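/- **Setting.** Let $\Lambda$ be a Grassmann (exterior) algebra over $\mathbb R$ on any real vector space of odd generators; the *body* of an element is its image in $\mathbb R$ when all odd generators are set to $0$. Every even element with positive body is invertible and has a unique even square root with positive body, written $\sqrt{\cdot}$. Let $P$ be a convex polygon with $n+3$ vertices, $T$ a triangulation of $P$, and $a\neq b$ two vertices of $P$ that are not joined by a side, such that the arc $(a,b)$ crosses all $n$ internal diagonals of $T$. Assign to each edge $e$ of $T$ (sides of $P$ included) a $\lambda$-length $x_e\in\Lambda$, even with positive body, and to each triangle a $\mu$-invariant, an odd element of $\Lambda$ (for instance the $x_e$ are positive real numbers and the $\mu$-invariants are free odd generators). Label the triangles $\theta_1,\dots,\theta_{n+1}$ in the order in which they are met from $a$ to $b$, and write $\theta_i$ also for their $\mu$-invariants; let $d_k$ be the diagonal between $\theta_k$ and $\theta_{k+1}$. **Fan centers, default orientation, positive order.** The fan center of $\theta_k$, $1<k<n+1$, is the common vertex of $d_{k-1}$ and $d_k$; $\theta_1$ and $\theta_{n+1}$ have the same fan center as their neighbour; if $n=1$, one end point of $d_1$ is chosen as the fan center of both triangles. In the default orientation, $d_k$ is oriented away from the fan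 center of $\theta_k$ (so away from the center inside a fan, and from the earlier to the later center where two fans meet); sides of $P$ are oriented arbitrarily. In the positive order, for each $k$, $\theta_k>\theta_i$ for all $i>k$ if $\theta_k$ lies to the right of the oriented diagonal $d_k$, and $\theta_k<\theta_i$ for all $i>k$ otherwise. **Super $\lambda$-length.** In an oriented triangulation with such data, consider a diagonal $e$ and the quadrilateral around it, drawn with $e$ pointing from left to right, with upper left, upper right, lower right and lower left sides $p,q,r,s$ (all these letters also denoting $\lambda$-lengths), and $\mu$-invariants $\theta$ above and $\sigma$ below $e$. The flip of $e$ replaces it by the other diagonal $f$, oriented upwards, reverses the orientation of the side $q$ only, and assigns $$ef=pr+qs+\sqrt{pqrs}\,\sigma\theta,\qquad \sigma'=\frac{\sigma\sqrt{qs}-\theta\sqrt{pr}}{\sqrt{pr+qs}},\qquad \theta'=\frac{\theta\sqrt{qs}+\sigma\sqrt{pr}}{\sqrt{pr+qs}},$$ with $\sigma'$ the $\mu$-invariant of the triangle on the right and $\theta'$ that of the triangle on the left of $f$. The super $\lambda$-length $\lambda_{a,b}$ is the $\lambda$-length of $(a,b)$ in a triangulation containing $(a,b)$ that is obtained from $T$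 by a sequence of flips. **Twisted super $T$-paths.** The twisted auxiliary graph $\Gamma$ has as vertices the vertices of $P$ and one internal vertex on the arc $(a,b)$ in each triangle $\theta_i$. Its edges are the edges of $T$; in each triangle two $\sigma$-edges, from the internal vertex to the two vertices of the triangle other than its fan center; and a $\tau$-edge $\tau_{ij}$ between any two internal vertices, $i<j$. A twisted super $T$-path from $a$ to $b$ is a walk in $\Gamma$ from $a$ to $b$ with steps $t_1,\dots,t_\ell$ such that: no edge is used twice; $\ell$ is odd; $t_i$ crosses $(a,b)$ if $i$ is even, where $\tau$-edges, but not $\sigma$-edges, are considered to cross $(a,b)$; $\tau_{ij}$ is traversed only towards $b$; $t_i$ is a $\sigma$-edge only if $i$ is odd and a $\tau$-edge only if $i$ is even; and if $i<j$ and both $t_i$ and $t_j$ cross $(a,b)$, then $t_i\cap(a,b)$ is closer to $a$ than $t_j\cap(a,b)$, where $\tau_{ij}\cap(a,b)$ is the whole segment of the arc between the internal vertices of $\theta_i$ and $\theta_j$. Let $\mathcal T_{a,b}$ be the set of these paths. The twisted weight $\mathrm{twt}(t_i)$ is $x_e$ if $t_i$ is an edge $e$ of $T$ and $i$ is odd,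 $x_e^{-1}$ if it is an edge $e$ of $T$ and $i$ is even, $1$ if $t_i$ is a $\tau$-edge, and $\sqrt{x_kx_l/x_j}\;\theta_s$ if $t_i$ is the $\sigma$-edge at the vertex $u$ of the triangle $\theta_s$, where $x_k,x_l$ are the $\lambda$-lengths of the two sides of this triangle at $u$, and $x_j$ is that of the side opposite to $u$. The twisted weight $\mathrm{twt}(t)$ of a path is the product of the weights of its steps, with the $\mu$-invariants multiplied in the positive order, the greatest first. **Theorem.** If the internal diagonals of $T$ carry the default orientation, then $\mathcal T_{a,b}$ is finite, some sequence of flips leads from $T$ to a triangulation that contains $(a,b)$, and for every such sequence the resulting $\lambda$-length of $(a,b)$ is $$\lambda_{a,b}=\sum_{t\in\mathcal T_{a,b}}\mathrm{twt}(t).$$ -/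

import Mathlib

noncomputable section

namespace SuperTeich

/-! ### The Grassmann algebra of coordinates -/

section Grassmann

variable {M : Type*} [AddCommGroup M] [Module ℝ M]

/-- The even part of the Grassmann algebra `Λ(M)` over `ℝ`. -/
def IsEven (x : ExteriorAlgebra ℝ M) : Prop :=
  x ∈ CliffordAlgebra.evenOdd (0 : QuadraticForm ℝ M) 0

/-- The odd part of the Grassmann algebra `Λ(M)` over `ℝ`. -/
def IsOdd (x : ExteriorAlgebra ℝ M) : Prop :=
  x ∈ CliffordAlgebra.evenOdd (0 : QuadraticForm ℝ M) 1

/-- The body of an element: its image in `ℝ` after all odd generators are set to zero. -/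
def body (x : ExteriorAlgebra ℝ M) : ℝ := ExteriorAlgebra.algebraMapInv x

/-- Even elements with positive body: the possible values of a super `λ`-length. -/
def IsPositive (x : ExteriorAlgebra ℝ M) : Prop := IsEven x ∧ 0 < body x

open Classical in
/-- The positive square root of an even element `x` with positive body: the even element with
positive body whose square is `x` (it exists and is unique for such `x`; `0` is a junk value). -/
def gsqrt (x : ExteriorAlgebra ℝ M) : ExteriorAlgebra ℝ M :=
  if h : ∃ y : ExteriorAlgebra ℝ M, IsPositive y ∧ y * y = x then h.choose else 0

end Grassmann

/-! ### Triangulated polygons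

The vertices of the polygon are the elements of `Fin N`, in counterclockwise order, so that
`sbtw i j k` says that `i, j, k` are distinct and are met in this order when going
counterclockwise around the polygon. -/

/-- The chords `i j` and `k l` cross in the interior of the polygon. -/
def Crosses {N : ℕ} (i j k l : Fin N) : Prop :=
  (sbtw i k j ∧ sbtw j l i) ∨ (sbtw i l j ∧ sbtw j k i)

/-- A triangulation of the polygon, given by the graph of its edges (sides of the polygon
included): a maximal set of pairwise noncrossing chords. -/
structure IsTriangulation {N : ℕ} (T : SimpleGraph (Fin N)) : Prop where
  noncrossing : ∀ i j k l, T.Adj i j → T.Adj k l → ¬ Crosses i j k l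
  maximal : ∀ i j, i ≠ j → (∀ k l, T.Adj k l → ¬ Crosses i j k l) → T.Adj i j

/-- `i` and `j` are adjacent vertices of the polygon. -/
def IsSide {n : ℕ} (i j : Fin (n + 3)) : Prop := j = i + 1 ∨ i = j + 1

/-- A triangulation together with the data of decorated super-Teichmüller theory. Edges are
two-element sets of vertices, triangles are three-element sets of vertices; the values of the
fields off the edges and triangles of `T` are irrelevant. -/
structure DecoratedTriangulation (N : ℕ) (M : Type*) [AddCommGroup M] [Module ℝ M] where
  /-- the triangulation -/
  T : SimpleGraph (Fin N)
  /-- the `λ`-lengths of the edges -/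
  lam : Finset (Fin N) → ExteriorAlgebra ℝ M
  /-- the `μ`-invariants of the triangles -/
  mu : Finset (Fin N) → ExteriorAlgebra ℝ M
  /-- the orientation: `dir i j` says that the edge `{i, j}` is oriented from `i` to `j` -/
  dir : Fin N → Fin N → Prop

namespace DecoratedTriangulation

variable {N : ℕ} {M : Type*} [AddCommGroup M] [Module ℝ M]

/-- `T` is a triangulation, its `λ`-lengths are even with positive body, its `μ`-invariants are
odd, and each edge is oriented in exactly one of its two directions. -/
structure IsValid (D : DecoratedTriangulation N M) : Prop where
  triangulation : IsTriangulation D.T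
  lam_pos : ∀ i j, D.T.Adj i j → IsPositive (D.lam {i, j})
  mu_odd : ∀ s, D.T.IsNClique 3 s → IsOdd (D.mu s)
  dir_iff : ∀ i j, D.T.Adj i j → (D.dir i j ↔ ¬ D.dir j i)

/-- The super Ptolemy transformation that flips the edge `P Q` inside the quadrilateral with
vertices `P, S, Q, R` in counterclockwise order, where the edge is oriented from `P` to `Q`.
With `e = PQ` drawn horizontally from left to right, `a = PR`, `b = RQ`, `c = QS`, `d = SP`,
`θ` the `μ`-invariant above and `σ` the one below `e`, and `f = SR` the new edge, with `σ'` on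
its right and `θ'` on its left:
* `e f = a c + b d + √(abcd) σ θ`,
* `σ' = (σ √(bd) - θ √(ac)) / √(ac + bd)`,
* `θ' = (θ √(bd) + σ √(ac)) / √(ac + bd)`;
the new edge is oriented from `S` to `R`, the orientation of `b` is reversed, and that of all
other edges is kept. -/
def flip (D : DecoratedTriangulation N M) (P S Q R : Fin N) : DecoratedTriangulation N M :=
  let e := D.lam {P, Q}
  let a := D.lam {P, R}
  let b := D.lam {R, Q}
  let c := D.lam {Q, S}
  let d := D.lam {S, P}
  let θ := D.mu {P, Q, R}
  let σ := D.mu {P, Q, S}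
  let r := Ring.inverse (gsqrt (a * c + b * d))
  { T := D.T.deleteEdges {s(P, Q)} ⊔ SimpleGraph.edge S R
    lam := Function.update D.lam {S, R}
      (Ring.inverse e * (a * c + b * d + gsqrt (a * b * c * d) * (σ * θ)))
    mu := Function.update
      (Function.update D.mu {P, R, S} ((θ * gsqrt (b * d) + σ * gsqrt (a * c)) * r))
      {Q, R, S} ((σ * gsqrt (b * d) - θ * gsqrt (a * c)) * r)
    dir := fun i j =>
      (i = S ∧ j = R) ∨ (s(i, j) = s(R, Q) ∧ D.dir j i) ∨
        (s(i, j) ≠ s(R, Q) ∧ s(i, j) ≠ s(S, R) ∧ D.dir i j) }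

/-- `D'` is obtained from `D` by a single flip: some diagonal `P Q` of the triangulation,
oriented from `P` to `Q`, with the triangle `P S Q` on its right and `P Q R` on its left,
is replaced by the other diagonal of the quadrilateral. -/
def FlipsTo (D D' : DecoratedTriangulation N M) : Prop :=
  ∃ P S Q R : Fin N, sbtw P S Q ∧ sbtw Q R P ∧
    D.T.Adj P Q ∧ D.T.Adj P S ∧ D.T.Adj S Q ∧ D.T.Adj Q R ∧ D.T.Adj R P ∧
    D.dir P Q ∧ D' = D.flip P S Q R

/-- `x` is the super `λ`-length of the arc `(a, b)`, as computed from `D` by some sequence of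
super Ptolemy transformations leading to a triangulation that contains the arc. -/
def IsLambdaLength (D : DecoratedTriangulation N M) (a b : Fin N)
    (x : ExteriorAlgebra ℝ M) : Prop :=
  ∃ D', Relation.ReflTransGen FlipsTo D D' ∧ D'.T.Adj a b ∧ x = D'.lam {a, b}

end DecoratedTriangulation

/-! ### Triangles in order along the arc, fan centers, default orientation, positive order -/

/-- The labels of the `n + 1` triangles of a triangulation of an `(n + 3)`-gon, and for each
triangle the center of the fan segment that contains it. -/
structure Labelling (n : ℕ) where
  /-- the vertex sets of the triangles `θ_0, …, θ_n` -/
  face : Fin (n + 1) → Finset (Fin (n + 3))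
  /-- the fan center of each triangle -/
  center : Fin (n + 1) → Fin (n + 3)

namespace Labelling

variable {n : ℕ} {M : Type*} [AddCommGroup M] [Module ℝ M]

/-- The `k`-th diagonal on the way from `a` to `b`: the common side of `θ_k` and `θ_{k+1}`. -/
def diag (L : Labelling n) (k : Fin n) : Finset (Fin (n + 3)) :=
  L.face k.castSucc ∩ L.face k.succ

/-- The triangles of `T` are labelled `θ_0, …, θ_n` in the order in which the arc from `a` to `b`
(which crosses all diagonals of `T`) meets them: the first one contains `a`, the last one
contains `b`, and consecutive ones share a diagonal. The fan center of a triangle is the vertex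
at which the diagonals bounding it meet (so it is a vertex of one of the small triangles cut out
by the arc and two consecutive diagonals); the first and the last triangle, which are bounded
by one diagonal only, belong to the same fan segment as their neighbour. If there is only one
diagonal, either of its end points may serve as the center of the fan. -/
structure IsLabelling (L : Labelling n) (T : SimpleGraph (Fin (n + 3)))
    (a b : Fin (n + 3)) : Prop where
  injective : Function.Injective L.face
  face_iff : ∀ s, (∃ k, L.face k = s) ↔ T.IsNClique 3 s
  first_mem : a ∈ L.face 0
  last_mem : b ∈ L.face (Fin.last n)
  card_diag : ∀ k, (L.diag k).card = 2
  center_mem_left : ∀ k : Fin n, L.center k.castSucc ∈ L.diag k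
  center_mem_right : ∀ k : Fin n, L.center k.succ ∈ L.diag k
  center_ends : ∀ k : Fin n, k.val = 0 ∨ k.val + 1 = n → L.center k.castSucc = L.center k.succ

/-- The default orientation of the diagonals: within a fan segment they are oriented away from
the center, and where two consecutive fan segments meet, the diagonal is oriented from the
center of the earlier one to the center of the later one. In both cases the diagonal between
`θ_k` and `θ_{k+1}` is oriented away from the fan center of `θ_k`. Sides of the polygon may be
oriented arbitrarily. -/
def IsDefault (L : Labelling n) (dir : Fin (n + 3) → Fin (n + 3) → Prop) : Prop :=
  ∀ k : Fin n, ∀ w ∈ L.diag k, w ≠ L.center k.castSucc → dir (L.center k.castSucc) w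

/-- The diagonal between `θ_k` and `θ_{k+1}` is oriented so that `θ_k` is on its right. -/
def OnRight (L : Labelling n) (dir : Fin (n + 3) → Fin (n + 3) → Prop) (k : Fin n) : Prop :=
  ∃ i ∈ L.diag k, ∃ j ∈ L.diag k, ∃ p ∈ L.face k.castSucc, dir i j ∧ sbtw i p j

/-- The positive order: `θ_i > θ_j`. For `k < l`, `θ_k > θ_l` if `θ_k` is to the right of the
oriented diagonal between `θ_k` and `θ_{k+1}`, and `θ_k < θ_l` otherwise. -/
def PosGT (L : Labelling n) (dir : Fin (n + 3) → Fin (n + 3) → Prop) (i j : Fin (n + 1)) :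
    Prop :=
  (∃ k : Fin n, k.castSucc = i ∧ i < j ∧ L.OnRight dir k) ∨
    (∃ k : Fin n, k.castSucc = j ∧ j < i ∧ ¬ L.OnRight dir k)

end Labelling

/-! ### The twisted auxiliary graph and twisted super T-paths -/

/-- Vertices of the auxiliary graph: the vertices of the polygon and one internal vertex for each
triangle, placed on the arc `(a, b)`. -/
inductive AuxVertex (n : ℕ) : Type
  | poly (v : Fin (n + 3)) : AuxVertex n
  | face (k : Fin (n + 1)) : AuxVertex n

namespace Labelling

variable {n : ℕ} {M : Type*} [AddCommGroup M] [Module ℝ M]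

/-- Adjacency in the twisted auxiliary graph: the edges of `T`; in each triangle, the two
`σ`-edges joining the internal vertex to the vertices of the triangle other than its fan center;
and the `τ`-edges joining any two internal vertices. -/
def AuxAdj (L : Labelling n) (T : SimpleGraph (Fin (n + 3))) : AuxVertex n → AuxVertex n → Prop
  | .poly u, .poly v => T.Adj u v
  | .poly u, .face k => u ∈ L.face k ∧ u ≠ L.center k
  | .face k, .poly u => u ∈ L.face k ∧ u ≠ L.center k
  | .face i, .face j => i ≠ j

/-- The twisted auxiliary graph. -/
def auxGraph (L : Labelling n) (T : SimpleGraph (Fin (n + 3))) : SimpleGraph (AuxVertex n) where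
  Adj := L.AuxAdj T
  symm := ⟨fun x y h => by
    cases x <;> cases y <;> simp_all [AuxAdj, T.adj_comm, eq_comm]⟩
  loopless := ⟨fun x h => by cases x <;> simp_all [AuxAdj]⟩

end Labelling

/-- Steps along `σ`-edges. -/
def IsSigma {n : ℕ} : AuxVertex n → AuxVertex n → Prop
  | .poly _, .face _ => True
  | .face _, .poly _ => True
  | _, _ => False

/-- Steps along `τ`-edges. -/
def IsTau {n : ℕ} : AuxVertex n → AuxVertex n → Prop
  | .face _, .face _ => True
  | _, _ => False

/-- Steps that cross the arc `(a, b)`; the `τ`-edges are considered to cross it. -/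
def CrossesArc {n : ℕ} (a b : Fin (n + 3)) : AuxVertex n → AuxVertex n → Prop
  | .poly u, .poly v => Crosses a b u v
  | .face _, .face _ => True
  | _, _ => False

/-- The steps along `τ`-edges that end closer to `b`, and all steps along other edges. -/
def TauForward {n : ℕ} : AuxVertex n → AuxVertex n → Prop
  | .face i, .face j => i < j
  | _, _ => True

namespace Labelling

variable {n : ℕ} {M : Type*} [AddCommGroup M] [Module ℝ M]

/-- The intersection of a step with the arc, in terms of the positions of the marked points of
the arc: on the way from `a` to `b` one meets the internal vertex `θ_0`, the diagonal `0`, the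
internal vertex `θ_1`, the diagonal `1`, and so on, at positions `0, 1, 2, 3, …`. A diagonal
meets the arc at a single point, the edge `τ_{ij}` in the whole segment between `θ_i`
and `θ_j`. -/
def arcPos (L : Labelling n) : AuxVertex n → AuxVertex n → Set ℕ
  | .poly u, .poly v => {p | ∃ k : Fin n, L.diag k = {u, v} ∧ p = 2 * k.val + 1}
  | .face i, .face j => Set.uIcc (2 * i.val) (2 * j.val)
  | _, _ => ∅

/-- Twisted super T-paths from `a` to `b`: walks in the twisted auxiliary graph from `a` to `b`
subject to the axioms below. The step from `w.getVert i` to `w.getVert (i + 1)` is the step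
number `i + 1`. -/
structure IsTwistedPath (L : Labelling n) {T : SimpleGraph (Fin (n + 3))} {a b : Fin (n + 3)}
    (w : (L.auxGraph T).Walk (.poly a) (.poly b)) : Prop where
  /-- no edge is used twice -/
  nodup : w.edges.Nodup
  /-- the number of steps is odd -/
  odd_length : Odd w.length
  /-- even steps cross the arc -/
  even_crosses : ∀ i < w.length, Even (i + 1) →
    CrossesArc a b (w.getVert i) (w.getVert (i + 1))
  /-- steps along `τ`-edges go towards `b` -/
  tau_forward : ∀ i < w.length, TauForward (w.getVert i) (w.getVert (i + 1))
  /-- `σ`-steps are odd -/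
  sigma_odd : ∀ i < w.length, IsSigma (w.getVert i) (w.getVert (i + 1)) → Odd (i + 1)
  /-- `τ`-steps are even -/
  tau_even : ∀ i < w.length, IsTau (w.getVert i) (w.getVert (i + 1)) → Even (i + 1)
  /-- of two steps crossing the arc, the earlier one crosses it closer to `a` -/
  crossings_ordered : ∀ i j, i < j → j < w.length →
    CrossesArc a b (w.getVert i) (w.getVert (i + 1)) →
    CrossesArc a b (w.getVert j) (w.getVert (j + 1)) →
    ∀ p ∈ L.arcPos (w.getVert i) (w.getVert (i + 1)),
    ∀ q ∈ L.arcPos (w.getVert j) (w.getVert (j + 1)), p < q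

/-- The set of twisted super T-paths from `a` to `b`. -/
def twistedPaths (L : Labelling n) (T : SimpleGraph (Fin (n + 3))) (a b : Fin (n + 3)) :
    Set ((L.auxGraph T).Walk (.poly a) (.poly b)) :=
  {w | L.IsTwistedPath w}

/-- The even factor `√(x_k x_l / x_j)` of the weight of the `σ`-edge at the vertex `u` of the
triangle `θ_s`, where `x_k, x_l` are the sides of the triangle at `u`, and `x_j` is the side
opposite to `u`. As `u` is not the fan center, the sides at `u` are the one joining it to the
fan center and the one opposite to the fan center. -/
def sigmaFactor (L : Labelling n) (D : DecoratedTriangulation (n + 3) M) (u : Fin (n + 3))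
    (s : Fin (n + 1)) : ExteriorAlgebra ℝ M :=
  gsqrt (D.lam {u, L.center s} * D.lam ((L.face s).erase (L.center s)) *
    Ring.inverse (D.lam ((L.face s).erase u)))

/-- The even factor of the twisted weight of step number `m`. -/
def evenFactor (L : Labelling n) (D : DecoratedTriangulation (n + 3) M) (m : ℕ) :
    AuxVertex n → AuxVertex n → ExteriorAlgebra ℝ M
  | .poly u, .poly v => if Odd m then D.lam {u, v} else Ring.inverse (D.lam {u, v})
  | .poly u, .face s => L.sigmaFactor D u s
  | .face s, .poly u => L.sigmaFactor D u s
  | .face _, .face _ => 1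

end Labelling

/-- The triangle whose `μ`-invariant occurs in the twisted weight of a step, if any. -/
def sigmaFace {n : ℕ} : AuxVertex n → AuxVertex n → Option (Fin (n + 1))
  | .poly _, .face s => some s
  | .face s, .poly _ => some s
  | _, _ => none

namespace Labelling

variable {n : ℕ} {M : Type*} [AddCommGroup M] [Module ℝ M]

open Classical in
/-- The twisted weight of a path: the product of the weights of its steps, where the product of
the `μ`-invariants is taken in the positive order, the greatest one first. -/
def twt (L : Labelling n) (D : DecoratedTriangulation (n + 3) M) {a b : Fin (n + 3)}
    (w : (L.auxGraph D.T).Walk (.poly a) (.poly b)) : ExteriorAlgebra ℝ M :=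
  ((List.range w.length).map
      (fun i => L.evenFactor D (i + 1) (w.getVert i) (w.getVert (i + 1)))).prod *
    ((((List.range w.length).filterMap
        (fun i => sigmaFace (w.getVert i) (w.getVert (i + 1)))).insertionSort
          (L.PosGT D.dir)).map (fun s => D.mu (L.face s))).prod

end Labelling

end SuperTeich

end

open SuperTeich

/-! To every vertex `i` of the polygon an even vector `u i` of the free supermodule of rank 2|1 over
the Grassmann algebra is attached. This module carries an orthosymplectic pairing (`pair`) and an
odd trilinear invariant (`bracket`). Up to signs, the λ-length of an edge is the pairing of its end
points, and the μ-invariant of a triangle, times the square root of the product of its three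
λ-lengths, is the bracket of its vertices (`Realizes`). The signs of the pairings come from the
linear order of the vertices that starts at `a`; a sign ε for each triangle records what the edge
orientations say (a spin structure).

Two identities drive everything. `pair_mul_ptolemy` expresses the failure of the classical Ptolemy
relation as a product of two brackets, and `pair_mul_bracket` is a three-term relation between
brackets with a common vertex. They are the flip formulas: after a flip the same vectors realize the
new data, with other signs ε (`Realizes.flip`). A triangulation with the default orientation is
realized by attaching its triangles one after the other, since a vector is determined by two
pairings and one bracket that may be prescribed (`exists_vector`). So every flip sequence that
reaches the arc yields the signed pairing of `u a` and `u b`, and flipping the diagonals in their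
order along the arc does reach it.

On the side of the paths, a twisted path is a word read by a finite automaton that remembers the
position along the arc, the parity of the next step and the current vertex. The sums over the
possible ends of paths obey a recursion along the arc, solved from `b` backwards in closed form
(`ClosedForm`). From an end `v` of a diagonal `{v, w}`, before an even step, the sum is
λ(w,b)/λ(v,w); over ends that begin with a τ-edge out of the triangle in front of the diagonal `{r,
l}`, it is the bracket of `r, b, l` divided by λ(r,l). The induction step and the final step at `a`
are again the two identities.

Two global conditions have to become local for this. That no edge is used twice follows from the
order of the crossings (`edges_nodup`). The positive order of the μ-invariants turns into one sign
per pair of σ-steps, because these steps come in pairs (`evenProd_mul_sortedProd`). -/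

noncomputable section

namespace SuperTeich

/-! ### The even and odd parts of the Grassmann algebra: commutation, units, square roots. -/

section EvenOdd

variable {M : Type*} [AddCommGroup M] [Module ℝ M]

/-- Moving a generator past two others changes the sign twice. Since such pairs generate the even
part, this is the source of its centrality. -/
theorem ι_pair_commute (v w : M) (y : ExteriorAlgebra ℝ M) :
    Commute (ExteriorAlgebra.ι ℝ v * ExteriorAlgebra.ι ℝ w) y := by
  induction y using ExteriorAlgebra.induction with
  | algebraMap r => exact (Algebra.commutes r _).symm
  | ι x =>
    have h1 := eq_neg_of_add_eq_zero_left (ExteriorAlgebra.ι_add_mul_swap (R := ℝ) w x)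
    have h2 := eq_neg_of_add_eq_zero_left (ExteriorAlgebra.ι_add_mul_swap (R := ℝ) v x)
    rw [commute_iff_eq, mul_assoc, h1, mul_neg, ← mul_assoc, h2, neg_mul, neg_neg, mul_assoc]
  | mul a b ha hb => exact ha.mul_right hb
  | add a b ha hb => exact ha.add_right hb

theorem IsEven.commute {x : ExteriorAlgebra ℝ M} (hx : IsEven x) (y : ExteriorAlgebra ℝ M) :
    Commute x y := by
  induction x, hx using CliffordAlgebra.even_induction with
  | algebraMap r => exact Algebra.commutes r y
  | add a b _ _ ha hb => exact ha.add_left hb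
  | ι_mul_ι_mul v w a _ ha => exact (ι_pair_commute v w y).mul_left ha

theorem IsOdd.anticomm {x y : ExteriorAlgebra ℝ M} (hx : IsOdd x) (hy : IsOdd y) :
    x * y = -(y * x) := by
  induction x, hx using CliffordAlgebra.odd_induction with
  | ι v =>
    induction y, hy using CliffordAlgebra.odd_induction with
    | ι w => exact eq_neg_of_add_eq_zero_left (ExteriorAlgebra.ι_add_mul_swap (R := ℝ) v w)
    | add a b _ _ ha hb => rw [mul_add, ha, hb, add_mul, neg_add]
    | ι_mul_ι_mul w w' a _ ha =>
      have h := (ι_pair_commute w w' (ExteriorAlgebra.ι ℝ v)).eq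
      change _ * (ExteriorAlgebra.ι ℝ w * ExteriorAlgebra.ι ℝ w' * a) = -(ExteriorAlgebra.ι ℝ w *
        ExteriorAlgebra.ι ℝ w' * a * _)
      rw [← mul_assoc, ← h, mul_assoc, ha, mul_neg]
      exact congrArg _ (mul_assoc _ _ _).symm
  | add a b _ _ ha hb => rw [add_mul, ha, hb, mul_add, neg_add]
  | ι_mul_ι_mul w w' a _ ha =>
    rw [mul_assoc, ha, mul_neg, ← mul_assoc, (ι_pair_commute w w' y).eq, mul_assoc]

theorem IsOdd.mul_self {x : ExteriorAlgebra ℝ M} (hx : IsOdd x) : x * x = 0 :=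
  have h : (2 : ℝ) • (x * x) = 0 := by
    rw [two_smul]; exact eq_neg_iff_add_eq_zero.mp (hx.anticomm hx)
  (smul_eq_zero.mp h).resolve_left two_ne_zero

/-- A product of two generators is central and has square zero, so every multiple of it is
nilpotent; sums stay nilpotent because even elements commute. Inverses and square roots of even
elements are obtained from the body by means of this. -/
theorem IsEven.isNilpotent_sub_body {x : ExteriorAlgebra ℝ M} (hx : IsEven x) :
    IsNilpotent (x - algebraMap ℝ _ (body x)) := by
  induction x, hx using CliffordAlgebra.even_induction with
  | algebraMap r =>
    have : body (algebraMap ℝ (ExteriorAlgebra ℝ M) r) = r :=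
      ExteriorAlgebra.algebraMap_leftInverse M r
    rw [show (algebraMap ℝ (CliffordAlgebra (0 : QuadraticForm ℝ M)) r) =
      algebraMap ℝ (ExteriorAlgebra ℝ M) r from rfl, this, sub_self]
    exact IsNilpotent.zero
  | add a b ha hb h1 h2 =>
    have hc : Commute (a - algebraMap ℝ _ (body a)) (b - algebraMap ℝ _ (body b)) :=
      Commute.sub_left (IsEven.commute ha _) (Algebra.commutes _ _)
    have := hc.isNilpotent_add h1 h2
    rwa [show a - algebraMap ℝ _ (body a) + (b - algebraMap ℝ _ (body b)) =
      a + b - algebraMap ℝ _ (body (a + b)) by simp [body]; abel] at this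
  | ι_mul_ι_mul v w a ha _ =>
    have hb : body (CliffordAlgebra.ι 0 v * CliffordAlgebra.ι 0 w * a : ExteriorAlgebra ℝ M) = 0 := by
      have : body (CliffordAlgebra.ι 0 v : ExteriorAlgebra ℝ M) = 0 := by
        simp [body, ExteriorAlgebra.algebraMapInv]
      have h2 := this
      simp only [body] at h2 ⊢
      rw [map_mul, map_mul, h2, zero_mul, zero_mul]
    rw [hb, map_zero, sub_zero]
    refine (ι_pair_commute v w a).isNilpotent_mul_right ⟨2, ?_⟩
    have h3 := (ι_pair_commute v w (ExteriorAlgebra.ι ℝ v)).eq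
    have h4 := ExteriorAlgebra.ι_sq_zero (R := ℝ) v
    change ExteriorAlgebra.ι ℝ v * ExteriorAlgebra.ι ℝ w * ExteriorAlgebra.ι ℝ v = _ at h3
    rw [pow_two, ← mul_assoc]
    change ExteriorAlgebra.ι ℝ v * ExteriorAlgebra.ι ℝ w * ExteriorAlgebra.ι ℝ v * _ = 0
    rw [h3, ← mul_assoc, h4, zero_mul, zero_mul]

variable (M) in
/-- The even part of the Grassmann algebra, as a commutative ring. -/
def Ev : Type _ := CliffordAlgebra.even (0 : QuadraticForm ℝ M)

variable (M) in
/-- The odd part of the Grassmann algebra, as a module over the even part. -/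
def Od : Type _ := CliffordAlgebra.evenOdd (0 : QuadraticForm ℝ M) 1

instance : Ring (Ev M) :=
  inferInstanceAs (Ring (CliffordAlgebra.even (0 : QuadraticForm ℝ M)))

instance : CommRing (Ev M) where
  mul_comm x y := Subtype.ext (IsEven.commute x.2 y.1).eq

instance : Algebra ℝ (Ev M) :=
  inferInstanceAs (Algebra ℝ (CliffordAlgebra.even (0 : QuadraticForm ℝ M)))

instance : AddCommGroup (Od M) :=
  inferInstanceAs (AddCommGroup (CliffordAlgebra.evenOdd (0 : QuadraticForm ℝ M) 1))

instance : CoeOut (Ev M) (ExteriorAlgebra ℝ M) := ⟨Subtype.val⟩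

instance : CoeOut (Od M) (ExteriorAlgebra ℝ M) := ⟨Subtype.val⟩

theorem IsEven.mul_isOdd {x y : ExteriorAlgebra ℝ M} (hx : IsEven x) (hy : IsOdd y) :
    IsOdd (x * y) := by
  have := SetLike.mul_mem_graded hx hy
  rwa [zero_add] at this

theorem IsOdd.mul_isOdd {x y : ExteriorAlgebra ℝ M} (hx : IsOdd x) (hy : IsOdd y) :
    IsEven (x * y) := by
  have := SetLike.mul_mem_graded hx hy
  rwa [show (1 : ZMod 2) + 1 = 0 from by decide] at this

instance : SMul (Ev M) (Od M) := ⟨fun x y => ⟨x.1 * y.1, IsEven.mul_isOdd x.2 y.2⟩⟩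

theorem coe_smul_Od (x : Ev M) (y : Od M) :
    ((x • y : Od M) : ExteriorAlgebra ℝ M) = x.1 * y.1 := rfl

instance : Module (Ev M) (Od M) where
  one_smul _ := Subtype.ext (one_mul _)
  mul_smul _ _ _ := Subtype.ext (mul_assoc _ _ _)
  smul_zero _ := Subtype.ext (mul_zero _)
  smul_add _ _ _ := Subtype.ext (mul_add _ _ _)
  add_smul _ _ _ := Subtype.ext (add_mul _ _ _)
  zero_smul _ := Subtype.ext (zero_mul _)

variable (M) in
/-- The product of two odd elements. -/
def oddMul : Od M →ₗ[Ev M] Od M →ₗ[Ev M] Ev M :=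
  LinearMap.mk₂ _ (fun x y => ⟨x.1 * y.1, IsOdd.mul_isOdd x.2 y.2⟩)
    (fun _ _ _ => Subtype.ext (add_mul _ _ _))
    (fun _ _ _ => Subtype.ext (mul_assoc _ _ _))
    (fun _ _ _ => Subtype.ext (mul_add _ _ _))
    (fun x y z => Subtype.ext (by
      change y.1 * (x.1 * z.1) = x.1 * (y.1 * z.1)
      rw [← mul_assoc, ← (IsEven.commute x.2 y.1).eq, mul_assoc]))

@[simp] theorem coe_oddMul (x y : Od M) :
    ((oddMul M x y : Ev M) : ExteriorAlgebra ℝ M) = x.1 * y.1 := rfl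

theorem oddMul_self (x : Od M) : oddMul M x x = 0 := Subtype.ext (IsOdd.mul_self x.2)

/-- The product of `y` and `z` is even and may be moved past `x`. Used as a rewriting rule, this
cyclic invariance replaces the tracking of signs in triple products of odd elements. -/
theorem oddMul_smul (x y z : Od M) : oddMul M x y • z = oddMul M y z • x :=
  Subtype.ext (by
    change x.1 * y.1 * z.1 = y.1 * z.1 * x.1
    rw [mul_assoc, (IsEven.commute (IsOdd.mul_isOdd y.2 z.2) x.1).eq])

variable (M) in
/-- The body map on the even part. -/
def evBody : Ev M →+* ℝ :=
  ((ExteriorAlgebra.algebraMapInv (R := ℝ) (M := M)).comp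
    (CliffordAlgebra.even (0 : QuadraticForm ℝ M)).val : _ →ₐ[ℝ] ℝ).toRingHom

/-- Positivity of the body of an even element. -/
def Pos (x : Ev M) : Prop := 0 < evBody M x

theorem isPositive_coe {x : Ev M} : IsPositive (x : ExteriorAlgebra ℝ M) ↔ Pos x :=
  ⟨fun h => h.2, fun h => ⟨x.2, h⟩⟩

theorem Ev.isNilpotent_sub_body (x : Ev M) :
    IsNilpotent (x - algebraMap ℝ (Ev M) (evBody M x)) := by
  obtain ⟨k, hk⟩ := IsEven.isNilpotent_sub_body x.2
  exact ⟨k, Subtype.ext hk⟩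

theorem evBody_algebraMap (r : ℝ) : evBody M (algebraMap ℝ (Ev M) r) = r :=
  ExteriorAlgebra.algebraMap_leftInverse M r

theorem isUnit_of_evBody_ne_zero {x : Ev M} (hx : evBody M x ≠ 0) : IsUnit x := by
  have h : IsUnit (algebraMap ℝ (Ev M) (evBody M x)) := (isUnit_iff_ne_zero.mpr hx).map _
  have := (x.isNilpotent_sub_body).isUnit_add_right_of_commute h (Commute.all _ _)
  rwa [sub_add_cancel] at this

theorem Pos.isUnit {x : Ev M} (hx : Pos x) : IsUnit x := isUnit_of_evBody_ne_zero hx.ne'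

theorem Pos.mul {x y : Ev M} (hx : Pos x) (hy : Pos y) : Pos (x * y) := by
  unfold Pos; rw [map_mul]; exact mul_pos hx hy

theorem Pos.add {x y : Ev M} (hx : Pos x) (hy : Pos y) : Pos (x + y) := by
  unfold Pos; rw [map_add]; exact add_pos hx hy

/-- The square of the product vanishes, and ℝ has no nilpotents. -/
theorem evBody_oddMul (x y : Od M) : evBody M (oddMul M x y) = 0 := by
  have h : oddMul M x y * oddMul M x y = 0 := by
    apply Subtype.ext
    change x.1 * y.1 * (x.1 * y.1) = 0
    rw [← mul_assoc, IsOdd.anticomm x.2 y.2, neg_mul, mul_assoc y.1, IsOdd.mul_self x.2, mul_zero,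
      neg_zero, zero_mul]
  have := congrArg (evBody M) h
  rw [map_mul, map_zero] at this
  exact mul_self_eq_zero.mp this

/-- Newton's method, started at the real square root of the body: there X² - x takes a nilpotent
value, while its derivative has nonzero body and is a unit. -/
theorem exists_sqrt {x : Ev M} (hx : Pos x) : ∃ y : Ev M, Pos y ∧ y * y = x := by
  set s : Ev M := algebraMap ℝ _ (Real.sqrt (evBody M x)) with hs
  have hsp : 0 < Real.sqrt (evBody M x) := Real.sqrt_pos.mpr hx
  have hss : s * s = algebraMap ℝ (Ev M) (evBody M x) := by
    rw [hs, ← map_mul, Real.mul_self_sqrt (le_of_lt hx)]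
  have hbs : evBody M s = Real.sqrt (evBody M x) := evBody_algebraMap _
  obtain ⟨r, ⟨hr1, hr2⟩, -⟩ := Polynomial.existsUnique_nilpotent_sub_and_aeval_eq_zero
    (P := (Polynomial.X ^ 2 - Polynomial.C x : Polynomial (Ev M))) (x := s)
    (by
      simp only [map_sub, map_pow, Polynomial.aeval_X, Polynomial.aeval_C, Algebra.algebraMap_self,
        RingHom.id_apply]
      rw [pow_two, hss, ← neg_sub, isNilpotent_neg_iff]
      exact x.isNilpotent_sub_body)
    (by
      apply isUnit_of_evBody_ne_zero
      simp only [Polynomial.derivative_sub, Polynomial.derivative_X_pow, Polynomial.derivative_C]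
      have h2 : evBody M 2 = 2 := map_ofNat _ 2
      simp [hbs, hsp.ne', h2])
  refine ⟨r, ?_, ?_⟩
  · have h1 : evBody M (s - r) = 0 := (hr1.map (evBody M)).eq_zero
    rw [map_sub, hbs, sub_eq_zero] at h1
    unfold Pos
    rw [← h1]; exact hsp
  · simpa [sub_eq_zero, pow_two] using hr2

/-- In (x + y)(x - y) = 0 the first factor has positive body, hence is a unit. -/
theorem sqrt_unique {x y : Ev M} (hx : Pos x) (hy : Pos y) (h : x * x = y * y) : x = y := by
  have h1 : (x + y) * (x - y) = 0 := by linear_combination h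
  exact sub_eq_zero.mp ((hx.add hy).isUnit.mul_right_eq_zero.mp h1)

open Classical in
/-- The positive square root of an even element with positive body. -/
def esqrt (x : Ev M) : Ev M := if h : ∃ y : Ev M, Pos y ∧ y * y = x then h.choose else 0

theorem esqrt_pos {x : Ev M} (hx : Pos x) : Pos (esqrt x) := by
  have h := exists_sqrt hx
  rw [esqrt, dif_pos h]; exact h.choose_spec.1

theorem esqrt_mul_self {x : Ev M} (hx : Pos x) : esqrt x * esqrt x = x := by
  have h := exists_sqrt hx
  rw [esqrt, dif_pos h]; exact h.choose_spec.2

theorem esqrt_eq {x y : Ev M} (hy : Pos y) (h : y * y = x) : esqrt x = y := by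
  have hx : Pos x := h ▸ hy.mul hy
  exact sqrt_unique (esqrt_pos hx) hy ((esqrt_mul_self hx).trans h.symm)

theorem esqrt_mul {x y : Ev M} (hx : Pos x) (hy : Pos y) :
    esqrt (x * y) = esqrt x * esqrt y :=
  esqrt_eq ((esqrt_pos hx).mul (esqrt_pos hy)) (by
    linear_combination (y) * esqrt_mul_self hx + (esqrt x * esqrt x) * esqrt_mul_self hy)

theorem gsqrt_coe {x : Ev M} (hx : Pos x) :
    gsqrt (x : ExteriorAlgebra ℝ M) = (esqrt x : Ev M) := by
  have h : ∃ y : ExteriorAlgebra ℝ M, IsPositive y ∧ y * y = x :=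
    ⟨esqrt x, isPositive_coe.mpr (esqrt_pos hx), congrArg Subtype.val (esqrt_mul_self hx)⟩
  rw [gsqrt, dif_pos h]
  obtain ⟨h1, h2⟩ := h.choose_spec
  have h3 : (⟨h.choose, h1.1⟩ : Ev M) = esqrt x :=
    (esqrt_eq (y := ⟨h.choose, h1.1⟩) h1.2 (Subtype.ext h2)).symm
  exact congrArg Subtype.val h3

theorem Pos.inverse {x : Ev M} (hx : Pos x) : Pos (Ring.inverse x) := by
  have h := congrArg (evBody M) (Ring.mul_inverse_cancel x hx.isUnit)
  rw [map_mul, map_one] at h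
  exact pos_of_mul_pos_right (h ▸ one_pos) hx.le

theorem inverse_coe {x : Ev M} (hx : Pos x) :
    Ring.inverse (x : ExteriorAlgebra ℝ M) = (Ring.inverse x : Ev M) := by
  have h1 : (x : ExteriorAlgebra ℝ M) * (Ring.inverse x : Ev M) = 1 :=
    congrArg Subtype.val (Ring.mul_inverse_cancel x hx.isUnit)
  have h2 : ((Ring.inverse x : Ev M) : ExteriorAlgebra ℝ M) * x = 1 :=
    congrArg Subtype.val (Ring.inverse_mul_cancel x hx.isUnit)
  have h3 : IsUnit (x : ExteriorAlgebra ℝ M) := ⟨⟨_, _, h1, h2⟩, rfl⟩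
  exact (h3.mul_left_cancel ((Ring.mul_inverse_cancel _ h3).trans h1.symm))

theorem exists_coe_of_isPositive {x : ExteriorAlgebra ℝ M} (hx : IsPositive x) :
    ∃ y : Ev M, x = y ∧ Pos y := ⟨⟨x, hx.1⟩, rfl, hx.2⟩

end EvenOdd

end SuperTeich

end

/-! ### Orthosymplectic geometry in rank 2|1: the pairing, the bracket and their relations. -/

noncomputable section

namespace SuperTeich

section Vectors

variable {M : Type*} [AddCommGroup M] [Module ℝ M]

variable (M) in
/-- The opposite product of odd elements. -/
def oppMul : Od M →ₗ[Ev M] Od M →ₗ[Ev M] Ev M := -oddMul M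

theorem oppMul_eq (x y : Od M) : oppMul M x y = -oddMul M x y := rfl

theorem oppMul_self (x : Od M) : oppMul M x x = 0 := by
  rw [oppMul_eq, oddMul_self, neg_zero]

theorem oppMul_swap (x y : Od M) : oppMul M y x = -oppMul M x y := by
  have h := oppMul_self (x + y)
  simp only [map_add, LinearMap.add_apply, oppMul_self] at h
  linear_combination h

theorem oppMul_smul (x y z : Od M) : oppMul M x y • z = oppMul M y z • x := by
  rw [oppMul_eq, oppMul_eq, neg_smul, neg_smul, oddMul_smul]

theorem oppMul_smul_left (x y : Od M) : oppMul M x y • x = 0 := by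
  rw [oppMul_smul, oppMul_smul, oppMul_self, zero_smul]

theorem oppMul_smul_swap (x y z : Od M) : oppMul M x z • y = -(oppMul M x y • z) := by
  rw [oppMul_smul, oppMul_swap, neg_smul, ← oppMul_smul]

theorem oppMul_mul (x y z w : Od M) :
    oppMul M x y * oppMul M z w = oppMul M y z * oppMul M x w := by
  have h := congrArg (fun t => oppMul M t w) (oppMul_smul x y z)
  simpa using h

theorem oppMul_mul_left (x y z : Od M) : oppMul M x y * oppMul M x z = 0 := by
  have h := congrArg (fun t => oppMul M t z) (oppMul_smul_left x y)
  simpa using h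

variable (M) in
/-- Even vectors in the free super module of rank `2|1`. -/
structure SVec where
  /-- first even coordinate -/
  x : Ev M
  /-- second even coordinate -/
  y : Ev M
  /-- odd coordinate -/
  o : Od M

/-- The orthosymplectic pairing. -/
def pair (u v : SVec M) : Ev M := u.x * v.y - u.y * v.x + oppMul M u.o v.o

/-- The odd trilinear orthosymplectic invariant. -/
def bracket (u v w : SVec M) : Od M :=
  pair v w • u.o + pair w u • v.o + pair u v • w.o - oppMul M u.o v.o • w.o

theorem pair_swap (u v : SVec M) : pair v u = -pair u v := by
  simp only [pair, oppMul_swap u.o v.o]; ring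

/-- Only the correction term looks asymmetric, and products of three odd elements are cyclically
invariant. -/
theorem bracket_cyclic (u v w : SVec M) : bracket v w u = bracket u v w := by
  simp only [bracket]
  linear_combination (norm := module) oppMul_smul u.o v.o w.o

theorem bracket_swap (u v w : SVec M) : bracket v u w = -bracket u v w := by
  simp only [bracket, pair_swap u v, pair_swap u w, pair_swap v w, oppMul_swap u.o v.o]
  module

/-- Odd analogue of the Plücker relation, with `u` as common vertex: in the coefficient of `u.o` the
classical Plücker relation cancels the purely even terms, and what remains is compensated by the
correction terms of the brackets. It governs the μ-invariants under a flip. -/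
theorem pair_mul_bracket (u v w t : SVec M) :
    pair u w • bracket u v t = pair u t • bracket u v w + pair u v • bracket u w t := by
  have h1 := oppMul_smul_left u.o w.o
  have h2 := oppMul_smul_swap u.o v.o w.o
  have h3 := oppMul_smul_left u.o t.o
  have h4 := oppMul_smul_swap u.o v.o t.o
  have h5 := oppMul_smul_swap u.o w.o t.o
  have h6 := oppMul_smul_left u.o v.o
  have h7 : (oppMul M u.o v.o * oppMul M u.o w.o) • t.o = 0 := by rw [oppMul_mul_left, zero_smul]
  have h8 : (oppMul M u.o t.o * oppMul M u.o v.o) • w.o = 0 := by rw [oppMul_mul_left, zero_smul]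
  have e1 := pair_swap u v
  have e2 := pair_swap u w
  have e3 := pair_swap u t
  -- The even coordinates satisfy the classical Plücker relation, so only terms with at least one
  -- product of odd coordinates survive.
  have key : pair u w • pair v t - pair u t • pair v w - pair u v * pair w t =
      oppMul M u.o w.o * (v.x * t.y - v.y * t.x) + (u.x * w.y - u.y * w.x) * oppMul M v.o t.o
      - oppMul M u.o t.o * (v.x * w.y - v.y * w.x) - (u.x * t.y - u.y * t.x) * oppMul M v.o w.o
      - oppMul M u.o v.o * (w.x * t.y - w.y * t.x) - (u.x * v.y - u.y * v.x) * oppMul M w.o t.o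
      + oppMul M u.o w.o * oppMul M v.o t.o - oppMul M u.o t.o * oppMul M v.o w.o
      - oppMul M u.o v.o * oppMul M w.o t.o := by
    simp only [pair, smul_eq_mul]; ring
  have k2 : (pair u w • pair v t - pair u t • pair v w - pair u v * pair w t) • u.o =
      (u.x * w.y - u.y * w.x) • oppMul M u.o v.o • t.o
      - (u.x * t.y - u.y * t.x) • oppMul M u.o v.o • w.o
      - (u.x * v.y - u.y * v.x) • oppMul M u.o w.o • t.o := by
    rw [key]
    have a1 := oppMul_smul u.o v.o t.o
    have a2 := oppMul_smul u.o v.o w.o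
    have a3 := oppMul_smul u.o w.o t.o
    have b1 : (oppMul M u.o w.o * oppMul M v.o t.o) • u.o = 0 := by
      rw [mul_comm, mul_smul, h1, smul_zero]
    have b2 : (oppMul M u.o t.o * oppMul M v.o w.o) • u.o = 0 := by
      rw [mul_comm, mul_smul, h3, smul_zero]
    have b3 : (oppMul M u.o v.o * oppMul M w.o t.o) • u.o = 0 := by
      rw [mul_comm, mul_smul, h6, smul_zero]
    linear_combination (norm := module) (v.x * t.y - v.y * t.x) • h1 - (v.x * w.y - v.y * w.x) • h3
      - (w.x * t.y - w.y * t.x) • h6 - (u.x * w.y - u.y * w.x) • a1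
      + (u.x * t.y - u.y * t.x) • a2 + (u.x * v.y - u.y * v.x) • a3 + b1 - b2 - b3
  simp only [bracket, e2, e3]
  have p1 : pair u w = (u.x * w.y - u.y * w.x) + oppMul M u.o w.o := rfl
  have p2 : pair u t = (u.x * t.y - u.y * t.x) + oppMul M u.o t.o := rfl
  have p3 : pair u v = (u.x * v.y - u.y * v.x) + oppMul M u.o v.o := rfl
  have q1 : pair u w • oppMul M u.o v.o • t.o = (u.x * w.y - u.y * w.x) • oppMul M u.o v.o • t.o := by
    rw [p1]; linear_combination (norm := module) h7
  have q2 : pair u t • oppMul M u.o v.o • w.o = (u.x * t.y - u.y * t.x) • oppMul M u.o v.o • w.o := by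
    rw [p2]; linear_combination (norm := module) h8
  have q3 : pair u v • oppMul M u.o w.o • t.o = (u.x * v.y - u.y * v.x) • oppMul M u.o w.o • t.o := by
    rw [p3]; linear_combination (norm := module) h7
  simp only [smul_eq_mul] at k2
  linear_combination (norm := module) k2 - q1 + q2 + q3

/-- The Plücker relation for the even coordinates makes the defect in the Ptolemy relation a
combination of products of odd coordinates; multiplied by the diagonal `pair u w`, it factors into
the brackets of the two triangles on this diagonal. It governs the λ-lengths under a flip. -/
theorem pair_mul_ptolemy (u v w t : SVec M) :
    pair u w * (pair u w * pair v t - pair u v * pair w t - pair v w * pair u t) =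
      oddMul M (bracket u v w) (bracket u w t) := by
  have e0 : oddMul M (bracket u v w) (bracket u w t) =
    -oppMul M (bracket u v w) (bracket u w t) := by rw [oppMul_eq, neg_neg]
  have hK : pair u w * pair v t - pair u v * pair w t - pair v w * pair u t =
      oppMul M u.o w.o * pair v t + pair u w * oppMul M v.o t.o - oppMul M u.o w.o * oppMul M v.o t.o
      - oppMul M u.o v.o * pair w t - pair u v * oppMul M w.o t.o + oppMul M u.o v.o * oppMul M w.o t.o
      - oppMul M v.o w.o * pair u t - pair v w * oppMul M u.o t.o
      + oppMul M v.o w.o * oppMul M u.o t.o := by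
    simp only [pair]; ring
  have r := oppMul_mul u.o w.o v.o t.o
  have s13 := oppMul_mul_left u.o w.o w.o
  have s12 := oppMul_mul_left u.o w.o v.o
  have s14 := oppMul_mul_left u.o w.o t.o
  have s23 := oppMul_mul_left w.o u.o v.o
  have s34 := oppMul_mul_left w.o u.o t.o
  rw [oppMul_swap v.o w.o] at r
  rw [oppMul_swap u.o w.o, oppMul_swap v.o w.o] at s23
  rw [oppMul_swap u.o w.o] at s34
  rw [e0]
  simp only [bracket, map_add, map_sub, map_smul, LinearMap.add_apply, LinearMap.sub_apply,
    LinearMap.smul_apply, smul_eq_mul, oppMul_self, pair_swap u w, pair_swap u t,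
    oppMul_swap u.o v.o, oppMul_swap u.o w.o]
  linear_combination (pair u w + oppMul M u.o w.o) * hK + (pair v t - oppMul M v.o t.o) * s13
    + pair u w * r + 2 * oppMul M w.o t.o * s12 + 2 * pair u v * s34
    + (-pair u t + oppMul M u.o t.o) * s23 - 2 * pair v w * s14

/-- `u` and `v` span the even directions because their pairing is a unit, and their brackets with
combinations of themselves vanish. The two pairings thus fix the coefficients along `u` and `v`, and
the bracket fixes a component orthogonal to both. -/
theorem exists_vector (u v : SVec M) (huv : Pos (pair u v)) (p q : Ev M) (ψ : Od M) :
    ∃ w, pair u w = p ∧ pair v w = q ∧ bracket u v w = ψ := by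
  obtain ⟨D, hD⟩ : ∃ D, D = u.x * v.y - u.y * v.x := ⟨_, rfl⟩
  have hpD : pair u v = D + oppMul M u.o v.o := by rw [hD]; rfl
  have hDu : IsUnit D := by
    apply Pos.isUnit
    have : evBody M (oppMul M u.o v.o) = 0 := by rw [oppMul_eq, map_neg, evBody_oddMul, neg_zero]
    unfold Pos at huv ⊢
    rwa [hpD, map_add, this, add_zero] at huv
  obtain ⟨i, hi⟩ := hDu.exists_right_inv
  obtain ⟨j, hj⟩ := huv.isUnit.exists_right_inv
  have hpu : ∀ X Y : Ev M, ∀ r : Od M, pair u ⟨X, Y, r⟩ = u.x * Y - u.y * X + oppMul M u.o r :=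
    fun _ _ _ => rfl
  have hpv : ∀ X Y : Ev M, ∀ r : Od M, pair v ⟨X, Y, r⟩ = v.x * Y - v.y * X + oppMul M v.o r :=
    fun _ _ _ => rfl
  have h21 := oppMul_swap u.o v.o
  -- The coefficients with `j` produce the prescribed pairings. The remaining summand has odd
  -- coordinate `i • ψ`, and its even coordinates are chosen to make it orthogonal to `u` and `v`.
  obtain ⟨w, hw⟩ : ∃ w : SVec M, w =
    ⟨-(j * q) * u.x + (j * p) * v.x +
        i * (u.x * oppMul M v.o (i • ψ) - v.x * oppMul M u.o (i • ψ)),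
      -(j * q) * u.y + (j * p) * v.y +
        i * (u.y * oppMul M v.o (i • ψ) - v.y * oppMul M u.o (i • ψ)),
      (-(j * q)) • u.o + (j * p) • v.o + i • ψ⟩ := ⟨_, rfl⟩
  have e1 : pair u w = p := by
    rw [hw, hpu]
    simp only [map_add, map_smul, smul_eq_mul, oppMul_self]
    rw [hpD] at hj
    linear_combination p * hj - i * oppMul M u.o ψ * (hi) + (-j * p) * hD + i * i * oppMul M u.o ψ * hD
  have e2 : pair v w = q := by
    rw [hw, hpv]
    simp only [map_add, map_smul, smul_eq_mul, oppMul_self, h21]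
    rw [hpD] at hj
    linear_combination q * hj - i * oppMul M v.o ψ * (hi) + (-j * q) * hD + i * i * oppMul M v.o ψ * hD
  refine ⟨w, e1, e2, ?_⟩
  have e3 : w.o = (-(j * q)) • u.o + (j * p) • v.o + i • ψ := by rw [hw]
  rw [bracket, e2, pair_swap u w, e1, e3, hpD]
  have s1 := oppMul_smul_left u.o v.o
  have s2 : oppMul M u.o v.o • v.o = 0 := by
    rw [oppMul_smul, oppMul_self, zero_smul]
  have hj' : (D + oppMul M u.o v.o) * j = 1 := by rw [← hpD, hj]
  have c1 : (D * j) • u.o = u.o := by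
    have := congrArg (fun t => t • u.o) hj'
    simp only [one_smul] at this
    linear_combination (norm := module) this - j • s1
  have c2 : (D * j) • v.o = v.o := by
    have := congrArg (fun t => t • v.o) hj'
    simp only [one_smul] at this
    linear_combination (norm := module) this - j • s2
  have c3 : (D * i) • ψ = ψ := by rw [hi, one_smul]
  linear_combination (norm := module) (-q) • c1 + p • c2 + c3

end Vectors

end SuperTeich

end

/-! ### The super Ptolemy transformation expressed in vectors. -/

noncomputable section

namespace SuperTeich

section FlipAlgebra

variable {M : Type*} [AddCommGroup M] [Module ℝ M]

theorem oddMul_swap (x y : Od M) : oddMul M y x = -oddMul M x y := by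
  have h := oppMul_swap x y
  rw [oppMul_eq, oppMul_eq] at h
  linear_combination -h

theorem oddMul_smul_left (x y : Od M) : oddMul M x y • x = 0 := by
  rw [oddMul_smul, oddMul_smul, oddMul_self, zero_smul]

theorem oddMul_smul_right (x y : Od M) : oddMul M x y • y = 0 := by
  rw [oddMul_smul, oddMul_self, zero_smul]

/-- Square roots of even elements that differ by a multiple of `στ` agree on the span of
`σ` and `τ`. -/
theorem smul_eq_of_sq_eq {x y N : Ev M} (hx : Pos x) (hy : Pos y) {σ θ Ψ : Od M}
    (h : x * x = y * y + N * oddMul M σ θ) (hΨ : oddMul M σ θ • Ψ = 0) : x • Ψ = y • Ψ := by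
  have h1 : (x + y) • (x • Ψ - y • Ψ) = 0 := by
    have : (x + y) • (x • Ψ - y • Ψ) = (x * x - y * y) • Ψ := by module
    rw [this, h, add_sub_cancel_left, mul_smul, hΨ, smul_zero]
  have h2 := (IsUnit.smul_left_cancel (hx.add hy).isUnit).mp (h1.trans (smul_zero _).symm)
  exact sub_eq_zero.mp h2

/-- In `pair_mul_ptolemy` the brackets are replaced by normalized μ-invariants. Both triangles carry
the same sign `τ`, which drops out of the product, and their square roots combine to e√(abcd); it
remains to cancel `e`. -/
theorem flip_lambda {p s q r : SVec M} {a b c d e : Ev M} {σ θ : Od M} {τ : Ev M}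
    (hτ : τ * τ = 1) (ha : Pos a) (hb : Pos b) (hc : Pos c) (hd : Pos d) (he : Pos e)
    (hpq : pair p q = e) (hpr : pair p r = a) (hqr : pair q r = b) (hsq : pair s q = c)
    (hps : pair p s = d)
    (hθ : esqrt (e * b * a) • θ = τ • bracket p q r)
    (hσ : esqrt (d * c * e) • σ = τ • bracket p s q) :
    e * pair s r = a * c + b * d + esqrt (a * b * c * d) * oddMul M σ θ := by
  have h := pair_mul_ptolemy p s q r
  have h1 : oddMul M (bracket p s q) (bracket p q r) =
      oddMul M (τ • bracket p s q) (τ • bracket p q r) := by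
    simp only [map_smul, LinearMap.smul_apply, smul_eq_mul]
    linear_combination -oddMul M (bracket p s q) (bracket p q r) * hτ
  rw [h1, ← hθ, ← hσ, hpq, hpr, hqr, hsq, hps] at h
  simp only [map_smul, LinearMap.smul_apply, smul_eq_mul] at h
  rw [esqrt_mul (he.mul hb) ha, esqrt_mul he hb, esqrt_mul (hd.mul hc) he, esqrt_mul hd hc] at h
  rw [esqrt_mul ((ha.mul hb).mul hc) hd, esqrt_mul (ha.mul hb) hc, esqrt_mul ha hb]
  have h2 : e * (e * pair s r) =
      e * (a * c + b * d + esqrt a * esqrt b * esqrt c * esqrt d * oddMul M σ θ) := by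
    linear_combination h + (esqrt a * esqrt b * esqrt c * esqrt d * oddMul M σ θ) * esqrt_mul_self he
  exact he.isUnit.mul_left_cancel h2

/-- Both formulas are instances of the three-term relation for brackets, based at `p` for the
triangle on the left and at `q` for the one on the right. The denominator √(ac + bd) may stand in
for √(ef), see `smul_eq_of_sq_eq`. The triangle on the right acquires the opposite sign. -/
theorem flip_mu {p s q r : SVec M} {a b c d e f : Ev M} {σ θ : Od M} {τ : Ev M}
    (ha : Pos a) (hb : Pos b) (hc : Pos c) (hd : Pos d) (he : Pos e) (hf : Pos f)
    (hpq : pair p q = e) (hpr : pair p r = a) (hqr : pair q r = b) (hsq : pair s q = c)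
    (hps : pair p s = d)
    (hθ : esqrt (e * b * a) • θ = τ • bracket p q r)
    (hσ : esqrt (d * c * e) • σ = τ • bracket p s q)
    (hef : e * f = a * c + b * d + esqrt (a * b * c * d) * oddMul M σ θ) :
    esqrt (d * f * a) • (Ring.inverse (esqrt (a * c + b * d)) •
        (esqrt (b * d) • θ + esqrt (a * c) • σ)) = τ • bracket p s r ∧
      esqrt (c * b * f) • (Ring.inverse (esqrt (a * c + b * d)) •
        (esqrt (b * d) • σ - esqrt (a * c) • θ)) = (-τ) • bracket s q r := by
  obtain ⟨g, hg⟩ : ∃ g, g = a * c + b * d := ⟨_, rfl⟩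
  have hgp : Pos g := hg ▸ (ha.mul hc).add (hb.mul hd)
  -- By the λ-length formula `e * f` and `g` differ by a multiple of σθ, which annihilates the
  -- combinations of σ and θ occurring below.
  have hsq' : (esqrt f * esqrt e) * (esqrt f * esqrt e) =
      esqrt g * esqrt g + esqrt (a * b * c * d) * oddMul M σ θ := by
    rw [esqrt_mul_self hgp, hg]
    linear_combination hef + esqrt f * esqrt f * esqrt_mul_self he + e * esqrt_mul_self hf
  have key := fun Ψ h => smul_eq_of_sq_eq (Ψ := Ψ) ((esqrt_pos hf).mul (esqrt_pos he))
    (esqrt_pos hgp) hsq' h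
  have hsl := oddMul_smul_left σ θ
  have hsr := oddMul_smul_right σ θ
  have hi := Ring.mul_inverse_cancel _ (esqrt_pos hgp).isUnit
  have hee := esqrt_mul_self he
  have haa := esqrt_mul_self ha
  have hbb := esqrt_mul_self hb
  have hcc := esqrt_mul_self hc
  have hdd := esqrt_mul_self hd
  rw [esqrt_mul (he.mul hb) ha, esqrt_mul he hb] at hθ
  rw [esqrt_mul (hd.mul hc) he, esqrt_mul hd hc] at hσ
  rw [← hg, esqrt_mul (hd.mul hf) ha, esqrt_mul hd hf, esqrt_mul (hc.mul hb) hf, esqrt_mul hc hb,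
    esqrt_mul hb hd, esqrt_mul ha hc]
  obtain ⟨k, hk⟩ : ∃ k, k = Ring.inverse (esqrt g) := ⟨_, rfl⟩
  rw [← hk] at hi ⊢
  constructor
  · have h1 := pair_mul_bracket p s q r
    rw [hpq, hpr, hps] at h1
    have h2 := key ((esqrt b * esqrt d) • θ + (esqrt a * esqrt c) • σ) (by
      rw [smul_add, smul_comm, hsr, smul_comm _ _ σ, hsl, smul_zero, smul_zero, add_zero])
    refine (IsUnit.smul_left_cancel (he.isUnit)).mp ?_
    generalize esqrt a = α at *
    generalize esqrt b = β at *
    generalize esqrt c = γ at *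
    generalize esqrt d = δ at *
    generalize esqrt e = ε at *
    generalize esqrt f = φ at *
    generalize esqrt g = ρ at *
    generalize bracket p s r = X1 at *
    generalize bracket p s q = X2 at *
    generalize bracket p q r = X3 at *
    -- With the λ-lengths written as squares of their roots, the claim is a linear combination of
    -- the relations collected so far.
    subst hee haa hbb hcc hdd
    have hi' : ∀ x : Od M, (ρ * k) • x = x := fun x => by rw [hi, one_smul]
    have e1 := hi' ((α * δ * ε) • ((β * δ) • θ + (α * γ) • σ))
    linear_combination (norm := module) (k * ε * α * δ) • h2 - τ • h1 + (δ * δ) • hθ + (α * α) • hσ + e1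
  · have h1 := pair_mul_bracket q r p s
    have t1 := bracket_cyclic s q r
    have t2 := bracket_cyclic p q r
    have t3 := (bracket_cyclic q p s).symm
    rw [t1, t2, pair_swap p q, hpq, hqr, pair_swap s q, hsq, t3] at h1
    have h2 := key ((esqrt b * esqrt d) • σ - (esqrt a * esqrt c) • θ) (by
      rw [smul_sub, smul_comm, hsl, smul_comm _ _ θ, hsr, smul_zero, smul_zero, sub_zero])
    refine (IsUnit.smul_left_cancel (he.isUnit)).mp ?_
    generalize esqrt a = α at *
    generalize esqrt b = β at *
    generalize esqrt c = γ at *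
    generalize esqrt d = δ at *
    generalize esqrt e = ε at *
    generalize esqrt f = φ at *
    generalize esqrt g = ρ at *
    generalize bracket s q r = X1 at *
    generalize bracket p s q = X2 at *
    generalize bracket p q r = X3 at *
    subst hee haa hbb hcc hdd
    have hi' : ∀ x : Od M, (ρ * k) • x = x := fun x => by rw [hi, one_smul]
    have e1 := hi' ((γ * β * ε) • ((β * δ) • σ - (α * γ) • θ))
    linear_combination (norm := module) (k * ε * γ * β) • h2 - τ • h1 + (β * β) • hσ - (γ * γ) • hθ + e1

end FlipAlgebra

end SuperTeich

end

/-! ### Chords of a polygon, apexes of triangles, and flips of noncrossing graphs. -/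

noncomputable section

namespace SuperTeich

section Geometry

variable {N : ℕ}

/-- Reduces cyclic order to inequalities between natural numbers, so that crossing arguments can be
left to `omega` and `grind`. -/
theorem sbtw_iff (i j k : Fin N) : sbtw i j k ↔
    (i.val < j.val ∧ j.val < k.val) ∨ (j.val < k.val ∧ k.val < i.val) ∨
      (k.val < i.val ∧ i.val < j.val) := Iff.rfl

/-- No two edges of the graph cross. -/
def NonCrossing (T : SimpleGraph (Fin N)) : Prop :=
  ∀ i j k l, T.Adj i j → T.Adj k l → ¬ Crosses i j k l

theorem IsTriangulation.nonCrossing {T : SimpleGraph (Fin N)} (h : IsTriangulation T) :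
    NonCrossing T := h.noncrossing

/-- Of two distinct apexes on the same side of `i j`, an edge from one to `i` or `j` would cross an
edge from the other. -/
theorem NonCrossing.apex_unique {T : SimpleGraph (Fin N)} (hT : NonCrossing T) {i j p q : Fin N}
    (hp : sbtw i p j) (hq : sbtw i q j) (hip : T.Adj i p) (hjp : T.Adj j p)
    (hiq : T.Adj i q) (hjq : T.Adj j q) : p = q := by
  have h1 := hT _ _ _ _ hip hjq
  have h2 := hT _ _ _ _ hiq hjp
  simp only [Crosses, sbtw_iff] at *
  rw [Fin.ext_iff]
  grind

theorem IsTriangulation.adj_of_no_sbtw {T : SimpleGraph (Fin N)} (hT : IsTriangulation T)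
    {i j : Fin N} (hij : i ≠ j) (h : ∀ k, ¬ sbtw i k j) : T.Adj i j := by
  apply hT.maximal _ _ hij
  rintro k l - (⟨h1, -⟩ | ⟨h1, -⟩)
  · exact h _ h1
  · exact h _ h1

/-- Among the neighbours of `j` strictly between `j` and `i`, the one closest to `i` works: an edge
that crossed `i k` would cross `i j` or `j k`, or would start at `j` and end beyond `k`. Maximality
then makes `i k` an edge. -/
theorem IsTriangulation.exists_apex {T : SimpleGraph (Fin N)} (hT : IsTriangulation T)
    {i j z : Fin N} (hij : T.Adj i j) (hz : sbtw j z i) :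
    ∃ k, sbtw j k i ∧ T.Adj i k ∧ T.Adj j k := by
  classical
  -- `s` is the successor of `j` in the cyclic order; it shows that `j` has a neighbour in the
  -- required range.
  obtain ⟨s, hs1, hs2⟩ : ∃ s : Fin N, s ≠ j ∧ ∀ k, ¬ sbtw j k s := by
    by_cases h : j.val + 1 < N
    · refine ⟨⟨j.val + 1, h⟩, by simp [Fin.ext_iff], fun k => ?_⟩
      simp only [sbtw_iff]; omega
    · refine ⟨⟨0, by have := j.2; omega⟩, ?_, fun k => ?_⟩
      · simp only [sbtw_iff] at hz
        simp only [ne_eq, Fin.ext_iff]; omega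
      · have := k.2
        simp only [sbtw_iff]; omega
  have hjs := hT.adj_of_no_sbtw hs1.symm hs2
  have hsi : sbtw j s i := by
    have := hs2 z
    have := hs2 i
    have hij' := hij.ne
    simp only [sbtw_iff, ne_eq, Fin.ext_iff] at *
    grind
  -- The position counted counterclockwise from `j`, by unrolling the cyclic order.
  let m : Fin N → ℕ := fun k => if j.val < k.val then k.val else k.val + N
  obtain ⟨k, hk, hmax⟩ := Finset.exists_max_image
    (Finset.univ.filter fun k => sbtw j k i ∧ T.Adj j k) m ⟨s, by simp [hsi, hjs]⟩
  simp only [Finset.mem_filter, Finset.mem_univ, true_and] at hk hmax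
  obtain ⟨hk1, hk2⟩ := hk
  have hmax' : ∀ y, sbtw j y i → T.Adj j y → ¬ sbtw j k y := by
    intro y hy hjy hky
    have hk := k.2
    have hy' := y.2
    have := hmax y ⟨hy, hjy⟩
    simp only [m] at this
    simp only [sbtw_iff] at *
    grind
  have main : ∀ x y, T.Adj x y → ¬ (sbtw i x k ∧ sbtw k y i) := by
    rintro x y hxy ⟨hx, hy⟩
    by_cases hxj : x = j
    · subst hxj
      refine hmax' y ?_ hxy ?_ <;> simp only [sbtw_iff] at * <;> omega
    · have h1 := hT.noncrossing _ _ _ _ hij hxy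
      have h2 := hT.noncrossing _ _ _ _ hk2 hxy
      simp only [sbtw_iff, Crosses, Fin.ext_iff] at *
      grind
  refine ⟨k, hk1, hT.maximal _ _ ?_ ?_, hk2⟩
  · rintro rfl; simp only [sbtw_iff] at hk1; omega
  · rintro x y hxy (⟨h1, h2⟩ | ⟨h1, h2⟩)
    · exact main x y hxy ⟨h1, h2⟩
    · exact main y x hxy.symm ⟨h1, h2⟩

/-- The result of flipping the edge `P Q` of the graph to `S R`. -/
def flipGraph (T : SimpleGraph (Fin N)) (P S Q R : Fin N) : SimpleGraph (Fin N) :=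
  T.deleteEdges {s(P, Q)} ⊔ SimpleGraph.edge S R

theorem flipGraph_adj {T : SimpleGraph (Fin N)} {P S Q R : Fin N} (hSR : S ≠ R) (i j : Fin N) :
    (flipGraph T P S Q R).Adj i j ↔ (T.Adj i j ∧ s(i, j) ≠ s(P, Q)) ∨ s(i, j) = s(S, R) := by
  simp only [flipGraph, SimpleGraph.sup_adj, SimpleGraph.deleteEdges_adj, Set.mem_singleton_iff,
    SimpleGraph.edge_adj, ne_eq, Sym2.eq_iff]
  constructor
  · rintro (h | h)
    · exact Or.inl h
    · exact Or.inr h.1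
  · rintro (h | h)
    · exact Or.inl h
    · refine Or.inr ⟨h, ?_⟩
      rintro rfl
      rcases h with ⟨rfl, rfl⟩ | ⟨rfl, rfl⟩ <;> exact hSR rfl

/-- The edge `P Q` is a diagonal of the quadrilateral `P, S, Q, R` of the graph. -/
structure IsQuad (T : SimpleGraph (Fin N)) (P S Q R : Fin N) : Prop where
  right : sbtw P S Q
  left : sbtw Q R P
  adjPQ : T.Adj P Q
  adjPS : T.Adj P S
  adjSQ : T.Adj S Q
  adjQR : T.Adj Q R
  adjRP : T.Adj R P

theorem IsQuad.ne {T : SimpleGraph (Fin N)} {P S Q R : Fin N} (h : IsQuad T P S Q R) :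
    P ≠ S ∧ P ≠ Q ∧ P ≠ R ∧ S ≠ Q ∧ S ≠ R ∧ Q ≠ R := by
  have h1 := h.right
  have h2 := h.left
  simp only [sbtw_iff, ne_eq, Fin.ext_iff] at *
  omega

theorem IsQuad.not_adj {T : SimpleGraph (Fin N)} {P S Q R : Fin N} (h : IsQuad T P S Q R)
    (hT : NonCrossing T) : ¬ T.Adj S R := by
  intro h3
  exact hT _ _ _ _ h.adjPQ h3 (Or.inl ⟨h.right, h.left⟩)

/-- An old edge that crosses the new diagonal has to leave the quadrilateral through one of its four
sides, unless it is `P Q` itself. -/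
theorem IsQuad.nonCrossing_flip {T : SimpleGraph (Fin N)} {P S Q R : Fin N}
    (h : IsQuad T P S Q R) (hT : NonCrossing T) : NonCrossing (flipGraph T P S Q R) := by
  have hne := h.ne
  have key : ∀ x y, T.Adj x y → s(x, y) ≠ s(P, Q) → ¬ (sbtw S x R ∧ sbtw R y S) := by
    rintro x y hxy hne' ⟨hx, hy⟩
    have h1 := hT _ _ _ _ h.adjPS hxy
    have h2 := hT _ _ _ _ h.adjSQ hxy
    have h3 := hT _ _ _ _ h.adjQR hxy
    have h4 := hT _ _ _ _ h.adjRP hxy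
    have h5 := h.right
    have h6 := h.left
    simp only [sbtw_iff, Crosses, ne_eq, Sym2.eq_iff, Fin.ext_iff] at *
    grind
  have key2 : ∀ x y, T.Adj x y → s(x, y) ≠ s(P, Q) → ¬ Crosses S R x y := by
    rintro x y hxy hne' (⟨h1, h2⟩ | ⟨h1, h2⟩)
    · exact key x y hxy hne' ⟨h1, h2⟩
    · exact key y x hxy.symm (by rwa [Sym2.eq_swap]) ⟨h1, h2⟩
  have sw1 : ∀ x y z w : Fin N, Crosses x y z w → Crosses z w x y := by
    intro x y z w; simp only [Crosses, sbtw_iff]; omega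
  have sw2 : ∀ x y z w : Fin N, Crosses x y z w → Crosses y x z w := by
    intro x y z w; simp only [Crosses, sbtw_iff]; omega
  intro i j k l hij hkl hc
  rw [flipGraph_adj hne.2.2.2.2.1] at hij hkl
  rcases hij with ⟨hij, hij'⟩ | hij <;> rcases hkl with ⟨hkl, hkl'⟩ | hkl
  · exact hT _ _ _ _ hij hkl hc
  · rcases Sym2.eq_iff.mp hkl with ⟨rfl, rfl⟩ | ⟨rfl, rfl⟩
    · exact key2 _ _ hij hij' (sw1 _ _ _ _ hc)
    · exact key2 _ _ hij hij' (sw2 _ _ _ _ (sw1 _ _ _ _ hc))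
  · rcases Sym2.eq_iff.mp hij with ⟨rfl, rfl⟩ | ⟨rfl, rfl⟩
    · exact key2 _ _ hkl hkl' hc
    · exact key2 _ _ hkl hkl' (sw2 _ _ _ _ hc)
  · rcases Sym2.eq_iff.mp hij with ⟨rfl, rfl⟩ | ⟨rfl, rfl⟩ <;>
      rcases Sym2.eq_iff.mp hkl with ⟨rfl, rfl⟩ | ⟨rfl, rfl⟩ <;>
      simp only [Crosses, sbtw_iff] at hc <;> omega

end Geometry

end SuperTeich

end

/-! ### Signs, and realizations of decorated triangulations by vectors. -/

noncomputable section

namespace SuperTeich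

section Signs

variable {M : Type*} [AddCommGroup M] [Module ℝ M]

variable (M) in
/-- A sign as an even scalar. -/
def sg (c : ℤˣ) : Ev M := ((c : ℤ) : Ev M)

theorem sg_mul (c d : ℤˣ) : sg M (c * d) = sg M c * sg M d := by simp [sg]

theorem sg_neg (c : ℤˣ) : sg M (-c) = -sg M c := by simp [sg]

@[simp] theorem sg_one : sg M 1 = 1 := by simp [sg]

theorem sg_mul_self (c : ℤˣ) : sg M c * sg M c = 1 := by
  rw [← sg_mul, Int.units_mul_self, sg_one]

/-- Scaling of a vector. -/
def SVec.scale (c : Ev M) (u : SVec M) : SVec M := ⟨c * u.x, c * u.y, c • u.o⟩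

theorem pair_scale (c d : Ev M) (u v : SVec M) :
    pair (u.scale c) (v.scale d) = c * d * pair u v := by
  simp only [pair, SVec.scale, map_smul, LinearMap.smul_apply, smul_eq_mul]; ring

theorem bracket_scale (c d e : Ev M) (u v w : SVec M) :
    bracket (u.scale c) (v.scale d) (w.scale e) = (c * d * e) • bracket u v w := by
  simp only [bracket, pair_scale, smul_sub, smul_add]
  simp only [SVec.scale, map_smul, LinearMap.smul_apply, smul_eq_mul]
  module

variable {N : ℕ}

/-- The signs of a linear order that is compatible with the cyclic order. -/
structure IsCut (e : Fin N → Fin N → ℤˣ) : Prop where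
  swap : ∀ i j, i ≠ j → e j i = -e i j
  cyclic : ∀ i j k, sbtw i j k → e i j * e j k * e k i = -1

/-- After each vector is rescaled by its sign relative to `i`, the pairing of `u j` and `u k`
becomes the unsigned λ-length; this is how signs are removed from a quadrilateral. -/
theorem IsCut.mul_eq {e : Fin N → Fin N → ℤˣ} (he : IsCut e) {i j k : Fin N} (h : sbtw i j k) :
    e j k = e i j * e i k := by
  have h1 := he.cyclic i j k h
  have h2 := he.swap i k (by rintro rfl; simp only [sbtw_iff] at h; omega)
  rw [h2] at h1
  have key : ∀ x y z : ℤˣ, x * y * -z = -1 → y = x * z := by decide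
  exact key _ _ _ h1

/-- The signed pairings. -/
def Lam (e : Fin N → Fin N → ℤˣ) (u : Fin N → SVec M) (i j : Fin N) : Ev M :=
  sg M (e i j) * pair (u i) (u j)

theorem Lam_symm {e : Fin N → Fin N → ℤˣ} (he : IsCut e) (u : Fin N → SVec M) {i j : Fin N}
    (h : i ≠ j) : Lam e u j i = Lam e u i j := by
  rw [Lam, Lam, he.swap i j h, pair_swap (u i), sg_neg]; ring

/-- The `μ`-invariant of the triangle `i, j, k` is given by the vectors. -/
def TriangleOK (e : Fin N → Fin N → ℤˣ) (u : Fin N → SVec M) (ε : Finset (Fin N) → ℤˣ)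
    (mu : Finset (Fin N) → ExteriorAlgebra ℝ M) (i j k : Fin N) : Prop :=
  ∃ θ : Od M, mu {i, j, k} = θ ∧ esqrt (Lam e u i j * Lam e u j k * Lam e u i k) • θ =
    sg M (ε {i, j, k}) • bracket (u i) (u j) (u k)

theorem triple_rotate (i j k : Fin N) : ({j, k, i} : Finset (Fin N)) = {i, j, k} := by
  ext x; simp only [Finset.mem_insert, Finset.mem_singleton]; tauto

theorem TriangleOK.rotate {e : Fin N → Fin N → ℤˣ} (he : IsCut e) {u : Fin N → SVec M}
    {ε : Finset (Fin N) → ℤˣ} {mu : Finset (Fin N) → ExteriorAlgebra ℝ M} {i j k : Fin N}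
    (hij : i ≠ j) (hik : i ≠ k) (h : TriangleOK e u ε mu i j k) : TriangleOK e u ε mu j k i := by
  obtain ⟨θ, h1, h2⟩ := h
  refine ⟨θ, by rw [triple_rotate]; exact h1, ?_⟩
  rw [triple_rotate, bracket_cyclic, ← h2, Lam_symm he u hik, Lam_symm he u hij]
  congr 2; ring

/-- The vectors `u` realize the decorated triangulation `D`. -/
structure Realizes (e : Fin N → Fin N → ℤˣ) (u : Fin N → SVec M) (ε : Finset (Fin N) → ℤˣ)
    (D : DecoratedTriangulation N M) : Prop where
  nonCrossing : NonCrossing D.T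
  lam_eq : ∀ i j, D.T.Adj i j → D.lam {i, j} = Lam e u i j
  lam_pos : ∀ i j, D.T.Adj i j → Pos (Lam e u i j)
  mu_eq : ∀ i j k, sbtw i j k → D.T.Adj i j → D.T.Adj j k → D.T.Adj i k →
    TriangleOK e u ε D.mu i j k
  dir_iff : ∀ i j, D.T.Adj i j → (D.dir i j ↔ ¬ D.dir j i)
  compat : ∀ i k j l, IsQuad D.T i k j l → D.dir i j → ε {i, j, k} * ε {i, j, l} = e k j * e j l

end Signs

/-! ### The values assigned by a flip, rewritten in the even ring and the odd module. -/

section FlipFields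

variable {M : Type*} [AddCommGroup M] [Module ℝ M] {N : ℕ} {D : DecoratedTriangulation N M}
  {P S Q R : Fin N} {a b c d e : Ev M} {σ θ : Od M}

theorem flip_lam_new (ha : Pos a) (hb : Pos b) (hc : Pos c) (hd : Pos d) (he : Pos e)
    (hea : D.lam {P, Q} = e) (haa : D.lam {P, R} = a) (hba : D.lam {R, Q} = b)
    (hca : D.lam {Q, S} = c) (hda : D.lam {S, P} = d) (hθ : D.mu {P, Q, R} = θ)
    (hσ : D.mu {P, Q, S} = σ) :
    (D.flip P S Q R).lam {S, R} =
      (Ring.inverse e * (a * c + b * d + esqrt (a * b * c * d) * oddMul M σ θ) : Ev M) := by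
  simp only [DecoratedTriangulation.flip, Function.update_self]
  rw [hea, haa, hba, hca, hda, hθ, hσ, inverse_coe he]
  rw [show (a : ExteriorAlgebra ℝ M) * b * c * d = ((a * b * c * d : Ev M) : ExteriorAlgebra ℝ M)
    from rfl, gsqrt_coe (((ha.mul hb).mul hc).mul hd)]
  rfl

theorem flip_mu_left (hne : ({P, R, S} : Finset (Fin N)) ≠ {Q, R, S})
    (ha : Pos a) (hb : Pos b) (hc : Pos c) (hd : Pos d)
    (haa : D.lam {P, R} = a) (hba : D.lam {R, Q} = b)
    (hca : D.lam {Q, S} = c) (hda : D.lam {S, P} = d) (hθ : D.mu {P, Q, R} = θ)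
    (hσ : D.mu {P, Q, S} = σ) :
    (D.flip P S Q R).mu {P, R, S} = (Ring.inverse (esqrt (a * c + b * d)) •
        (esqrt (b * d) • θ + esqrt (a * c) • σ) : Od M) := by
  simp only [DecoratedTriangulation.flip, Function.update_of_ne hne, Function.update_self]
  have hp := (ha.mul hc).add (hb.mul hd)
  rw [haa, hba, hca, hda, hθ, hσ]
  rw [show (a : ExteriorAlgebra ℝ M) * c + b * d = ((a * c + b * d : Ev M) : ExteriorAlgebra ℝ M)
    from rfl, show (a : ExteriorAlgebra ℝ M) * c = ((a * c : Ev M) : ExteriorAlgebra ℝ M)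
    from rfl, show (b : ExteriorAlgebra ℝ M) * d = ((b * d : Ev M) : ExteriorAlgebra ℝ M)
    from rfl, gsqrt_coe hp, gsqrt_coe (ha.mul hc), gsqrt_coe (hb.mul hd), inverse_coe (esqrt_pos hp)]
  rw [← (IsEven.commute (esqrt (b * d)).2 _).eq, ← (IsEven.commute (esqrt (a * c)).2 _).eq,
    ← (IsEven.commute (Ring.inverse (esqrt (a * c + b * d))).2 _).eq]
  rfl

theorem flip_mu_right (ha : Pos a) (hb : Pos b) (hc : Pos c) (hd : Pos d)
    (haa : D.lam {P, R} = a) (hba : D.lam {R, Q} = b)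
    (hca : D.lam {Q, S} = c) (hda : D.lam {S, P} = d) (hθ : D.mu {P, Q, R} = θ)
    (hσ : D.mu {P, Q, S} = σ) :
    (D.flip P S Q R).mu {Q, R, S} = (Ring.inverse (esqrt (a * c + b * d)) •
        (esqrt (b * d) • σ - esqrt (a * c) • θ) : Od M) := by
  simp only [DecoratedTriangulation.flip, Function.update_self]
  have hp := (ha.mul hc).add (hb.mul hd)
  rw [haa, hba, hca, hda, hθ, hσ]
  rw [show (a : ExteriorAlgebra ℝ M) * c + b * d = ((a * c + b * d : Ev M) : ExteriorAlgebra ℝ M)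
    from rfl, show (a : ExteriorAlgebra ℝ M) * c = ((a * c : Ev M) : ExteriorAlgebra ℝ M)
    from rfl, show (b : ExteriorAlgebra ℝ M) * d = ((b * d : Ev M) : ExteriorAlgebra ℝ M)
    from rfl, gsqrt_coe hp, gsqrt_coe (ha.mul hc), gsqrt_coe (hb.mul hd), inverse_coe (esqrt_pos hp)]
  rw [← (IsEven.commute (esqrt (b * d)).2 _).eq, ← (IsEven.commute (esqrt (a * c)).2 _).eq,
    ← (IsEven.commute (Ring.inverse (esqrt (a * c + b * d))).2 _).eq]
  rfl

end FlipFields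

end SuperTeich

end

/-! ### Invariance of realizations under flips. -/

noncomputable section

namespace SuperTeich

section FlipRealizes

variable {M : Type*} [AddCommGroup M] [Module ℝ M] {N : ℕ}

theorem finset_pair_eq_iff {i j k l : Fin N} :
    ({i, j} : Finset (Fin N)) = {k, l} ↔ s(i, j) = s(k, l) := by
  rw [← Finset.coe_inj, Sym2.eq_iff, Finset.coe_pair, Finset.coe_pair, Set.pair_eq_pair_iff]

theorem IsQuad.symm {T : SimpleGraph (Fin N)} {P S Q R : Fin N} (h : IsQuad T P S Q R) :
    IsQuad T Q R P S :=
  ⟨h.left, h.right, h.adjPQ.symm, h.adjQR, h.adjRP, h.adjPS, h.adjSQ⟩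

theorem sym2_ne_left {a b c d : Fin N} (h1 : a ≠ c) (h2 : a ≠ d) : s(a, b) ≠ s(c, d) := by
  intro h
  rcases Sym2.eq_iff.mp h with ⟨h3, -⟩ | ⟨h3, -⟩
  · exact h1 h3
  · exact h2 h3

theorem sym2_ne_right {a b c d : Fin N} (h1 : b ≠ c) (h2 : b ≠ d) : s(a, b) ≠ s(c, d) := by
  rw [Sym2.eq_swap]; exact sym2_ne_left h1 h2

/-- In the flipped graph, the triangles that contain the new edge are the two new ones, and the
others are triangles of the old graph. -/
theorem IsQuad.flip_triangle {T : SimpleGraph (Fin N)} {P S Q R : Fin N}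
    (h : IsQuad T P S Q R) (hT : NonCrossing T) {i j k : Fin N} (hs : sbtw i j k)
    (hij : (flipGraph T P S Q R).Adj i j) (hjk : (flipGraph T P S Q R).Adj j k)
    (hik : (flipGraph T P S Q R).Adj i k) :
    (T.Adj i j ∧ T.Adj j k ∧ T.Adj i k ∧
      ({i, j, k} : Finset (Fin N)) ≠ {P, R, S} ∧ ({i, j, k} : Finset (Fin N)) ≠ {Q, R, S}) ∨
    ((i = P ∧ j = S ∧ k = R) ∨ (i = S ∧ j = R ∧ k = P) ∨ (i = R ∧ j = P ∧ k = S)) ∨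
    ((i = S ∧ j = Q ∧ k = R) ∨ (i = Q ∧ j = R ∧ k = S) ∨ (i = R ∧ j = S ∧ k = Q)) := by
  have hne := h.ne
  have hT' := h.nonCrossing_flip hT
  have hSR := hne.2.2.2.2.1
  have adj : ∀ x y, T.Adj x y → s(x, y) ≠ s(P, Q) → (flipGraph T P S Q R).Adj x y :=
    fun x y h1 h2 => (flipGraph_adj hSR x y).mpr (Or.inl ⟨h1, h2⟩)
  obtain ⟨nPS, nPQ, nPR, nSQ, -, nQR⟩ := hne
  have aPS := adj _ _ h.adjPS (sym2_ne_right nPS.symm nSQ)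
  have aSQ := adj _ _ h.adjSQ (sym2_ne_left nPS.symm nSQ)
  have aQR := adj _ _ h.adjQR (sym2_ne_right nPR.symm nQR.symm)
  have aRP := adj _ _ h.adjRP (sym2_ne_left nPR.symm nQR.symm)
  have sQ : sbtw S Q R := by
    have h1 := h.right; have h2 := h.left
    simp only [sbtw_iff] at *; omega
  have sP : sbtw R P S := by
    have h1 := h.right; have h2 := h.left
    simp only [sbtw_iff] at *; omega
  have uQ : ∀ x, sbtw S x R → (flipGraph T P S Q R).Adj S x → (flipGraph T P S Q R).Adj R x →
      x = Q := fun x h1 h2 h3 => hT'.apex_unique h1 sQ h2 h3 aSQ aQR.symm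
  have uP : ∀ x, sbtw R x S → (flipGraph T P S Q R).Adj R x → (flipGraph T P S Q R).Adj S x →
      x = P := fun x h1 h2 h3 => hT'.apex_unique h1 sP h2 h3 aRP aPS.symm
  have hs1 := sbtw_cyclic_left hs
  have hs2 := sbtw_cyclic_left hs1
  by_cases e1 : s(i, j) = s(S, R)
  · rcases Sym2.eq_iff.mp e1 with ⟨rfl, rfl⟩ | ⟨rfl, rfl⟩
    · exact Or.inr (Or.inl (Or.inr (Or.inl ⟨rfl, rfl, uP k hs1 hjk hik⟩)))
    · exact Or.inr (Or.inr (Or.inr (Or.inr ⟨rfl, rfl, uQ k hs1 hjk hik⟩)))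
  by_cases e2 : s(j, k) = s(S, R)
  · rcases Sym2.eq_iff.mp e2 with ⟨rfl, rfl⟩ | ⟨rfl, rfl⟩
    · exact Or.inr (Or.inl (Or.inl ⟨uP i hs2 hik.symm hij.symm, rfl, rfl⟩))
    · exact Or.inr (Or.inr (Or.inr (Or.inl ⟨uQ i hs2 hik.symm hij.symm, rfl, rfl⟩)))
  by_cases e3 : s(i, k) = s(S, R)
  · rcases Sym2.eq_iff.mp e3 with ⟨rfl, rfl⟩ | ⟨rfl, rfl⟩
    · exact Or.inr (Or.inr (Or.inl ⟨rfl, uQ j hs hij hjk.symm, rfl⟩))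
    · exact Or.inr (Or.inl (Or.inr (Or.inr ⟨rfl, uP j hs hij hjk.symm, rfl⟩)))
  left
  have o1 := (((flipGraph_adj hSR _ _).mp hij).resolve_right e1).1
  have o2 := (((flipGraph_adj hSR _ _).mp hjk).resolve_right e2).1
  have o3 := (((flipGraph_adj hSR _ _).mp hik).resolve_right e3).1
  have nSR := h.not_adj hT
  refine ⟨o1, o2, o3, ?_, ?_⟩
  all_goals
    intro he
    have hS : S ∈ ({i, j, k} : Finset (Fin N)) := by rw [he]; simp
    have hR : R ∈ ({i, j, k} : Finset (Fin N)) := by rw [he]; simp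
    simp only [Finset.mem_insert, Finset.mem_singleton] at hS hR
    have p1 := T.adj_symm o1
    have p2 := T.adj_symm o2
    have p3 := T.adj_symm o3
    rcases hS with rfl | rfl | rfl <;> rcases hR with rfl | rfl | rfl <;> contradiction

theorem triple_swap_right (i j k : Fin N) : ({i, k, j} : Finset (Fin N)) = {i, j, k} := by
  rw [Finset.pair_comm]

theorem triple_swap_left (i j k : Fin N) : ({j, i, k} : Finset (Fin N)) = {i, j, k} :=
  Finset.insert_comm _ _ _

-- The vectors of the quadrilateral are rescaled by their signs relative to `P`, so that its
-- λ-lengths are plain pairings. The condition `compat` for the edge from `P` to `Q` says that the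
-- two triangle signs then become one common `τ`, and `flip_lambda` and `flip_mu` apply. The
-- triangle on the right of the new edge receives `-τ`; the reversal of the side `R Q` is what keeps
-- `compat` true there.
set_option maxHeartbeats 1000000 in
theorem Realizes.flip {e : Fin N → Fin N → ℤˣ} (he : IsCut e) {u : Fin N → SVec M}
    {ε : Finset (Fin N) → ℤˣ} {D : DecoratedTriangulation N M} (hR : Realizes e u ε D)
    {P S Q R : Fin N} (hq : IsQuad D.T P S Q R) (hdir : D.dir P Q) :
    ∃ ε', Realizes e u ε' (D.flip P S Q R) := by
  obtain ⟨nPS, nPQ, nPR, nSQ, nSR, nQR⟩ := hq.ne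
  have sPSQ := hq.right
  have sPQR := sbtw_cyclic_right hq.left
  have sPSR : sbtw P S R := by
    clear * - sPSQ sPQR; simp only [sbtw_iff] at *; omega
  have sSQR : sbtw S Q R := by
    clear * - sPSQ sPQR; simp only [sbtw_iff] at *; omega
  have cSQ := he.mul_eq sPSQ
  have cQR := he.mul_eq sPQR
  have cSR := he.mul_eq sPSR
  obtain ⟨θ, hθ, hθ'⟩ := hR.mu_eq _ _ _ sPQR hq.adjPQ hq.adjQR hq.adjRP.symm
  obtain ⟨σ, hσ, hσ'⟩ := hR.mu_eq _ _ _ sPSQ hq.adjPS hq.adjSQ hq.adjPQ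
  have hc := hR.compat _ _ _ _ hq hdir
  rw [triple_swap_right P Q S] at hσ hσ'
  -- The sign of the lower triangle in the rescaled vectors; `hτ2` shows that the upper triangle has
  -- the same one.
  obtain ⟨τ, hτ⟩ : ∃ τ : ℤˣ, τ = ε {P, Q, S} * (e P S * e P Q) := ⟨_, rfl⟩
  rw [cSQ, cQR] at hc
  have hτ2 : ε {P, Q, R} = τ * (e P Q * e P R) := by
    rw [hτ]
    -- Here and below identities between signs are verified by running through all values ±1.
    have key : ∀ a b x y z : ℤˣ, a * b = x * y * (y * z) → b = a * (x * y) * (y * z) := by decide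
    exact key _ _ _ _ _ hc
  have hτ1 : ε {P, Q, S} = τ * (e P S * e P Q) := by
    rw [hτ, mul_assoc, Int.units_mul_self, mul_one]
  have pPQ := hR.lam_pos _ _ hq.adjPQ
  have pPS := hR.lam_pos _ _ hq.adjPS
  have pSQ := hR.lam_pos _ _ hq.adjSQ
  have pQR := hR.lam_pos _ _ hq.adjQR
  have pPR := hR.lam_pos _ _ hq.adjRP.symm
  have v1 : pair ((u P).scale 1) ((u Q).scale (sg M (e P Q))) = Lam e u P Q := by
    rw [pair_scale, one_mul]; rfl
  have v2 : pair ((u P).scale 1) ((u R).scale (sg M (e P R))) = Lam e u P R := by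
    rw [pair_scale, one_mul]; rfl
  have v3 : pair ((u P).scale 1) ((u S).scale (sg M (e P S))) = Lam e u P S := by
    rw [pair_scale, one_mul]; rfl
  have v4 : pair ((u Q).scale (sg M (e P Q))) ((u R).scale (sg M (e P R))) = Lam e u Q R := by
    rw [pair_scale, ← sg_mul, ← cQR]; rfl
  have v5 : pair ((u S).scale (sg M (e P S))) ((u Q).scale (sg M (e P Q))) = Lam e u S Q := by
    rw [pair_scale, ← sg_mul, ← cSQ]; rfl
  have v6 : pair ((u S).scale (sg M (e P S))) ((u R).scale (sg M (e P R))) = Lam e u S R := by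
    rw [pair_scale, ← sg_mul, ← cSR]; rfl
  have w1 : esqrt (Lam e u P Q * Lam e u Q R * Lam e u P R) • θ =
      sg M τ • bracket ((u P).scale 1) ((u Q).scale (sg M (e P Q))) ((u R).scale (sg M (e P R))) := by
    rw [hθ', hτ2, bracket_scale, smul_smul, one_mul, ← sg_mul, ← sg_mul]
  have w2 : esqrt (Lam e u P S * Lam e u S Q * Lam e u P Q) • σ =
      sg M τ • bracket ((u P).scale 1) ((u S).scale (sg M (e P S))) ((u Q).scale (sg M (e P Q))) := by
    rw [hσ', hτ1, bracket_scale, smul_smul, one_mul, ← sg_mul, ← sg_mul]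
  have hf := flip_lambda (sg_mul_self τ) pPR pQR pSQ pPS pPQ v1 v2 v4 v5 v3 w1 w2
  rw [v6] at hf
  -- The σθ term has body zero, so on bodies this is the classical Ptolemy relation with positive
  -- entries.
  have pSR : Pos (Lam e u S R) := by
    have h1 := congrArg (evBody M) hf
    rw [map_mul, map_add, map_mul (evBody M) (esqrt _), evBody_oddMul, mul_zero, add_zero] at h1
    have h2 : 0 < evBody M (Lam e u P R * Lam e u S Q + Lam e u Q R * Lam e u P S) :=
      (pPR.mul pSQ).add (pQR.mul pPS)
    rw [← h1] at h2
    exact pos_of_mul_pos_right h2 (le_of_lt pPQ)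
  obtain ⟨m1, m2⟩ := flip_mu pPR pQR pSQ pPS pPQ pSR v1 v2 v4 v5 v3 w1 w2 hf
  have l1 := hR.lam_eq _ _ hq.adjPQ
  have l2 : D.lam {P, R} = _ := hR.lam_eq _ _ hq.adjRP.symm
  have l3 : D.lam {R, Q} = Lam e u Q R := by rw [Finset.pair_comm]; exact hR.lam_eq _ _ hq.adjQR
  have l4 : D.lam {Q, S} = Lam e u S Q := by rw [Finset.pair_comm]; exact hR.lam_eq _ _ hq.adjSQ
  have l5 : D.lam {S, P} = Lam e u P S := by rw [Finset.pair_comm]; exact hR.lam_eq _ _ hq.adjPS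
  have fnew := flip_lam_new pPR pQR pSQ pPS pPQ l1 l2 l3 l4 l5 hθ hσ
  rw [← hf, ← mul_assoc, Ring.inverse_mul_cancel _ pPQ.isUnit, one_mul] at fnew
  have tne : ({P, R, S} : Finset (Fin N)) ≠ {Q, R, S} := by
    intro h
    have h1 : P ∈ ({Q, R, S} : Finset (Fin N)) := h ▸ Finset.mem_insert_self _ _
    simp only [Finset.mem_insert, Finset.mem_singleton] at h1
    tauto
  have fmu1 := flip_mu_left (D := D) tne pPR pQR pSQ pPS l2 l3 l4 l5 hθ hσ
  have fmu2 := flip_mu_right (D := D) pPR pQR pSQ pPS l2 l3 l4 l5 hθ hσ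
  rw [bracket_scale, smul_smul (sg M τ), one_mul, ← sg_mul, ← sg_mul] at m1
  rw [bracket_scale, smul_smul (-sg M τ), ← sg_neg, ← sg_mul, ← sg_mul, ← sg_mul] at m2
  have hTri := fun {i j k} => hq.flip_triangle hR.nonCrossing (i := i) (j := j) (k := k)
  -- The signs are dictated by `flip_mu`, translated back to the vectors before rescaling.
  obtain ⟨ε', hε'⟩ : ∃ ε', ε' = Function.update (Function.update ε {P, R, S}
    (τ * (e P S * e P R))) {Q, R, S} (-τ * (e P S * e P Q * e P R)) := ⟨_, rfl⟩
  have ε1 : ε' {P, R, S} = τ * (e P S * e P R) := by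
    rw [hε', Function.update_of_ne tne, Function.update_self]
  have ε2 : ε' {Q, R, S} = -τ * (e P S * e P Q * e P R) := by rw [hε', Function.update_self]
  have ε3 : ∀ t, t ≠ {P, R, S} → t ≠ {Q, R, S} → ε' t = ε t := fun t h1 h2 => by
    rw [hε', Function.update_of_ne h2, Function.update_of_ne h1]
  have base1 : TriangleOK e u ε' (D.flip P S Q R).mu P S R :=
    ⟨_, by rw [Finset.pair_comm S R, fmu1], by rw [Finset.pair_comm S R, ε1, m1]⟩
  have base2 : TriangleOK e u ε' (D.flip P S Q R).mu S Q R :=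
    ⟨_, by rw [← triple_rotate S Q R, fmu2], by rw [← triple_rotate S Q R, ε2, m2]⟩
  have nPQ' : s(R, Q) ≠ s(S, R) := sym2_ne_right nSQ.symm nQR
  have dn1 : (D.flip P S Q R).dir S R := Or.inl ⟨rfl, rfl⟩
  have dn2 : ¬ (D.flip P S Q R).dir R S := by
    rintro (⟨h, -⟩ | ⟨h, -⟩ | ⟨-, h, -⟩)
    · exact nSR h.symm
    · exact sym2_ne_right nSR nSQ h
    · exact h Sym2.eq_swap
  have db : ∀ i j, s(i, j) = s(R, Q) → ((D.flip P S Q R).dir i j ↔ D.dir j i) := by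
    intro i j h
    constructor
    · rintro (⟨rfl, rfl⟩ | ⟨-, h1⟩ | ⟨h1, -⟩)
      · exact absurd h.symm nPQ'
      · exact h1
      · exact absurd h h1
    · exact fun h1 => Or.inr (Or.inl ⟨h, h1⟩)
  have do' : ∀ i j, s(i, j) ≠ s(R, Q) → s(i, j) ≠ s(S, R) →
      ((D.flip P S Q R).dir i j ↔ D.dir i j) := by
    intro i j h h'
    constructor
    · rintro (⟨rfl, rfl⟩ | ⟨h1, -⟩ | ⟨-, -, h1⟩)
      · exact absurd rfl h'
      · exact absurd h1 h
      · exact h1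
    · exact fun h1 => Or.inr (Or.inr ⟨h, h', h1⟩)
  refine ⟨ε', hq.nonCrossing_flip hR.nonCrossing, ?_, ?_, ?_, ?_, ?_⟩
  · intro i j h
    by_cases hs : s(i, j) = s(S, R)
    · rcases Sym2.eq_iff.mp hs with ⟨rfl, rfl⟩ | ⟨rfl, rfl⟩
      · exact fnew
      · rw [Finset.pair_comm, fnew, Lam_symm he u nSR]
    · rw [← hR.lam_eq _ _ (((flipGraph_adj nSR i j).mp h).resolve_right hs).1]
      exact Function.update_of_ne (fun h => hs (finset_pair_eq_iff.mp h)) _ _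
  · intro i j h
    by_cases hs : s(i, j) = s(S, R)
    · rcases Sym2.eq_iff.mp hs with ⟨rfl, rfl⟩ | ⟨rfl, rfl⟩
      · exact pSR
      · rwa [Lam_symm he u nSR]
    · exact hR.lam_pos _ _ (((flipGraph_adj nSR i j).mp h).resolve_right hs).1
  · intro i j k hs hij hjk hik
    rcases hTri hs hij hjk hik with ⟨h1, h2, h3, h4, h5⟩ | (⟨rfl, rfl, rfl⟩ | ⟨rfl, rfl, rfl⟩ |
      ⟨rfl, rfl, rfl⟩) | (⟨rfl, rfl, rfl⟩ | ⟨rfl, rfl, rfl⟩ | ⟨rfl, rfl, rfl⟩)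
    · obtain ⟨t, h6, h7⟩ := hR.mu_eq _ _ _ hs h1 h2 h3
      refine ⟨t, ?_, ?_⟩
      · rw [← h6]
        simp only [DecoratedTriangulation.flip]
        rw [Function.update_of_ne h5, Function.update_of_ne h4]
      · rw [ε3 _ h4 h5]; exact h7
    · exact base1
    · exact base1.rotate he nPS nPR
    · exact (base1.rotate he nPS nPR).rotate he nSR nPS.symm
    · exact base2
    · exact base2.rotate he nSQ nSR
    · exact (base2.rotate he nSQ nSR).rotate he nQR nSQ.symm
  · intro i j h
    by_cases hs : s(i, j) = s(S, R)
    · rcases Sym2.eq_iff.mp hs with ⟨rfl, rfl⟩ | ⟨rfl, rfl⟩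
      · exact iff_of_true dn1 dn2
      · exact iff_of_false dn2 (not_not.mpr dn1)
    · have ho := (((flipGraph_adj nSR i j).mp h).resolve_right hs).1
      by_cases hb : s(i, j) = s(R, Q)
      · rw [db i j hb, db j i (Sym2.eq_swap.trans hb), hR.dir_iff _ _ ho.symm]
      · rw [do' i j hb hs, do' j i (by rwa [Sym2.eq_swap]) (by rwa [Sym2.eq_swap]),
          hR.dir_iff _ _ ho]
  · have hqR := hq
    intro i k j l hq' hd
    have eSP := he.swap _ _ nPS
    have eQP := he.swap _ _ nPQ
    have eRP := he.swap _ _ nPR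
    have eQS := he.swap _ _ nSQ
    have eRQ := he.swap _ _ nQR
    have eRS := he.swap _ _ nSR
    rw [cSQ] at eQS
    rw [cQR] at eRQ
    rw [cSR] at eRS
    have nadj := hq.not_adj hR.nonCrossing
    -- Each of the two triangles at the edge `i j` is an old one or one of the two new ones. If both
    -- are old, nothing changes; if one is new, the edge is a side of the quadrilateral and the old
    -- condition has `P` or `Q` as apex instead; if both are new, it is the new diagonal.
    have t1 := hTri hq'.right hq'.adjPS hq'.adjSQ hq'.adjPQ
    have t2 := hTri hq'.left hq'.adjQR hq'.adjRP hq'.adjPQ.symm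
    have uS : ∀ x, sbtw R x Q → (flipGraph D.T P S Q R).Adj x R →
        (flipGraph D.T P S Q R).Adj x Q → x = S := by
      intro x h1 h2 h3
      refine (hq.nonCrossing_flip hR.nonCrossing).apex_unique h1 (sbtw_cyclic_right sSQR) h2.symm
        h3.symm ?_ ?_
      · exact (flipGraph_adj nSR _ _).mpr (Or.inr Sym2.eq_swap)
      · exact (flipGraph_adj nSR _ _).mpr (Or.inl ⟨hq.adjSQ.symm, sym2_ne_right nPS.symm nSQ⟩)
    have f1 : ({i, k, j} : Finset (Fin N)) ≠ {P, R, S} → ({i, k, j} : Finset (Fin N)) ≠ {Q, R, S} →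
        ε' {i, j, k} = ε {i, j, k} := by
      rw [triple_swap_right i j k]; exact ε3 _
    have f2 : ({j, l, i} : Finset (Fin N)) ≠ {P, R, S} → ({j, l, i} : Finset (Fin N)) ≠ {Q, R, S} →
        ε' {i, j, l} = ε {i, j, l} := by
      rw [triple_rotate i j l]; exact ε3 _
    have sl := hq'.left
    have sr := hq'.right
    rcases t1 with ⟨o1, o2, o3, n1, n2⟩ | t1
    · rw [f1 n1 n2]
      rcases t2 with ⟨o4, o5, o6, n4, n5⟩ | t2
      · rw [f2 n4 n5]
        refine hR.compat i k j l ⟨sr, sl, o3, o1, o2, o4, o5⟩ ((do' i j ?_ ?_).mp hd)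
        · intro h
          rcases Sym2.eq_iff.mp h with ⟨rfl, rfl⟩ | ⟨rfl, rfl⟩
          · rw [uS k sr hq'.adjPS.symm hq'.adjSQ] at n2
            exact n2 (triple_rotate j i S)
          · rw [uS l sl hq'.adjQR.symm hq'.adjRP] at n5
            exact n5 (triple_rotate i j S)
        · intro h
          rcases Sym2.eq_iff.mp h with ⟨rfl, rfl⟩ | ⟨rfl, rfl⟩
          · exact nadj o3
          · exact nadj o3.symm
      · rcases t2 with (⟨rfl, rfl, rfl⟩ | ⟨rfl, rfl, rfl⟩ | ⟨rfl, rfl, rfl⟩) |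
          (⟨rfl, rfl, rfl⟩ | ⟨rfl, rfl, rfl⟩ | ⟨rfl, rfl, rfl⟩)
        · have h := hR.compat i k j Q ⟨sr, sPQR, o3, o1, o2, hq.adjPQ, hq.adjQR⟩
            ((do' _ _ (sym2_ne_right nPR nPQ) (sym2_ne_right nPS nPR)).mp hd)
          rw [← triple_rotate i j Q, hτ2] at h
          rw [triple_swap_left j i l, ε1]
          have key : ∀ τ a b c x y : ℤˣ, x * (τ * (b * c)) = y * b → x * (τ * (a * c)) = y * a := by
            decide
          exact key _ _ _ _ _ _ h
        · have h := hR.compat i k j Q ⟨sr, sbtw_cyclic_left sPSQ, o3, o1, o2, hq.adjSQ,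
            hq.adjPQ.symm⟩ ((do' _ _ (sym2_ne_left nPR nPQ) (sym2_ne_left nPS nPR)).mp hd)
          rw [triple_swap_right i Q j, hτ1, cSQ] at h
          rw [triple_swap_right i l j, ε1, cSR]
          have key : ∀ τ a b c x y : ℤˣ, x * (τ * (a * b)) = y * (a * b) →
            x * (τ * (a * c)) = y * (a * c) := by decide
          exact key _ _ _ _ _ _ h
        · exact absurd o3 nadj
        · exact absurd o3.symm nadj
        · have h := hR.compat i k j P ⟨sr, sbtw_cyclic_right sPSQ, o3, o1, o2, hq.adjPQ.symm,
            hq.adjPS⟩ ((do' _ _ (sym2_ne_left nSR nSQ) (sym2_ne_right nSQ.symm nQR)).mp hd)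
          rw [← triple_rotate i j P, triple_swap_left P j i, hτ1, eQP] at h
          rw [← triple_rotate i j l, ε2, cQR]
          have key : ∀ τ a b c x y : ℤˣ, x * (τ * (a * b)) = y * -b →
            x * (-τ * (a * b * c)) = y * (b * c) := by decide
          exact key _ _ _ _ _ _ h
        -- This is the side whose orientation was reversed, so the old condition is read off for the
        -- opposite direction.
        · have h := hR.compat j P i k ⟨sbtw_cyclic_left hq.left, sr, o3.symm, hq.adjRP, hq.adjPQ,
            o1, o2⟩ ((db _ _ Sym2.eq_swap).mp hd)
          rw [← triple_rotate j i P, triple_swap_left P i j, hτ2, triple_swap_left i j k] at h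
          rw [ε2, he.mul_eq sr, cQR, eRS]
          have key : ∀ τ a b c x y : ℤˣ, τ * (b * c) * x = b * y →
            x * (-τ * (a * b * c)) = y * (b * c) * -(a * c) := by decide
          exact key _ _ _ _ _ _ h
    · rcases t2 with ⟨o4, o5, o6, n4, n5⟩ | t2
      · rw [f2 n4 n5]
        rcases t1 with (⟨rfl, rfl, rfl⟩ | ⟨rfl, rfl, rfl⟩ | ⟨rfl, rfl, rfl⟩) |
          (⟨rfl, rfl, rfl⟩ | ⟨rfl, rfl, rfl⟩ | ⟨rfl, rfl, rfl⟩)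
        · have h := hR.compat i Q j l ⟨sPQR, sl, o6.symm, hq.adjPQ, hq.adjQR, o4, o5⟩
            ((do' _ _ (sym2_ne_left nPR nPQ) (sym2_ne_left nPS nPR)).mp hd)
          rw [triple_swap_right i Q j, hτ2, cQR] at h
          rw [ε1, cSR]
          have key : ∀ τ a b c x y : ℤˣ, τ * (b * c) * x = b * c * y →
            τ * (a * c) * x = a * c * y := by decide
          exact key _ _ _ _ _ _ h
        · have h := hR.compat i Q j l ⟨sbtw_cyclic_left sPSQ, sl, o6.symm, hq.adjSQ,
            hq.adjPQ.symm, o4, o5⟩ ((do' _ _ (sym2_ne_right nPR nPQ) (sym2_ne_right nPS nPR)).mp hd)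
          rw [← triple_rotate i j Q, hτ1, eQP] at h
          rw [← triple_rotate i j k, ε1, eRP]
          have key : ∀ τ a b c x y : ℤˣ, τ * (a * b) * x = -b * y →
            τ * (a * c) * x = -c * y := by decide
          exact key _ _ _ _ _ _ h
        · exact absurd o6 nadj
        · exact absurd o6.symm nadj
        · have h := hR.compat i P j l ⟨sbtw_cyclic_right sPSQ, sl, o6.symm, hq.adjPQ.symm,
            hq.adjPS, o4, o5⟩ ((do' _ _ (sym2_ne_right nSR nSQ) (sym2_ne_left nSQ.symm nQR)).mp hd)
          rw [triple_rotate P i j, hτ1] at h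
          rw [triple_swap_right i k j, ε2, eRS]
          have key : ∀ τ a b c x y : ℤˣ, τ * (a * b) * x = a * y →
            -τ * (a * b * c) * x = -(a * c) * y := by decide
          exact key _ _ _ _ _ _ h
        · have h := hR.compat j l i P ⟨sl, sbtw_cyclic_left hq.left, o6, o4, o5, hq.adjRP,
            hq.adjPQ⟩ ((db _ _ rfl).mp hd)
          rw [triple_rotate P j i, hτ2, he.mul_eq sl, cQR, eRP] at h
          rw [triple_swap_left j i k, triple_swap_left j i l, ε2, cSQ]
          have key : ∀ τ a b c x y : ℤˣ, x * (τ * (b * c)) = y * (b * c) * -c →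
            -τ * (a * b * c) * x = a * b * y := by decide
          exact key _ _ _ _ _ _ h
      -- Only the new diagonal bounds two new triangles, and its orientation from `S` to `R` leaves
      -- a single case.
      · rcases t1 with (⟨rfl, rfl, rfl⟩ | ⟨rfl, rfl, rfl⟩ | ⟨rfl, rfl, rfl⟩) |
          (⟨rfl, rfl, rfl⟩ | ⟨rfl, rfl, rfl⟩ | ⟨rfl, rfl, rfl⟩) <;>
        rcases t2 with (⟨h1, h2, h3⟩ | ⟨h1, h2, h3⟩ | ⟨h1, h2, h3⟩) |
          (⟨h1, h2, h3⟩ | ⟨h1, h2, h3⟩ | ⟨h1, h2, h3⟩) <;>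
        first
        | exact absurd h1 (by assumption)
        | exact absurd h1.symm (by assumption)
        | exact absurd h3 (by assumption)
        | exact absurd h3.symm (by assumption)
        | exact absurd hd dn2
        | skip
        subst h2
        rw [← triple_rotate i j k, triple_swap_left k j i, ← triple_rotate i j l,
          triple_swap_left l j i, ε1, ε2, cQR, eRP]
        have key : ∀ τ a b c : ℤˣ, -τ * (a * b * c) * (τ * (a * c)) = b * c * -c := by decide
        exact key _ _ _ _

end FlipRealizes

end SuperTeich

end

/-! ### The chain of triangles and diagonals along the arc. -/

noncomputable section

namespace SuperTeich

theorem sbtw_or {N : ℕ} {i j p : Fin N} (hij : i ≠ j) (hip : i ≠ p) (hjp : j ≠ p) :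
    sbtw i p j ∨ sbtw j p i := by
  simp only [Fin.ext_iff, ne_eq, sbtw_iff] at *
  omega

namespace Labelling.IsLabelling

variable {n : ℕ} {L : Labelling n} {T : SimpleGraph (Fin (n + 3))} {a b : Fin (n + 3)}

theorem isNClique (h : L.IsLabelling T a b) (k : Fin (n + 1)) : T.IsNClique 3 (L.face k) :=
  (h.face_iff _).mp ⟨k, rfl⟩

theorem card_face (h : L.IsLabelling T a b) (k : Fin (n + 1)) : (L.face k).card = 3 :=
  (h.isNClique k).card_eq

theorem adj (h : L.IsLabelling T a b) {k : Fin (n + 1)} {i j : Fin (n + 3)} (hi : i ∈ L.face k)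
    (hj : j ∈ L.face k) (hij : i ≠ j) : T.Adj i j :=
  (h.isNClique k).isClique hi hj hij

theorem exists_face_of_sbtw (h : L.IsLabelling T a b) (hT : IsTriangulation T)
    {i j z : Fin (n + 3)} (hij : T.Adj i j) (hz : sbtw j z i) :
    ∃ k, i ∈ L.face k ∧ j ∈ L.face k ∧ ∃ p ∈ L.face k, sbtw j p i := by
  obtain ⟨p, hp, hip, hjp⟩ := hT.exists_apex hij hz
  obtain ⟨k, hk⟩ := (h.face_iff {i, j, p}).mpr (SimpleGraph.is3Clique_triple_iff.mpr ⟨hij, hip, hjp⟩)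
  exact ⟨k, by simp [hk], by simp [hk], p, by simp [hk], hp⟩

theorem exists_face (h : L.IsLabelling T a b) (hT : IsTriangulation T)
    {i j : Fin (n + 3)} (hij : T.Adj i j) : ∃ k, i ∈ L.face k ∧ j ∈ L.face k := by
  obtain ⟨z, hz⟩ : ∃ z : Fin (n + 3), z ∉ ({i, j} : Finset (Fin (n + 3))) := by
    by_contra! hc
    have h1 := Finset.card_le_card (fun x _ => hc x : (Finset.univ : Finset (Fin (n + 3))) ⊆ {i, j})
    have h2 := Finset.card_le_two (a := i) (b := j)
    rw [Finset.card_univ, Fintype.card_fin] at h1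
    omega
  have hne := hij.ne
  have hz' : sbtw j z i ∨ sbtw i z j := by
    simp only [Finset.mem_insert, Finset.mem_singleton, Fin.ext_iff, ne_eq, sbtw_iff] at *
    omega
  rcases hz' with hz | hz
  · obtain ⟨k, h1, h2, -⟩ := h.exists_face_of_sbtw hT hij hz
    exact ⟨k, h1, h2⟩
  · obtain ⟨k, h1, h2, -⟩ := h.exists_face_of_sbtw hT hij.symm hz
    exact ⟨k, h2, h1⟩

/-- No chord crosses the side from `v` to `v + 1`, so it is an edge, and every edge bounds a
triangle. -/
theorem cover (h : L.IsLabelling T a b) (hT : IsTriangulation T) (v : Fin (n + 3)) :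
    ∃ k, v ∈ L.face k := by
  have hv : T.Adj v (v + 1) := by
    refine hT.adj_of_no_sbtw (by simp) fun k => ?_
    have h2 := k.2
    have h3 := v.2
    rw [sbtw_iff, Fin.val_add_one (n := n + 2) v]
    split_ifs with hl
    · have : v.val = n + 2 := by rw [hl]; rfl
      omega
    · omega
  obtain ⟨k, h1, -⟩ := h.exists_face hT hv
  exact ⟨k, h1⟩

/-- A count: the first triangle has three vertices and each of the `n` later ones contributes at
most one more, yet all `n + 3` vertices are covered. So each triangle contributes exactly one. -/
theorem exists_fresh (h : L.IsLabelling T a b) (hT : IsTriangulation T) (k : Fin n) :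
    ∃ q, L.face k.succ = insert q (L.diag k) ∧ ∀ j ≤ k.castSucc, q ∉ L.face j := by
  classical
  by_contra! hc
  -- The vertices of the triangles with index at most `m`.
  let U : ℕ → Finset (Fin (n + 3)) := fun m =>
    Finset.univ.filter fun v => ∃ j : Fin (n + 1), j.val ≤ m ∧ v ∈ L.face j
  have hsd : ∀ m : Fin n, ∃ q, L.face m.succ \ L.diag m = {q} := by
    intro m
    rw [← Finset.card_eq_one, Finset.card_sdiff_of_subset (show L.diag m ⊆ L.face m.succ from Finset.inter_subset_right),
      h.card_face,
      h.card_diag]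
  -- If the triangle behind the diagonal `k` brought no new vertex, the bound would be smaller by
  -- one from there on.
  have hU : ∀ m, m ≤ n → (U m).card + (if k.val < m then 1 else 0) ≤ m + 3 := by
    intro m
    induction m with
    | zero =>
      intro _
      have : U 0 ⊆ L.face 0 := by
        intro v hv
        obtain ⟨j, hj, hv⟩ := (Finset.mem_filter.mp hv).2
        rwa [show j = 0 from Fin.ext (by simpa using hj)] at hv
      simpa using (Finset.card_le_card this).trans (h.card_face 0).le
    | succ m ih =>
      intro hm
      have ih := ih (by omega)
      obtain ⟨q, hq⟩ := hsd ⟨m, hm⟩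
      have hq' : L.face (Fin.succ ⟨m, hm⟩) = insert q (L.diag ⟨m, hm⟩) := by
        have hs : L.diag ⟨m, hm⟩ ⊆ L.face (Fin.succ ⟨m, hm⟩) := Finset.inter_subset_right
        rw [← Finset.sdiff_union_of_subset hs, hq, Finset.singleton_union]
      have hsub : U (m + 1) ⊆ insert q (U m) := by
        intro v hv
        obtain ⟨j, hj, hv⟩ := (Finset.mem_filter.mp hv).2
        rcases Nat.lt_or_ge m j.val with hj' | hj'
        · have : j = Fin.succ ⟨m, hm⟩ := Fin.ext (by simp; omega)
          rw [this, hq', Finset.mem_insert] at hv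
          rcases hv with rfl | hv
          · exact Finset.mem_insert_self _ _
          · refine Finset.mem_insert_of_mem (Finset.mem_filter.mpr ⟨Finset.mem_univ _,
              (Fin.castSucc ⟨m, hm⟩), le_rfl, (Finset.mem_inter.mp hv).1⟩)
        · exact Finset.mem_insert_of_mem (Finset.mem_filter.mpr ⟨Finset.mem_univ _, j, hj', hv⟩)
      have hcard := Finset.card_le_card hsub
      have hcard2 := Finset.card_insert_le q (U m)
      by_cases hmk : m = k.val
      · obtain ⟨j, hj, hqj⟩ := hc q (by subst hmk; exact hq')
        have : insert q (U m) = U m := Finset.insert_eq_of_mem (Finset.mem_filter.mpr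
          ⟨Finset.mem_univ _, j, by rw [hmk]; exact hj, hqj⟩)
        rw [this] at hcard
        split_ifs at * <;> omega
      · split_ifs at * <;> omega
  have huniv : U n = Finset.univ := by
    refine Finset.eq_univ_of_forall fun v => Finset.mem_filter.mpr ⟨Finset.mem_univ _, ?_⟩
    obtain ⟨j, hj⟩ := h.cover hT v
    exact ⟨j, Nat.lt_succ_iff.mp j.2, hj⟩
  have := hU n le_rfl
  rw [huniv, Finset.card_univ, Fintype.card_fin, if_pos k.2] at this
  omega

/-- Going back from `θ_m`, a vertex not shared with the preceding triangle is a fresh one and occurs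
in no earlier triangle. Hence the triangles at a vertex are consecutive. -/
theorem mem_face_of_le_of_le (h : L.IsLabelling T a b) (hT : IsTriangulation T) {v : Fin (n + 3)}
    {i m : Fin (n + 1)} (hi : v ∈ L.face i) (hm : v ∈ L.face m) :
    ∀ k, i ≤ k → k ≤ m → v ∈ L.face k := by
  induction m using Fin.induction with
  | zero =>
    intro k _ hk
    rwa [Fin.le_zero_iff.mp hk]
  | succ m ih =>
    intro k hik hk
    rcases hk.eq_or_lt with rfl | hk
    · exact hm
    · have hk' : k ≤ m.castSucc := Nat.lt_succ_iff.mp hk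
      obtain ⟨q, hq, hq'⟩ := h.exists_fresh hT m
      rw [hq, Finset.mem_insert] at hm
      rcases hm with rfl | hm
      · exact absurd hi (hq' _ (hik.trans hk'))
      · exact ih (Finset.mem_inter.mp hm).1 k hik hk'

/-- An edge with vertices on both sides bounds two triangles. As the triangles at each of its end
points are consecutive, it is shared by the first of the two and its successor. -/
theorem eq_diag (h : L.IsLabelling T a b) (hT : IsTriangulation T) {u v : Fin (n + 3)}
    (huv : T.Adj u v) {x y : Fin (n + 3)} (hx : sbtw u x v) (hy : sbtw v y u) :
    ∃ k, L.diag k = {u, v} := by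
  obtain ⟨i, hui, hvi, p, hpi, hp⟩ := h.exists_face_of_sbtw hT huv hy
  obtain ⟨j, hvj, huj, p', hpj, hp'⟩ := h.exists_face_of_sbtw hT huv.symm hx
  have key : ∀ i j, u ∈ L.face i → v ∈ L.face i → u ∈ L.face j → v ∈ L.face j → i < j →
      ∃ k, L.diag k = {u, v} := by
    intro i j hui hvi huj hvj hij
    have hin : i.val < n := by have := j.2; have : i.val < j.val := hij; omega
    refine ⟨⟨i.val, hin⟩, (Finset.eq_of_subset_of_card_le ?_ ?_).symm⟩
    · have h1 : i ≤ (Fin.succ ⟨i.val, hin⟩) := Fin.le_def.mpr (by simp)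
      have h2 : (Fin.succ ⟨i.val, hin⟩) ≤ j := Fin.le_def.mpr hij
      intro z hz
      simp only [Finset.mem_insert, Finset.mem_singleton] at hz
      rcases hz with rfl | rfl
      · exact Finset.mem_inter.mpr ⟨hui, h.mem_face_of_le_of_le hT hui huj _ h1 h2⟩
      · exact Finset.mem_inter.mpr ⟨hvi, h.mem_face_of_le_of_le hT hvi hvj _ h1 h2⟩
    · rw [h.card_diag, Finset.card_pair huv.ne]
  rcases lt_trichotomy i j with hij | rfl | hij
  · exact key i j hui hvi huj hvj hij
  · exfalso
    have : ({u, v, p, p'} : Finset (Fin (n + 3))) ⊆ L.face i := by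
      intro z hz
      simp only [Finset.mem_insert, Finset.mem_singleton] at hz
      rcases hz with rfl | rfl | rfl | rfl <;> assumption
    have h1 := Finset.card_le_card this
    rw [h.card_face, Finset.card_eq_of_equiv_fin (n := 4)] at h1
    · omega
    · refine (Fintype.equivFinOfCardEq ?_)
      rw [Fintype.card_coe]
      have huv' := huv.ne
      rw [Finset.card_insert_of_notMem, Finset.card_insert_of_notMem, Finset.card_pair]
      all_goals
        simp only [Finset.mem_insert, Finset.mem_singleton, Fin.ext_iff, ne_eq, sbtw_iff] at *
        omega
  · exact key j i huj hvj hui hvi hij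

theorem diag_subset_left (L : Labelling n) (k : Fin n) : L.diag k ⊆ L.face k.castSucc :=
  Finset.inter_subset_left

theorem diag_subset_right (L : Labelling n) (k : Fin n) : L.diag k ⊆ L.face k.succ :=
  Finset.inter_subset_right

/-- The two triangles adjacent to a diagonal lie on different sides of it. -/
theorem exists_apexes (h : L.IsLabelling T a b) (hT : IsTriangulation T) {k : Fin n}
    {i j : Fin (n + 3)} (hd : L.diag k = {i, j}) : ∃ p q,
      L.face k.castSucc = {i, j, p} ∧ L.face k.succ = {i, j, q} ∧
      ((sbtw i p j ∧ sbtw j q i) ∨ (sbtw j p i ∧ sbtw i q j)) := by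
  have hij : i ≠ j := by
    rintro rfl
    have := h.card_diag k
    rw [hd] at this
    simp at this
  have hex : ∀ m, L.diag k ⊆ L.face m → ∃ p, L.face m = {i, j, p} ∧ i ≠ p ∧ j ≠ p := by
    intro m hm
    have h1 : (L.face m \ L.diag k).card = 1 := by
      rw [Finset.card_sdiff_of_subset hm, h.card_face, h.card_diag]
    obtain ⟨p, hp⟩ := Finset.card_eq_one.mp h1
    have h2 : p ∈ L.face m \ L.diag k := by rw [hp]; simp
    rw [hd, Finset.mem_sdiff, Finset.mem_insert, Finset.mem_singleton] at h2
    refine ⟨p, ?_, fun h => h2.2 (Or.inl h.symm), fun h => h2.2 (Or.inr h.symm)⟩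
    rw [← Finset.sdiff_union_of_subset hm, hp, hd]
    ext x
    simp only [Finset.mem_union, Finset.mem_insert, Finset.mem_singleton]
    tauto
  obtain ⟨p, hp, hp1, hp2⟩ := hex _ (diag_subset_left L k)
  obtain ⟨q, hq, hq1, hq2⟩ := hex _ (diag_subset_right L k)
  refine ⟨p, q, hp, hq, ?_⟩
  have hpq : p ≠ q := by
    rintro rfl
    have := h.injective (hp.trans hq.symm)
    exact absurd (congrArg Fin.val this) (by simp)
  have ip : T.Adj i p := h.adj (k := k.castSucc) (by simp [hp]) (by simp [hp]) hp1
  have jp : T.Adj j p := h.adj (k := k.castSucc) (by simp [hp]) (by simp [hp]) hp2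
  have iq : T.Adj i q := h.adj (k := k.succ) (by simp [hq]) (by simp [hq]) hq1
  have jq : T.Adj j q := h.adj (k := k.succ) (by simp [hq]) (by simp [hq]) hq2
  have u1 : sbtw i p j → ¬ sbtw i q j := fun h1 h2 =>
    hpq (hT.nonCrossing.apex_unique h1 h2 ip jp iq jq)
  have u2 : sbtw j p i → ¬ sbtw j q i := fun h1 h2 =>
    hpq (hT.nonCrossing.apex_unique h1 h2 jp ip jq iq)
  rcases sbtw_or hij hp1 hp2 with hp | hp <;> rcases sbtw_or hij hq1 hq2 with hq | hq
  · exact absurd hq (u1 hp)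
  · exact Or.inl ⟨hp, hq⟩
  · exact Or.inr ⟨hp, hq⟩
  · exact absurd hq (u2 hp)

/-- A diagonal has an apex on each side, so it is not a side of the polygon and must cross the arc.
-/
theorem exists_diag_eq (h : L.IsLabelling T a b) (hT : IsTriangulation T)
    (hcross : ∀ i j, T.Adj i j → ¬ IsSide i j → Crosses a b i j) (k : Fin n) :
    ∃ r l, L.diag k = {r, l} ∧ sbtw a r b ∧ sbtw b l a := by
  obtain ⟨i, j, hij, hd⟩ := Finset.card_eq_two.mp (h.card_diag k)
  obtain ⟨p, q, -, -, hpq⟩ := h.exists_apexes hT hd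
  have hi : i ∈ L.face k.castSucc := diag_subset_left L k (by simp [hd])
  have hj : j ∈ L.face k.castSucc := diag_subset_left L k (by simp [hd])
  have hns : ∀ x y z : Fin (n + 3), sbtw x y z → z ≠ x + 1 := by
    rintro x y z hs rfl
    have h2 := y.2
    have h3 := x.2
    rw [sbtw_iff, Fin.val_add_one (n := n + 2) x] at hs
    split_ifs at hs with hl
    · have : x.val = n + 2 := by rw [hl]; rfl
      omega
    · omega
  have hside : ¬ IsSide i j := by
    rintro (hs | hs)
    · rcases hpq with ⟨h1, h2⟩ | ⟨h1, h2⟩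
      · exact hns _ _ _ h1 hs
      · exact hns _ _ _ h2 hs
    · rcases hpq with ⟨h1, h2⟩ | ⟨h1, h2⟩
      · exact hns _ _ _ h2 hs
      · exact hns _ _ _ h1 hs
  rcases hcross i j (h.adj hi hj hij) hside with ⟨h1, h2⟩ | ⟨h1, h2⟩
  · exact ⟨i, j, hd, h1, h2⟩
  · exact ⟨j, i, by rw [hd, Finset.pair_comm], h1, h2⟩

end Labelling.IsLabelling

/-- The diagonals `d_k = {r_k, l_k}` with `r_k` to the right and `l_k` to the left of the arc, and
the new vertices `q_k` of the triangles behind them. -/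
structure Labelling.IsChain {n : ℕ} (L : Labelling n) (T : SimpleGraph (Fin (n + 3)))
    (a b : Fin (n + 3)) (r l q : Fin n → Fin (n + 3)) : Prop where
  diag_eq : ∀ k, L.diag k = {r k, l k}
  right : ∀ k, sbtw a (r k) b
  left : ∀ k, sbtw b (l k) a
  face_zero : ∀ k, k.val = 0 → L.face k.castSucc = {r k, l k, a}
  face_succ : ∀ k, L.face k.succ = {r k, l k, q k}
  q_last : ∀ k, k.val + 1 = n → q k = b
  between : ∀ k, sbtw (r k) (q k) (l k)
  fresh : ∀ k, ∀ j ≤ k.castSucc, q k ∉ L.face j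
  step : ∀ k k' : Fin n, k.succ = k'.castSucc →
    (l k' = l k ∧ r k' = q k ∧ L.center k.succ = l k) ∨
      (r k' = r k ∧ l k' = q k ∧ L.center k.succ = r k)

/-- The next diagonal consists of the fresh vertex and one end of the present one. As it crosses the
arc too, the fresh vertex takes the place of the end on its own side of the arc, and the end that is
kept is the fan center. -/
theorem Labelling.IsLabelling.exists_isChain {n : ℕ} {L : Labelling n}
    {T : SimpleGraph (Fin (n + 3))} {a b : Fin (n + 3)} (h : L.IsLabelling T a b)
    (hT : IsTriangulation T) (hcross : ∀ i j, T.Adj i j → ¬ IsSide i j → Crosses a b i j) :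
    ∃ r l q, L.IsChain T a b r l q := by
  choose r l hd hr hl using h.exists_diag_eq hT hcross
  choose q hq hf using h.exists_fresh hT
  have hq' : ∀ k, L.face k.succ = {r k, l k, q k} := by
    intro k
    rw [hq, hd]
    ext x
    simp only [Finset.mem_insert, Finset.mem_singleton]
    tauto
  have nab : ∀ k, a ≠ r k ∧ a ≠ l k ∧ b ≠ r k ∧ b ≠ l k ∧ r k ≠ l k := by
    intro k
    have h1 := hr k
    have h2 := hl k
    simp only [Fin.ext_iff, ne_eq, sbtw_iff] at *
    omega
  have face_zero : ∀ k : Fin n, k.val = 0 → L.face k.castSucc = {r k, l k, a} := by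
    intro k hk
    symm
    apply Finset.eq_of_subset_of_card_le
    · intro x hx
      simp only [Finset.mem_insert, Finset.mem_singleton] at hx
      have hsub := Labelling.IsLabelling.diag_subset_left L k
      rw [hd] at hsub
      rcases hx with rfl | rfl | rfl
      · exact hsub (by simp)
      · exact hsub (by simp)
      · rw [show k.castSucc = 0 from Fin.ext hk]; exact h.first_mem
    · obtain ⟨h1, h2, h3, h4, h5⟩ := nab k
      rw [h.card_face, Finset.card_insert_of_notMem, Finset.card_pair h2.symm]
      simp only [Finset.mem_insert, Finset.mem_singleton]
      tauto
  have q_last : ∀ k : Fin n, k.val + 1 = n → q k = b := by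
    intro k hk
    have h1 := h.last_mem
    rw [show Fin.last n = k.succ from Fin.ext hk.symm, hq'] at h1
    simp only [Finset.mem_insert, Finset.mem_singleton] at h1
    have := nab k
    tauto
  have hrl : ∀ k, r k ∈ L.face k.castSucc ∧ l k ∈ L.face k.castSucc := fun k =>
    ⟨Labelling.IsLabelling.diag_subset_left L k (by simp [hd]),
      Labelling.IsLabelling.diag_subset_left L k (by simp [hd])⟩
  -- The apexes of the two triangles at a diagonal lie on opposite sides of it, so it suffices to
  -- locate the earlier apex.
  have side : ∀ k p, sbtw (l k) p (r k) → p ∈ L.face k.castSucc → sbtw (r k) (q k) (l k) := by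
    intro k p hp hpf
    obtain ⟨p', q', h1, h2, h3⟩ := h.exists_apexes hT (hd k)
    have nq1 : q k ≠ r k := fun h => hf k _ le_rfl (h ▸ (hrl k).1)
    have nq2 : q k ≠ l k := fun h => hf k _ le_rfl (h ▸ (hrl k).2)
    have hqq : q k = q' := by
      have : q k ∈ L.face k.succ := by rw [hq']; simp
      rw [h2] at this
      simp only [Finset.mem_insert, Finset.mem_singleton] at this
      tauto
    have hpp : p = p' := by
      rw [h1] at hpf
      simp only [Finset.mem_insert, Finset.mem_singleton] at hpf
      clear * - hpf hp
      simp only [Fin.ext_iff, sbtw_iff] at *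
      omega
    rw [hqq]
    rw [← hpp] at h3
    clear * - h3 hp
    simp only [sbtw_iff] at *
    omega
  have step : ∀ k k' : Fin n, k.succ = k'.castSucc →
      (l k' = l k ∧ r k' = q k ∧ L.center k.succ = l k) ∨
      (r k' = r k ∧ l k' = q k ∧ L.center k.succ = r k) := by
    intro k k' hkk
    have hne : q k' ∉ L.face k.succ := hf k' _ hkk.le
    obtain ⟨m1, m2⟩ := hrl k'
    have c1 := h.center_mem_left k'
    have c2 := h.center_mem_right k
    rw [← hkk] at m1 m2 c1
    rw [hd] at c1 c2
    rw [hq'] at m1 m2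
    have hr1 := hr k
    have hl1 := hl k
    have hr2 := hr k'
    have hl2 := hl k'
    -- Two consecutive diagonals that coincide would belong to three triangles, while an edge has
    -- only one apex on each side.
    have hnot : ¬ (r k' = r k ∧ l k' = l k) := by
      rintro ⟨e1, e2⟩
      obtain ⟨p, q1, hp, hq1, hs⟩ := h.exists_apexes hT (hd k)
      obtain ⟨p2, q2, hp2, hq2, hs2⟩ := h.exists_apexes hT (hd k')
      rw [e1, e2] at hp2 hq2 hs2
      rw [← hkk] at hp2
      have hpq : p2 = q1 := by
        have : p2 ∈ L.face k.succ := by rw [hp2]; simp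
        rw [hq1] at this
        simp only [Finset.mem_insert, Finset.mem_singleton] at this
        clear * - this hs2
        simp only [Fin.ext_iff, sbtw_iff] at *
        omega
      have hpq2 : p = q2 := by
        have adjs : ∀ x m, L.face m = {r k, l k, x} → (sbtw (r k) x (l k) ∨ sbtw (l k) x (r k)) →
            T.Adj (r k) x ∧ T.Adj (l k) x := by
          intro x m hm hs
          refine ⟨h.adj (k := m) (by simp [hm]) (by simp [hm]) ?_,
            h.adj (k := m) (by simp [hm]) (by simp [hm]) ?_⟩
          all_goals
            clear * - hs
            simp only [Fin.ext_iff, ne_eq, sbtw_iff] at *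
            omega
        subst hpq
        rcases hs with ⟨s1, s2⟩ | ⟨s1, s2⟩ <;> rcases hs2 with ⟨s3, s4⟩ | ⟨s3, s4⟩
        · exact absurd s2 (by clear * - s3; simp only [sbtw_iff] at *; omega)
        · exact hT.nonCrossing.apex_unique s1 s4 (adjs p _ hp (by tauto)).1
            (adjs p _ hp (by tauto)).2 (adjs q2 _ hq2 (by tauto)).1 (adjs q2 _ hq2 (by tauto)).2
        · exact hT.nonCrossing.apex_unique s1 s4 (adjs p _ hp (by tauto)).2
            (adjs p _ hp (by tauto)).1 (adjs q2 _ hq2 (by tauto)).2 (adjs q2 _ hq2 (by tauto)).1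
        · exact absurd s2 (by clear * - s3; simp only [sbtw_iff] at *; omega)
      have := h.injective (hp.trans (hpq2 ▸ hq2.symm))
      have h1 := congrArg Fin.val this
      have h2 := congrArg Fin.val hkk
      simp at h1 h2
      omega
    simp only [Finset.mem_insert, Finset.mem_singleton] at m1 m2 c1 c2
    simp only [Fin.ext_iff, sbtw_iff] at *
    have hcq := hf k _ le_rfl
    have nq1 : q k ≠ r k := fun h => hcq (h ▸ (hrl k).1)
    have nq2 : q k ≠ l k := fun h => hcq (h ▸ (hrl k).2)
    rw [ne_eq, Fin.ext_iff] at nq1 nq2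
    clear * - m1 m2 c1 c2 nq1 nq2 hnot hr1 hl1 hr2 hl2
    grind
  -- The induction carries along a vertex of the earlier triangle behind the diagonal: `a` at first,
  -- then the end that has just been replaced.
  have between : ∀ k, sbtw (r k) (q k) (l k) ∧ ∃ p, sbtw (l k) p (r k) ∧ p ∈ L.face k.castSucc := by
    rintro ⟨k, hk⟩
    suffices hs : ∃ p, sbtw (l ⟨k, hk⟩) p (r ⟨k, hk⟩) ∧ p ∈ L.face (Fin.castSucc ⟨k, hk⟩) by
      obtain ⟨p, hp, hp'⟩ := hs
      exact ⟨side _ p hp hp', p, hp, hp'⟩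
    induction k with
    | zero =>
      refine ⟨a, ?_, by rw [face_zero _ rfl]; simp⟩
      have h1 := hr ⟨0, hk⟩
      have h2 := hl ⟨0, hk⟩
      clear * - h1 h2
      simp only [sbtw_iff] at *
      omega
    | succ k ih =>
      obtain ⟨p, hp, hp'⟩ := ih (by omega)
      have hs := side _ p hp hp'
      have hkk : Fin.succ ⟨k, by omega⟩ = Fin.castSucc ⟨k + 1, hk⟩ := rfl
      rw [← hkk, hq']
      rcases step _ _ hkk with ⟨h1, h2, -⟩ | ⟨h1, h2, -⟩
      · refine ⟨r ⟨k, by omega⟩, ?_, by simp⟩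
        rw [h1, h2]
        clear * - hs
        simp only [sbtw_iff] at *
        omega
      · refine ⟨l ⟨k, by omega⟩, ?_, by simp⟩
        rw [h1, h2]
        clear * - hs
        simp only [sbtw_iff] at *
        omega
  exact ⟨r, l, q, hd, hr, hl, face_zero, hq', q_last, fun k => (between k).1, hf, step⟩

end SuperTeich

end

/-! ### Existence of a realization for the default orientation. -/

noncomputable section

namespace SuperTeich

section Cut

variable {N : ℕ}

open Classical in
/-- The signs of the linear order obtained by cutting the cyclic order in front of `a`. -/
def cutSign (a i j : Fin N) : ℤˣ := if i = a ∨ sbtw a i j then 1 else -1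

theorem cutSign_self_left (a j : Fin N) : cutSign a a j = 1 := if_pos (Or.inl rfl)

theorem cutSign_of_sbtw {a i j : Fin N} (h : sbtw a i j) : cutSign a i j = 1 := if_pos (Or.inr h)

theorem isCut_cutSign (a : Fin N) : IsCut (cutSign a) := by
  constructor
  · intro i j hij
    unfold cutSign
    by_cases h : i = a ∨ sbtw a i j
    · rw [if_pos h, if_neg]
      simp only [sbtw_iff, Fin.ext_iff, ne_eq] at *
      omega
    · rw [if_neg h, if_pos, neg_neg]
      simp only [sbtw_iff, Fin.ext_iff, ne_eq] at *
      omega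
  · intro i j k h
    unfold cutSign
    simp only [sbtw_iff, Fin.ext_iff] at *
    split_ifs <;> first | decide | (exfalso; omega)

end Cut

section FaceOK

variable {M : Type*} [AddCommGroup M] [Module ℝ M] {N : ℕ}

/-- The data of `D` on the triangle `x, y, z` are given by the vectors. -/
structure FaceOK (e : Fin N → Fin N → ℤˣ) (u : Fin N → SVec M) (ε : Finset (Fin N) → ℤˣ)
    (D : DecoratedTriangulation N M) (x y z : Fin N) : Prop where
  lam₁ : D.lam {x, y} = Lam e u x y
  lam₂ : D.lam {y, z} = Lam e u y z
  lam₃ : D.lam {x, z} = Lam e u x z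
  tri : TriangleOK e u ε D.mu x y z

variable {e : Fin N → Fin N → ℤˣ} {u u' : Fin N → SVec M} {ε : Finset (Fin N) → ℤˣ}
  {D : DecoratedTriangulation N M} {x y z : Fin N}

theorem FaceOK.rotate (he : IsCut e) (hxy : x ≠ y) (hxz : x ≠ z) (h : FaceOK e u ε D x y z) :
    FaceOK e u ε D y z x :=
  ⟨h.lam₂, by rw [Finset.pair_comm, h.lam₃, Lam_symm he u hxz],
    by rw [Finset.pair_comm, h.lam₁, Lam_symm he u hxy], h.tri.rotate he hxy hxz⟩

theorem FaceOK.congr (hx : u x = u' x) (hy : u y = u' y) (hz : u z = u' z)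
    (h : FaceOK e u ε D x y z) : FaceOK e u' ε D x y z := by
  obtain ⟨h1, h2, h3, θ, h4, h5⟩ := h
  simp only [Lam, hx, hy, hz] at h1 h2 h3 h5
  exact ⟨h1, h2, h3, θ, h4, h5⟩

theorem FaceOK.of_eq (he : IsCut e) {x' y' z' : Fin N} (hs : sbtw x y z) (hs' : sbtw x' y' z')
    (heq : ({x, y, z} : Finset (Fin N)) = {x', y', z'}) (h : FaceOK e u ε D x y z) :
    FaceOK e u ε D x' y' z' := by
  have h1 : x' ∈ ({x, y, z} : Finset (Fin N)) := heq ▸ by simp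
  have h2 : y' ∈ ({x, y, z} : Finset (Fin N)) := heq ▸ by simp
  have h3 : z' ∈ ({x, y, z} : Finset (Fin N)) := heq ▸ by simp
  simp only [Finset.mem_insert, Finset.mem_singleton] at h1 h2 h3
  have hne : x ≠ y ∧ x ≠ z ∧ y ≠ z := by
    simp only [Fin.ext_iff, ne_eq, sbtw_iff] at *
    omega
  have key : (x' = x ∧ y' = y ∧ z' = z) ∨ (x' = y ∧ y' = z ∧ z' = x) ∨
      (x' = z ∧ y' = x ∧ z' = y) := by
    clear h heq he
    rcases h1 with rfl | rfl | rfl <;> rcases h2 with rfl | rfl | rfl <;>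
      rcases h3 with rfl | rfl | rfl <;>
      first
      | exact Or.inl ⟨rfl, rfl, rfl⟩
      | exact Or.inr (Or.inl ⟨rfl, rfl, rfl⟩)
      | exact Or.inr (Or.inr ⟨rfl, rfl, rfl⟩)
      | (exfalso; simp only [sbtw_iff] at *; omega)
  rcases key with ⟨rfl, rfl, rfl⟩ | ⟨rfl, rfl, rfl⟩ | ⟨rfl, rfl, rfl⟩
  · exact h
  · exact h.rotate he hne.1 hne.2.1
  · exact (h.rotate he hne.1 hne.2.1).rotate he hne.2.2 hne.1.symm

theorem exists_vector_of_lam (e : Fin N → Fin N → ℤˣ) (u : Fin N → SVec M) {r l z : Fin N}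
    (hrl : e r l = 1) (hpos : Pos (Lam e u r l)) (hzr : z ≠ r) (hzl : z ≠ l) (c₁ c₂ : Ev M)
    (ψ : Od M) : ∃ w, Lam e (Function.update u z w) r z = c₁ ∧
      Lam e (Function.update u z w) l z = c₂ ∧ bracket (u r) (u l) w = ψ := by
  have h1 : Pos (pair (u r) (u l)) := by
    rw [Lam, hrl, sg_one, one_mul] at hpos; exact hpos
  obtain ⟨w, hw1, hw2, hw3⟩ := exists_vector _ _ h1 (sg M (e r z) * c₁) (sg M (e l z) * c₂) ψ
  refine ⟨w, ?_, ?_, hw3⟩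
  · rw [Lam, Function.update_self, Function.update_of_ne hzr.symm, hw1, ← mul_assoc, sg_mul_self,
      one_mul]
  · rw [Lam, Function.update_self, Function.update_of_ne hzl.symm, hw2, ← mul_assoc, sg_mul_self,
      one_mul]

/-- A triangle that is attached to an edge with given vectors. -/
theorem exists_faceOK (ε : Finset (Fin N) → ℤˣ) (u : Fin N → SVec M) {r l z : Fin N}
    (hrl : e r l = 1) (h : D.lam {r, l} = Lam e u r l) (hpos : Pos (Lam e u r l))
    (hzr : z ≠ r) (hzl : z ≠ l) (h₁ : ∃ c : Ev M, D.lam {r, z} = c)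
    (h₂ : ∃ c : Ev M, D.lam {l, z} = c) (h₃ : ∃ θ : Od M, D.mu {r, l, z} = θ) :
    ∃ w, FaceOK e (Function.update u z w) ε D r l z := by
  obtain ⟨c₁, h₁⟩ := h₁
  obtain ⟨c₂, h₂⟩ := h₂
  obtain ⟨θ, h₃⟩ := h₃
  obtain ⟨w, hw1, hw2, hw3⟩ := exists_vector_of_lam e u hrl hpos hzr hzl c₁ c₂
    (sg M (ε {r, l, z}) • esqrt (Lam e u r l * c₂ * c₁) • θ)
  have hL : Lam e (Function.update u z w) r l = Lam e u r l := by
    simp only [Lam, Function.update_of_ne hzr.symm, Function.update_of_ne hzl.symm]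
  refine ⟨w, by rw [hL, h], by rw [h₂, hw2], by rw [h₁, hw1], θ, h₃, ?_⟩
  rw [hL, hw1, hw2, Function.update_self, Function.update_of_ne hzr.symm,
    Function.update_of_ne hzl.symm, hw3, smul_smul (sg M _), sg_mul_self, one_smul]

/-- A triangle on the other side of the edge. -/
theorem exists_faceOK' (he : IsCut e) (ε : Finset (Fin N) → ℤˣ) (u : Fin N → SVec M) {r l z : Fin N}
    (hrl : e r l = 1) (h : D.lam {r, l} = Lam e u r l) (hpos : Pos (Lam e u r l))
    (hzr : z ≠ r) (hzl : z ≠ l) (h₁ : ∃ c : Ev M, D.lam {r, z} = c)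
    (h₂ : ∃ c : Ev M, D.lam {l, z} = c) (h₃ : ∃ θ : Od M, D.mu {r, l, z} = θ) :
    ∃ w, FaceOK e (Function.update u z w) ε D r z l := by
  -- Traversing the triangle in the other direction changes the sign of the bracket, hence the
  -- opposite triangle signs.
  obtain ⟨w, h1, h2, h3, θ, h4, h5⟩ := exists_faceOK (-ε) u hrl h hpos hzr hzl h₁ h₂ h₃
  refine ⟨w, h3, by rw [Finset.pair_comm, h2, Lam_symm he _ hzl], h1, θ, ?_, ?_⟩
  · rw [← h4, Finset.pair_comm]
  · rw [Finset.pair_comm z l, Lam_symm he _ hzl.symm, bracket_swap, ← bracket_cyclic]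
    rw [Pi.neg_apply, sg_neg] at h5
    rw [show Lam e (Function.update u z w) r z * Lam e (Function.update u z w) l z *
      Lam e (Function.update u z w) r l = Lam e (Function.update u z w) r l *
      Lam e (Function.update u z w) l z * Lam e (Function.update u z w) r z by ring, h5]
    simp

end FaceOK

section Realize

variable {M : Type*} [AddCommGroup M] [Module ℝ M] {n : ℕ} {L : Labelling n}
  {T : SimpleGraph (Fin (n + 3))} {a b : Fin (n + 3)} {r l q : Fin n → Fin (n + 3)}

theorem Labelling.IsChain.ne (h : L.IsChain T a b r l q) (k : Fin n) :
    a ≠ r k ∧ a ≠ l k ∧ b ≠ r k ∧ b ≠ l k ∧ r k ≠ l k ∧ q k ≠ r k ∧ q k ≠ l k := by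
  have h1 := h.right k
  have h2 := h.left k
  have h3 := h.between k
  simp only [Fin.ext_iff, ne_eq, sbtw_iff] at *
  omega

theorem Labelling.IsChain.sbtw_first (h : L.IsChain T a b r l q) (k : Fin n) :
    sbtw a (r k) (l k) := by
  have h1 := h.right k
  have h2 := h.left k
  simp only [sbtw_iff] at *
  omega

theorem Labelling.IsChain.sbtw_new (h : L.IsChain T a b r l q) (k : Fin n) :
    sbtw a (r k) (q k) ∧ sbtw a (q k) (l k) := by
  have h1 := h.sbtw_first k
  have h3 := h.between k
  simp only [sbtw_iff] at *
  omega

/-- The triangle in front of a diagonal. -/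
theorem Labelling.IsChain.exists_back (h : L.IsChain T a b r l q) (k : Fin n) :
    ∃ p, L.face k.castSucc = {r k, l k, p} ∧ sbtw (l k) p (r k) ∧
      ((k.val = 0 ∧ p = a) ∨ (k.val ≠ 0 ∧ L.center k.castSucc = r k ∧ sbtw a (l k) p) ∨
        (k.val ≠ 0 ∧ L.center k.castSucc = l k ∧ sbtw a p (r k))) := by
  obtain ⟨k, hk⟩ := k
  cases k with
  | zero =>
    refine ⟨a, h.face_zero _ rfl, ?_, Or.inl ⟨rfl, rfl⟩⟩
    exact sbtw_cyclic_right (h.sbtw_first _)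
  | succ k =>
    have hkk : Fin.succ ⟨k, by omega⟩ = Fin.castSucc ⟨k + 1, hk⟩ := rfl
    have hb := h.between ⟨k, by omega⟩
    obtain ⟨h4, h5⟩ := h.sbtw_new ⟨k, by omega⟩
    rcases h.step _ _ hkk with ⟨h1, h2, h3⟩ | ⟨h1, h2, h3⟩
    · refine ⟨r ⟨k, by omega⟩, ?_, ?_, Or.inr (Or.inr ⟨by simp, ?_, ?_⟩)⟩
      · rw [← hkk, h.face_succ, h1, h2]
        ext x; simp only [Finset.mem_insert, Finset.mem_singleton]; tauto
      · rw [h1, h2]; exact sbtw_cyclic_right hb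
      · rw [← hkk, h3, h1]
      · rw [h2]; exact h4
    · refine ⟨l ⟨k, by omega⟩, ?_, ?_, Or.inr (Or.inl ⟨by simp, ?_, ?_⟩)⟩
      · rw [← hkk, h.face_succ, h1, h2]
        ext x; simp only [Finset.mem_insert, Finset.mem_singleton]; tauto
      · rw [h1, h2]; exact sbtw_cyclic_left hb
      · rw [← hkk, h3, h1]
      · rw [h2]; exact h5

theorem Labelling.IsChain.exists_sbtw_face (h : L.IsChain T a b r l q) (hn : 0 < n)
    (k : Fin (n + 1)) : ∃ x y z, L.face k = {x, y, z} ∧ sbtw x y z := by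
  refine Fin.cases ?_ (fun k => ?_) k
  · exact ⟨r ⟨0, hn⟩, l ⟨0, hn⟩, a, h.face_zero ⟨0, hn⟩ rfl, sbtw_cyclic_left (h.sbtw_first _)⟩
  · exact ⟨r k, q k, l k, by rw [h.face_succ, Finset.pair_comm], h.between k⟩

theorem FaceOK.lam_of_mem {N : ℕ} {e : Fin N → Fin N → ℤˣ} {u : Fin N → SVec M}
    {ε : Finset (Fin N) → ℤˣ} {D : DecoratedTriangulation N M} {x y z i j : Fin N} (he : IsCut e)
    (h : FaceOK e u ε D x y z) (hi : i ∈ ({x, y, z} : Finset (Fin N)))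
    (hj : j ∈ ({x, y, z} : Finset (Fin N))) (hij : i ≠ j) : D.lam {i, j} = Lam e u i j := by
  simp only [Finset.mem_insert, Finset.mem_singleton] at hi hj
  have h1 := h.lam₁
  have h2 := h.lam₂
  have h3 := h.lam₃
  rcases hi with rfl | rfl | rfl <;> rcases hj with rfl | rfl | rfl <;>
    first
    | exact absurd rfl hij
    | assumption
    | (rw [Finset.pair_comm, ← Lam_symm he u hij]; assumption)

variable {D : DecoratedTriangulation (n + 3) M}

/-- The triangles are attached in order. Each has one fresh vertex, whose vector is still free and
can be solved for; changing it does not affect the earlier triangles. -/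
theorem Labelling.IsChain.exists_vectors (h : L.IsChain D.T a b r l q) (hn : 0 < n)
    (hD : D.IsValid) (hL : L.IsLabelling D.T a b) (ε : Finset (Fin (n + 3)) → ℤˣ)
    (m : Fin (n + 1)) :
    ∃ u, ∀ j ≤ m, ∀ x y z, L.face j = {x, y, z} → sbtw x y z → FaceOK (cutSign a) u ε D x y z := by
  have he := isCut_cutSign a
  have hlam : ∀ i j, D.T.Adj i j → ∃ c : Ev M, D.lam {i, j} = c ∧ Pos c := fun i j hij =>
    exists_coe_of_isPositive (hD.lam_pos i j hij)
  have hlam' : ∀ {k i j}, i ∈ L.face k → j ∈ L.face k → i ≠ j →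
      ∃ c : Ev M, D.lam {i, j} = c ∧ Pos c :=
    fun hi hj hij => hlam _ _ (hL.adj hi hj hij)
  have hmu : ∀ k, ∃ θ : Od M, D.mu (L.face k) = θ := fun k =>
    ⟨⟨_, hD.mu_odd _ (hL.isNClique k)⟩, rfl⟩
  induction m using Fin.induction with
  | zero =>
    obtain ⟨k, hk⟩ : ∃ k : Fin n, k = ⟨0, hn⟩ := ⟨_, rfl⟩
    obtain ⟨n1, n2, n3, n4, n5, n6, n7⟩ := h.ne k
    have hf := h.face_zero k (by rw [hk])
    have hr : r k ∈ L.face k.castSucc := by rw [hf]; simp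
    have hl : l k ∈ L.face k.castSucc := by rw [hf]; simp
    have ha : a ∈ L.face k.castSucc := by rw [hf]; simp
    have hrl := cutSign_of_sbtw (h.sbtw_first k)
    obtain ⟨c, hc, hcp⟩ := hlam' hr hl n5
    -- Any two vectors with the correct pairing can serve for the first diagonal; these are the
    -- simplest ones.
    have h0 : Lam (cutSign a) (fun i => if i = r k then ⟨1, 0, 0⟩ else ⟨0, c, 0⟩) (r k) (l k) = c := by
      simp only [Lam, hrl, sg_one, if_pos, if_neg n5.symm, pair]
      simp
    obtain ⟨w, hw⟩ := exists_faceOK ε (D := D)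
      (fun i => if i = r k then ⟨1, 0, 0⟩ else ⟨0, c, 0⟩) hrl (by rw [h0, hc]) (by rw [h0]; exact hcp)
      n1 n2 ((hlam' hr ha n1.symm).imp fun _ h => h.1) ((hlam' hl ha n2.symm).imp fun _ h => h.1)
      (hf ▸ hmu _)
    refine ⟨_, fun j hj x y z hx hs => hw.of_eq he (sbtw_cyclic_left (h.sbtw_first k)) hs ?_⟩
    rw [← hf, ← hx, Fin.le_zero_iff.mp hj, hk]
    rfl
  | succ k ih =>
    obtain ⟨u, hu⟩ := ih
    obtain ⟨n1, n2, n3, n4, n5, n6, n7⟩ := h.ne k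
    have hf := h.face_succ k
    have hr : r k ∈ L.face k.succ := by rw [hf]; simp
    have hl : l k ∈ L.face k.succ := by rw [hf]; simp
    have hq : q k ∈ L.face k.succ := by rw [hf]; simp
    have hrl := cutSign_of_sbtw (h.sbtw_first k)
    obtain ⟨c, hc, hcp⟩ := hlam' hr hl n5
    have h0 : D.lam {r k, l k} = Lam (cutSign a) u (r k) (l k) := by
      obtain ⟨x, y, z, h1, h2⟩ := h.exists_sbtw_face hn k.castSucc
      have hsub : L.diag k ⊆ L.face k.castSucc := Finset.inter_subset_left
      rw [h.diag_eq, h1] at hsub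
      exact (hu _ le_rfl _ _ _ h1 h2).lam_of_mem he (hsub (by simp)) (hsub (by simp)) n5
    have h0p : Pos (Lam (cutSign a) u (r k) (l k)) := by
      rw [h0] at hc
      rwa [Subtype.coe_injective hc]
    obtain ⟨w, hw⟩ := exists_faceOK' he ε (D := D) u hrl h0 h0p
      n6 n7 ((hlam' hr hq n6.symm).imp fun _ h => h.1) ((hlam' hl hq n7.symm).imp fun _ h => h.1)
      (hf ▸ hmu _)
    refine ⟨Function.update u (q k) w, fun j hj x y z hx hs => ?_⟩
    rcases hj.eq_or_lt with rfl | hj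
    · refine hw.of_eq he (h.between k) hs ?_
      rw [Finset.pair_comm, ← hf, hx]
    · have hj' : j ≤ k.castSucc := Nat.lt_succ_iff.mp hj
      have hfr := h.fresh k j hj'
      rw [hx] at hfr
      simp only [Finset.mem_insert, Finset.mem_singleton, not_or] at hfr
      obtain ⟨f1, f2, f3⟩ := hfr
      refine (hu j hj' x y z hx hs).congr ?_ ?_ ?_ <;> rw [Function.update_of_ne] <;>
        (apply Ne.symm; assumption)

open Classical in
/-- The signs of the triangles in the default orientation. -/
def Labelling.faceSign (L : Labelling n) (r : Fin n → Fin (n + 3)) (s : Finset (Fin (n + 3))) : ℤˣ :=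
  if ∃ k : Fin n, k.val = 0 ∧ s = L.face k.castSucc ∧ L.center k.castSucc = r k then -1 else 1

/-- The signs `faceSign` are those for which `compat` describes the default orientation. With the
order cut at `a`, the signs of pairings that enter this condition are 1, except for the pair formed
by the left end of the first diagonal and `a`. That pair enters only if the first diagonal starts at
its right end, and the sign -1 of the first triangle makes up for it. -/
theorem Labelling.IsChain.exists_realizes (h : L.IsChain D.T a b r l q) (hn : 0 < n)
    (hD : D.IsValid) (hL : L.IsLabelling D.T a b) (hdir : L.IsDefault D.dir) :
    ∃ u, Realizes (cutSign a) u (L.faceSign r) D := by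
  have he := isCut_cutSign a
  obtain ⟨u, hu⟩ := h.exists_vectors hn hD hL (L.faceSign r) (Fin.last n)
  have hu := fun j => hu j (Fin.le_last j)
  have lam_eq : ∀ i j, D.T.Adj i j → D.lam {i, j} = Lam (cutSign a) u i j := by
    intro i j hij
    obtain ⟨k, hi, hj⟩ := hL.exists_face hD.triangulation hij
    obtain ⟨x, y, z, h1, h2⟩ := h.exists_sbtw_face hn k
    rw [h1] at hi hj
    exact (hu _ _ _ _ h1 h2).lam_of_mem he hi hj hij.ne
  refine ⟨u, hD.triangulation.nonCrossing, lam_eq, ?_, ?_, hD.dir_iff, ?_⟩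
  · intro i j hij
    have := hD.lam_pos i j hij
    rwa [lam_eq i j hij, isPositive_coe] at this
  · intro i j k hs hij hjk hik
    obtain ⟨m, hm⟩ := (hL.face_iff {i, j, k}).mpr
      (SimpleGraph.is3Clique_triple_iff.mpr ⟨hij, hik, hjk⟩)
    exact (hu m _ _ _ hm hs).tri
  · intro i p j p' hq hd
    obtain ⟨k, hk⟩ := hL.eq_diag hD.triangulation hq.adjPQ hq.right hq.left
    have hk' := hk
    rw [h.diag_eq, finset_pair_eq_iff] at hk'
    obtain ⟨o, ho, hos, hoc⟩ := h.exists_back k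
    obtain ⟨n1, n2, n3, n4, n5, n6, n7⟩ := h.ne k
    have hf := h.face_succ k
    have adj_o : D.T.Adj (r k) o ∧ D.T.Adj (l k) o := by
      have : r k ≠ o ∧ l k ≠ o := by
        clear * - hos
        simp only [Fin.ext_iff, ne_eq, sbtw_iff] at *
        omega
      exact ⟨hL.adj (k := k.castSucc) (by simp [ho]) (by simp [ho]) this.1,
        hL.adj (k := k.castSucc) (by simp [ho]) (by simp [ho]) this.2⟩
    have adj_q : D.T.Adj (r k) (q k) ∧ D.T.Adj (l k) (q k) :=
      ⟨hL.adj (k := k.succ) (by simp [hf]) (by simp [hf]) n6.symm,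
        hL.adj (k := k.succ) (by simp [hf]) (by simp [hf]) n7.symm⟩
    have hnc := hD.triangulation.nonCrossing
    have ε1 : L.faceSign r {r k, l k, q k} = 1 := by
      rw [Labelling.faceSign, if_neg]
      rintro ⟨k', hk1, hk2, -⟩
      rw [← hf] at hk2
      have := congrArg Fin.val (hL.injective hk2)
      simp [hk1] at this
    have ecr : L.center k.castSucc = r k ∨ L.center k.castSucc = l k := by
      have := hL.center_mem_left k
      rw [h.diag_eq] at this
      simpa using this
    have elq := cutSign_of_sbtw (h.sbtw_new k).2
    have erq := cutSign_of_sbtw (h.sbtw_new k).1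
    have no0 : k.val ≠ 0 → L.faceSign r {r k, l k, o} = 1 := by
      intro h0
      rw [Labelling.faceSign, if_neg]
      rintro ⟨k', hk1, hk2, -⟩
      rw [← ho] at hk2
      have := congrArg Fin.val (hL.injective hk2)
      simp only [Fin.val_castSucc] at this
      omega
    have xd := hD.dir_iff _ _ hq.adjPQ
    have dd := hdir k
    rcases Sym2.eq_iff.mp hk' with ⟨e1, e2⟩ | ⟨e1, e2⟩
    · subst e1 e2
      have e3 := hnc.apex_unique hq.right (h.between k) hq.adjPS hq.adjSQ.symm adj_q.1 adj_q.2
      have e4 := hnc.apex_unique hq.left hos hq.adjQR hq.adjRP.symm adj_o.2 adj_o.1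
      subst e3 e4
      have hcr : L.center k.castSucc = r k := by
        rcases ecr with hc | hc
        · exact hc
        · have := dd (r k) (by rw [h.diag_eq]; simp) (by rw [hc]; exact n5)
          rw [hc] at this
          exact absurd this (xd.mp hd)
      rw [ε1, one_mul, elq, one_mul]
      rcases hoc with ⟨h1, h2⟩ | ⟨h1, h2, h3⟩ | ⟨h1, h2, h3⟩
      · rw [Labelling.faceSign, if_pos ⟨k, h1, ho.symm, hcr⟩, h2, he.swap _ _ n2, cutSign_self_left]
      · rw [no0 h1, cutSign_of_sbtw h3]
      · exact absurd (hcr.symm.trans h2) n5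
    · subst e1 e2
      have e3 := hnc.apex_unique hq.right hos hq.adjPS hq.adjSQ.symm adj_o.2 adj_o.1
      have e4 := hnc.apex_unique hq.left (h.between k) hq.adjQR hq.adjRP.symm adj_q.1 adj_q.2
      subst e3 e4
      have hcr : L.center k.castSucc = l k := by
        rcases ecr with hc | hc
        · have := dd (l k) (by rw [h.diag_eq]; simp) (by rw [hc]; exact n5.symm)
          rw [hc] at this
          exact absurd this (xd.mp hd)
        · exact hc
      rw [triple_swap_left (r k) (l k), triple_swap_left (r k) (l k), ε1, mul_one, erq, mul_one]
      rcases hoc with ⟨h1, h2⟩ | ⟨h1, h2, h3⟩ | ⟨h1, h2, h3⟩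
      · rw [Labelling.faceSign, if_neg, h2, cutSign_self_left]
        rintro ⟨k', hk1, -, hk2⟩
        have : k' = k := Fin.ext (hk1.trans h1.symm)
        subst this
        exact n5 (hk2.symm.trans hcr)
      · exact absurd (h2.symm.trans hcr) n5
      · rw [no0 h1, cutSign_of_sbtw h3]

end Realize

end SuperTeich

end

/-! ### Flip sequences: invariance of the λ-length and a sequence that reaches the arc. -/

noncomputable section

namespace SuperTeich

section FlipSequence

variable {M : Type*} [AddCommGroup M] [Module ℝ M]

open DecoratedTriangulation

theorem Realizes.of_reflTransGen {N : ℕ} {e : Fin N → Fin N → ℤˣ} (he : IsCut e)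
    {u : Fin N → SVec M} {ε : Finset (Fin N) → ℤˣ} {D D' : DecoratedTriangulation N M}
    (hR : Realizes e u ε D) (h : Relation.ReflTransGen FlipsTo D D') :
    ∃ ε', Realizes e u ε' D' := by
  induction h with
  | refl => exact ⟨ε, hR⟩
  | tail _ h ih =>
    obtain ⟨ε', hR'⟩ := ih
    obtain ⟨P, S, Q, R, h1, h2, h3, h4, h5, h6, h7, h8, rfl⟩ := h
    exact hR'.flip he ⟨h1, h2, h3, h4, h5, h6, h7⟩ h8

variable {n : ℕ} {L : Labelling n} {a b : Fin (n + 3)} {r l q : Fin n → Fin (n + 3)}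
  {D : DecoratedTriangulation (n + 3) M}

theorem Labelling.IsChain.mem_face (h : L.IsChain D.T a b r l q) (k : Fin n) :
    r k ∈ L.face k.castSucc ∧ l k ∈ L.face k.castSucc := by
  have hsub : L.diag k ⊆ L.face k.castSucc := Finset.inter_subset_left
  rw [h.diag_eq] at hsub
  exact ⟨hsub (by simp), hsub (by simp)⟩

theorem Labelling.IsChain.fresh_ne (h : L.IsChain D.T a b r l q) {j k : Fin n} (hjk : j ≤ k)
    (x : Fin (n + 3)) : s(x, q k) ≠ s(r j, l j) := by
  obtain ⟨h1, h2⟩ := h.mem_face j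
  have h3 := h.fresh k j.castSucc hjk
  exact sym2_ne_right (fun h => h3 (h ▸ h1)) (fun h => h3 (h ▸ h2))

theorem Labelling.IsChain.diag_ne (h : L.IsChain D.T a b r l q) {j k : Fin n} (hjk : j < k) :
    s(r k, l k) ≠ s(r j, l j) := by
  obtain ⟨k, hk⟩ := k
  cases k with
  | zero => exact absurd hjk (Nat.not_lt_zero _)
  | succ k =>
    have hkk : Fin.succ ⟨k, by omega⟩ = Fin.castSucc ⟨k + 1, hk⟩ := rfl
    have hj : j ≤ ⟨k, by omega⟩ := Nat.lt_succ_iff.mp hjk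
    rcases h.step _ _ hkk with ⟨-, h1, -⟩ | ⟨-, h1, -⟩
    · rw [h1, Sym2.eq_swap]; exact h.fresh_ne hj _
    · rw [h1]; exact h.fresh_ne hj _

/-- The diagonals are flipped in order. When it is the turn of the diagonal `k`, the vertex `a` is
already joined to both of its ends, so its quadrilateral has the corners `a` and `q k`, and the flip
creates the edge from `a` to `q k`. At the end this vertex is `b`. -/
theorem Labelling.IsChain.exists_flips (h : L.IsChain D.T a b r l q) (hn : 0 < n)
    (hL : L.IsLabelling D.T a b) {u : Fin (n + 3) → SVec M} {ε : Finset (Fin (n + 3)) → ℤˣ}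
    (hR : Realizes (cutSign a) u ε D) : ∃ D', Relation.ReflTransGen FlipsTo D D' ∧ D'.T.Adj a b := by
  have he := isCut_cutSign a
  have main : ∀ m ≤ n, ∃ D', Relation.ReflTransGen FlipsTo D D' ∧
      (∀ i j, D.T.Adj i j → (∀ k : Fin n, k.val < m → s(i, j) ≠ s(r k, l k)) → D'.T.Adj i j) ∧
      (∀ k : Fin n, k.val = m → D'.T.Adj (r k) a ∧ D'.T.Adj (l k) a) ∧
      (∀ k : Fin n, k.val + 1 = m → D'.T.Adj a (q k)) := by
    intro m
    induction m with
    | zero =>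
      intro _
      refine ⟨D, .refl, fun i j h _ => h, fun k hk => ?_, fun k hk => by omega⟩
      have hf := h.face_zero k hk
      obtain ⟨n1, n2, -⟩ := h.ne k
      exact ⟨hL.adj (k := k.castSucc) (by simp [hf]) (by simp [hf]) n1.symm,
        hL.adj (k := k.castSucc) (by simp [hf]) (by simp [hf]) n2.symm⟩
    | succ m ih =>
      intro hm
      obtain ⟨D', h1, h2, h3, -⟩ := ih (by omega)
      obtain ⟨k, hk⟩ : ∃ k : Fin n, k = ⟨m, hm⟩ := ⟨_, rfl⟩
      have hkm : k.val = m := by rw [hk]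
      obtain ⟨hra, hla⟩ := h3 k hkm
      obtain ⟨n1, n2, n3, n4, n5, n6, n7⟩ := h.ne k
      have hf := h.face_succ k
      have hrl : D'.T.Adj (r k) (l k) := by
        refine h2 _ _ (hL.adj (k := k.succ) (by simp [hf]) (by simp [hf]) n5) fun j hj => ?_
        exact h.diag_ne (Fin.lt_def.mpr (by omega))
      have hrq : D'.T.Adj (r k) (q k) := by
        refine h2 _ _ (hL.adj (k := k.succ) (by simp [hf]) (by simp [hf]) n6.symm) fun j hj => ?_
        exact h.fresh_ne (Fin.le_def.mpr (by omega)) _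
      have hlq : D'.T.Adj (l k) (q k) := by
        refine h2 _ _ (hL.adj (k := k.succ) (by simp [hf]) (by simp [hf]) n7.symm) fun j hj => ?_
        exact h.fresh_ne (Fin.le_def.mpr (by omega)) _
      obtain ⟨ε', hR'⟩ := hR.of_reflTransGen he h1
      have hquad : IsQuad D'.T (r k) (q k) (l k) a :=
        ⟨h.between k, sbtw_cyclic_right (h.sbtw_first k), hrl, hrq, hlq.symm, hla, hra.symm⟩
      have nqa : q k ≠ a := hquad.ne.2.2.2.2.1
      -- A flip is described starting from the tail of the edge, so the roles of the ends and of the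
      -- apexes depend on its present orientation; the resulting graph does not.
      obtain ⟨D'', hD, hT⟩ : ∃ D'', FlipsTo D' D'' ∧ ∀ i j, D''.T.Adj i j ↔
          (D'.T.Adj i j ∧ s(i, j) ≠ s(r k, l k)) ∨ s(i, j) = s(a, q k) := by
        by_cases hd : D'.dir (r k) (l k)
        · refine ⟨D'.flip (r k) (q k) (l k) a, ⟨_, _, _, _, hquad.right, hquad.left, hquad.adjPQ,
            hquad.adjPS, hquad.adjSQ, hquad.adjQR, hquad.adjRP, hd, rfl⟩, fun i j => ?_⟩
          rw [Sym2.eq_swap (a := a)]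
          exact flipGraph_adj nqa i j
        · have hd' := (hR'.dir_iff _ _ hrl.symm).mpr hd
          have hq' := hquad.symm
          refine ⟨D'.flip (l k) a (r k) (q k), ⟨_, _, _, _, hq'.right, hq'.left, hq'.adjPQ,
            hq'.adjPS, hq'.adjSQ, hq'.adjQR, hq'.adjRP, hd', rfl⟩, fun i j => ?_⟩
          rw [Sym2.eq_swap (a := r k)]
          exact flipGraph_adj nqa.symm i j
      refine ⟨D'', h1.tail hD, ?_, ?_, ?_⟩
      · intro i j hij hj
        refine (hT i j).mpr (Or.inl ⟨h2 i j hij fun k' hk' => hj k' (by omega), hj k (by omega)⟩)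
      · intro k' hk'
        have haq : D''.T.Adj (q k) a := (hT _ _).mpr (Or.inr Sym2.eq_swap)
        have har : D''.T.Adj (r k) a := (hT _ _).mpr (Or.inl ⟨hra, sym2_ne_right n1 n2⟩)
        have hal : D''.T.Adj (l k) a := (hT _ _).mpr (Or.inl ⟨hla, sym2_ne_right n1 n2⟩)
        rcases h.step k k' (Fin.ext (by simp; omega)) with ⟨e1, e2, -⟩ | ⟨e1, e2, -⟩
        · rw [e1, e2]; exact ⟨haq, hal⟩
        · rw [e1, e2]; exact ⟨har, haq⟩
      · intro k' hk'
        have : k' = k := Fin.ext (by omega)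
        rw [this]
        exact (hT _ _).mpr (Or.inr rfl)
  obtain ⟨D', h1, -, -, h2⟩ := main n le_rfl
  have hl : (⟨n - 1, by omega⟩ : Fin n).val + 1 = n := by simp; omega
  refine ⟨D', h1, ?_⟩
  rw [← h.q_last _ hl]
  exact h2 _ hl

/-- All flip sequences lead to the same `λ`-length of the arc. -/
theorem Labelling.IsChain.isLambdaLength_iff (h : L.IsChain D.T a b r l q) (hn : 0 < n)
    (hL : L.IsLabelling D.T a b) {u : Fin (n + 3) → SVec M} {ε : Finset (Fin (n + 3)) → ℤˣ}
    (hR : Realizes (cutSign a) u ε D) (x : ExteriorAlgebra ℝ M) :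
    D.IsLambdaLength a b x ↔ x = (Lam (cutSign a) u a b : Ev M) := by
  constructor
  · rintro ⟨D', h1, h2, rfl⟩
    obtain ⟨ε', hR'⟩ := hR.of_reflTransGen (isCut_cutSign a) h1
    exact hR'.lam_eq _ _ h2
  · rintro rfl
    obtain ⟨D', h1, h2⟩ := h.exists_flips hn hL hR
    obtain ⟨ε', hR'⟩ := hR.of_reflTransGen (isCut_cutSign a) h1
    exact ⟨D', h1, h2, (hR'.lam_eq _ _ h2).symm⟩

end FlipSequence

end SuperTeich

end

/-! ### Paths as words of an automaton, and the one-step recursion for their sums. -/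

noncomputable section

namespace SuperTeich

section Accepted

variable {S Y A : Type*} [Semiring A] (term : S → Prop) (ok : S → Y → Prop) (f : S → Y → S)
  (W : S → Y → A)

/-- The words that are accepted from the state `s` of an automaton. -/
def Accepts : List Y → S → Prop
  | [], s => term s
  | y :: t, s => ok s y ∧ Accepts t (f s y)

/-- The weight of a word: the product of the weights of its letters. -/
def wordWeight : List Y → S → A
  | [], _ => 1
  | y :: t, s => W s y * wordWeight t (f s y)

/-- The sum of the weights of the accepted words. -/
def accSum (s : S) : A := ∑ᶠ t ∈ {t | Accepts term ok f t s}, wordWeight f W t s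

variable {term ok f}

theorem setOf_accepts (s : S) : {t | Accepts term ok f t s} =
    {t | t = [] ∧ term s} ∪ ⋃ y, List.cons y '' {t | ok s y ∧ Accepts term ok f t (f s y)} := by
  ext t
  cases t with
  | nil => simp [Accepts]
  | cons y t => simp [Accepts]

/-- The rank of the state decreases with each letter, so it bounds the length, and the alphabet is
finite. -/
theorem finite_accepts [Finite Y] (rank : S → ℕ) (h : ∀ s y, ok s y → rank (f s y) < rank s)
    (s : S) : {t | Accepts term ok f t s}.Finite := by
  induction hk : rank s using Nat.strong_induction_on generalizing s with
  | _ k ih =>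
    rw [setOf_accepts]
    refine ((Set.finite_singleton []).subset fun t ht => ht.1).union (Set.finite_iUnion fun y => ?_)
    refine Set.Finite.image _ ?_
    by_cases hy : ok s y
    · exact (ih _ (hk ▸ h s y hy) _ rfl).subset fun t ht => ht.2
    · exact Set.finite_empty.subset fun t ht => hy ht.1

open Classical in
-- The words are sorted by their first letter. Finiteness is essential, since a `finsum` with
-- infinite support would have the default value 0.
theorem accSum_eq [Fintype Y] (hf : ∀ s, {t | Accepts term ok f t s}.Finite) (s : S) :
    accSum term ok f W s = (if term s then 1 else 0) +
      ∑ y, if ok s y then W s y * accSum term ok f W (f s y) else 0 := by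
  have hfin := hf s
  rw [setOf_accepts] at hfin
  rw [accSum, setOf_accepts, finsum_mem_union ?_ (hfin.subset Set.subset_union_left)
    (hfin.subset Set.subset_union_right)]
  · congr 1
    · by_cases h : term s
      · simp [h, wordWeight]
      · simp [h]
    · rw [finsum_mem_iUnion ?_ fun y => (hfin.subset Set.subset_union_right).subset
        (Set.subset_iUnion (fun y => List.cons y '' {t | ok s y ∧ Accepts term ok f t (f s y)}) y),
        finsum_eq_sum_of_fintype]
      · refine Finset.sum_congr rfl fun y _ => ?_
        rw [finsum_mem_image (List.cons_injective.injOn)]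
        by_cases h : ok s y
        · simp only [h, true_and, if_true, wordWeight]
          exact (mul_finsum_mem' _ _ (hf _)).symm
        · simp [h]
      · intro y y' hyy
        rw [Function.onFun, Set.disjoint_left]
        rintro t ⟨t1, -, rfl⟩ ⟨t2, -, h⟩
        exact hyy (List.cons.inj h).1.symm
  · rw [Set.disjoint_left]
    rintro t ⟨rfl, -⟩ h
    simp at h

end Accepted

section AuxVertex

variable {n : ℕ}

/-- The internal vertices of the auxiliary graph and those of the polygon. -/
def auxVertexEquiv (n : ℕ) : Fin (n + 3) ⊕ Fin (n + 1) ≃ AuxVertex n where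
  toFun := Sum.elim .poly .face
  invFun
    | .poly v => .inl v
    | .face k => .inr k
  left_inv x := by cases x <;> rfl
  right_inv x := by cases x <;> rfl

instance : Fintype (AuxVertex n) := Fintype.ofEquiv _ (auxVertexEquiv n)

theorem sum_auxVertex {A : Type*} [AddCommMonoid A] (g : AuxVertex n → A) :
    ∑ y, g y = ∑ v, g (.poly v) + ∑ k, g (.face k) := by
  rw [← (auxVertexEquiv n).sum_comp, Fintype.sum_sum_type]
  rfl

end AuxVertex

namespace Labelling

variable {M : Type*} [AddCommGroup M] [Module ℝ M] {n : ℕ} (L : Labelling n)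
  (D : DecoratedTriangulation (n + 3) M) (a b : Fin (n + 3))

/-- The state of a path: all further crossings of the arc have to be at positions `≥ pos`, the
next step is an odd one or not, and the path has reached the vertex `vert`. -/
structure PathState (n : ℕ) where
  pos : ℕ
  odd : Bool
  vert : AuxVertex n

open Classical in
/-- The least position for further crossings of the arc after a step. -/
def advance (p : ℕ) : AuxVertex n → AuxVertex n → ℕ
  | .poly u, .poly v => if h : ∃ k : Fin n, L.diag k = {u, v} then max p (2 * h.choose.val + 2) else p
  | .face i, .face j => max p (2 * (max i.val j.val) + 1)
  | _, _ => p

/-- The state after a step. -/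
def nextState (s : PathState n) (y : AuxVertex n) : PathState n :=
  ⟨L.advance s.pos s.vert y, !s.odd, y⟩

/-- The steps that are allowed in a twisted path. -/
structure StepOK (T : SimpleGraph (Fin (n + 3))) (s : PathState n) (y : AuxVertex n) : Prop where
  adj : L.AuxAdj T s.vert y
  crosses : s.odd = false → CrossesArc a b s.vert y
  forward : TauForward s.vert y
  sigma : IsSigma s.vert y → s.odd = true
  tau : IsTau s.vert y → s.odd = false
  pos_le : ∀ q ∈ L.arcPos s.vert y, s.pos ≤ q

/-- The states in which a path is complete. -/
def IsFinal (s : PathState n) : Prop := s.vert = .poly b ∧ s.odd = false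

open Classical in
/-- The sign of the `μ`-invariant of a triangle at the end of the first of a pair of `σ`-steps. -/
def faceUnit (dir : Fin (n + 3) → Fin (n + 3) → Prop) (i : Fin (n + 1)) : ℤˣ :=
  if ∃ k : Fin n, k.castSucc = i ∧ L.OnRight dir k then 1 else -1

/-- The odd factor of the weight of a step. -/
def oddFactor : AuxVertex n → AuxVertex n → ExteriorAlgebra ℝ M
  | .poly _, .face i => ((L.faceUnit D.dir i : ℤ) : ExteriorAlgebra ℝ M) * D.mu (L.face i)
  | .face i, .poly _ => D.mu (L.face i)
  | _, _ => 1

/-- The weight of a step. -/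
def stepWeight (s : PathState n) (y : AuxVertex n) : ExteriorAlgebra ℝ M :=
  L.evenFactor D (if s.odd then 1 else 2) s.vert y * L.oddFactor D s.vert y

/-- The sum of the weights of the ends of twisted paths from a given state on. -/
def pathSum (s : PathState n) : ExteriorAlgebra ℝ M :=
  accSum (IsFinal b) (L.StepOK a b D.T) L.nextState (L.stepWeight D) s

variable {L D a b} {r l q : Fin n → Fin (n + 3)}

theorem IsChain.diag_injective (h : L.IsChain D.T a b r l q) {j k : Fin n}
    (hjk : L.diag j = L.diag k) : j = k := by
  rw [h.diag_eq, h.diag_eq, finset_pair_eq_iff] at hjk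
  rcases lt_trichotomy j k with h1 | h1 | h1
  · exact absurd hjk.symm (h.diag_ne h1)
  · exact h1
  · exact absurd hjk (h.diag_ne h1)

theorem IsChain.crosses (h : L.IsChain D.T a b r l q) {k : Fin n} {u v : Fin (n + 3)}
    (hd : L.diag k = {u, v}) : Crosses a b u v := by
  rw [h.diag_eq, finset_pair_eq_iff] at hd
  rcases Sym2.eq_iff.mp hd with ⟨rfl, rfl⟩ | ⟨rfl, rfl⟩
  · exact Or.inl ⟨h.right k, h.left k⟩
  · exact Or.inr ⟨h.right k, h.left k⟩

theorem IsLabelling.exists_diag_of_crosses {T : SimpleGraph (Fin (n + 3))}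
    (hL : L.IsLabelling T a b) (hT : IsTriangulation T) {u v : Fin (n + 3)} (huv : T.Adj u v)
    (hc : Crosses a b u v) : ∃ k, L.diag k = {u, v} := by
  have : (sbtw u a v ∧ sbtw v b u) ∨ (sbtw u b v ∧ sbtw v a u) := by
    simp only [Crosses, sbtw_iff] at *; omega
  rcases this with h | h
  · exact hL.eq_diag hT huv h.1 h.2
  · exact hL.eq_diag hT huv h.1 h.2

theorem IsLabelling.adj_of_diag {T : SimpleGraph (Fin (n + 3))}
    (hL : L.IsLabelling T a b) {k : Fin n} {u v : Fin (n + 3)} (hd : L.diag k = {u, v}) :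
    T.Adj u v := by
  have hsub := IsLabelling.diag_subset_left L k
  have hc := hL.card_diag k
  rw [hd] at hsub hc
  refine hL.adj (hsub (by simp)) (hsub (by simp)) ?_
  rintro rfl
  simp at hc

theorem IsChain.advance_of_diag (h : L.IsChain D.T a b r l q) {k : Fin n} {u v : Fin (n + 3)}
    (hd : L.diag k = {u, v}) (p : ℕ) : L.advance p (.poly u) (.poly v) = max p (2 * k.val + 2) := by
  have hex : ∃ k : Fin n, L.diag k = {u, v} := ⟨k, hd⟩
  rw [advance, dif_pos hex, h.diag_injective (hex.choose_spec.trans hd.symm)]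

theorem advance_of_not_diag {u v : Fin (n + 3)} (hd : ∀ k, L.diag k ≠ {u, v}) (p : ℕ) :
    L.advance p (.poly u) (.poly v) = p := by
  rw [advance, dif_neg (by simpa using hd)]

theorem IsChain.mem_arcPos (h : L.IsChain D.T a b r l q) {k : Fin n} {u v : Fin (n + 3)}
    (hd : L.diag k = {u, v}) {p : ℕ} :
    p ∈ L.arcPos (.poly u) (.poly v) ↔ p = 2 * k.val + 1 := by
  constructor
  · rintro ⟨k', hk', rfl⟩
    rw [h.diag_injective (hk'.trans hd.symm)]
  · rintro rfl
    exact ⟨k, hd, rfl⟩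

/-- The assumptions on the labelling that are used for the paths. -/
structure IsSetup (L : Labelling n) (D : DecoratedTriangulation (n + 3) M) (a b : Fin (n + 3))
    (r l q : Fin n → Fin (n + 3)) : Prop where
  pos : 0 < n
  valid : D.IsValid
  labelling : L.IsLabelling D.T a b
  default : L.IsDefault D.dir
  chain : L.IsChain D.T a b r l q

theorem IsSetup.finite_accepts (h : IsSetup L D a b r l q) (s : PathState n) :
    {t | Accepts (IsFinal b) (L.StepOK a b D.T) L.nextState t s}.Finite := by
  -- An odd step clears the flag without lowering the position. An even step crosses the arc and
  -- raises the position by at least one, which outweighs the flag that it sets.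
  refine SuperTeich.finite_accepts
    (fun s => 2 * (2 * n + 1 - s.pos) + if s.odd then 1 else 0) ?_ s
  rintro ⟨p, o, x⟩ y hs
  have hle : p ≤ L.advance p x y := by
    cases x <;> cases y <;> simp only [advance] <;> (try split_ifs) <;> simp
  cases o with
  | true =>
    simp only [nextState, Bool.not_true, Bool.false_eq_true, if_false, if_true]
    omega
  | false =>
    have hc := hs.crosses rfl
    simp only [nextState, Bool.not_false, Bool.false_eq_true, if_false, if_true]
    suffices p ≤ 2 * n ∧ p < L.advance p x y by omega
    cases x with
    | poly u =>
      cases y with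
      | poly v =>
        obtain ⟨k, hk⟩ := h.labelling.exists_diag_of_crosses h.valid.triangulation hs.adj hc
        have h1 := hs.pos_le _ ((h.chain.mem_arcPos hk).mpr rfl)
        rw [h.chain.advance_of_diag hk]
        have := k.2
        simp only at h1
        omega
      | face i => exact absurd hc id
    | face i =>
      cases y with
      | poly v => exact absurd hc id
      | face j =>
        have h1 := hs.pos_le (2 * i.val) Set.left_mem_uIcc
        simp only [advance]
        have := i.2
        simp only at h1
        omega

open Classical in
-- Specialized below according to parity and kind of vertex. From a polygon vertex an even step
-- follows a diagonal, and an odd one an edge of the triangulation or a σ-edge. From an internal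
-- vertex an even step is a τ-edge and an odd one a σ-edge.
theorem IsSetup.pathSum_eq (h : IsSetup L D a b r l q) (s : PathState n) :
    L.pathSum D a b s = (if IsFinal b s then 1 else 0) +
      (∑ v, if L.StepOK a b D.T s (.poly v) then
        L.stepWeight D s (.poly v) * L.pathSum D a b (L.nextState s (.poly v)) else 0) +
      ∑ i, if L.StepOK a b D.T s (.face i) then
        L.stepWeight D s (.face i) * L.pathSum D a b (L.nextState s (.face i)) else 0 := by
  rw [pathSum, accSum_eq _ h.finite_accepts, sum_auxVertex, add_assoc]
  rfl

open Classical in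
theorem IsSetup.pathSum_even_poly (h : IsSetup L D a b r l q) (p : ℕ) (v : Fin (n + 3)) :
    L.pathSum D a b ⟨p, false, .poly v⟩ = (if v = b then 1 else 0) +
      ∑ m : Fin n, ∑ v', if p ≤ 2 * m.val + 1 ∧ L.diag m = {v, v'} then
        Ring.inverse (D.lam {v, v'}) * L.pathSum D a b ⟨2 * (m.val + 1), true, .poly v'⟩ else 0 := by
  rw [h.pathSum_eq, Finset.sum_eq_zero (s := Finset.univ (α := Fin (n + 1))), add_zero]
  · congr 1
    · simp [IsFinal]
    · rw [Finset.sum_comm]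
      refine Finset.sum_congr rfl fun v' _ => ?_
      by_cases hd : ∃ m, L.diag m = {v, v'}
      · obtain ⟨m, hm⟩ := hd
        rw [Finset.sum_eq_single m]
        · by_cases hp : p ≤ 2 * m.val + 1
          · rw [if_pos, if_pos ⟨hp, hm⟩]
            · have h1 : L.nextState ⟨p, false, .poly v⟩ (.poly v') =
                  ⟨2 * (m.val + 1), true, .poly v'⟩ := by
                simp only [nextState, h.chain.advance_of_diag hm, Bool.not_false]
                congr 1
                omega
              rw [h1]
              simp [stepWeight, evenFactor, oddFactor]
            · refine ⟨h.labelling.adj_of_diag hm, fun _ => h.chain.crosses hm, trivial,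
                fun h => absurd h id, fun _ => rfl, fun q' hq => ?_⟩
              rw [(h.chain.mem_arcPos hm).mp hq]
              exact hp
          · rw [if_neg, if_neg (fun h => hp h.1)]
            exact fun hs => hp (hs.pos_le _ ((h.chain.mem_arcPos hm).mpr rfl))
        · intro m' _ hm'
          exact if_neg fun h2 => hm' (h.chain.diag_injective (h2.2.trans hm.symm))
        · simp
      · rw [if_neg, Finset.sum_eq_zero]
        · intro m _
          exact if_neg fun h2 => hd ⟨m, h2.2⟩
        · exact fun hs => hd (h.labelling.exists_diag_of_crosses h.valid.triangulation hs.adj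
            (hs.crosses rfl))
  · intro i _
    exact if_neg fun hs => Bool.false_ne_true (hs.sigma trivial)

open Classical in
theorem IsSetup.pathSum_odd_poly (h : IsSetup L D a b r l q) (p : ℕ) (v : Fin (n + 3)) :
    L.pathSum D a b ⟨p, true, .poly v⟩ =
      (∑ v', if D.T.Adj v v' ∧ ∀ m, L.diag m ≠ {v, v'} then
        D.lam {v, v'} * L.pathSum D a b ⟨p, false, .poly v'⟩ else 0) +
      (∑ m : Fin n, ∑ v', if p ≤ 2 * m.val + 1 ∧ L.diag m = {v, v'} then
        D.lam {v, v'} * L.pathSum D a b ⟨2 * (m.val + 1), false, .poly v'⟩ else 0) +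
      ∑ i, if v ∈ L.face i ∧ v ≠ L.center i then
        L.sigmaFactor D v i * (((L.faceUnit D.dir i : ℤ) : ExteriorAlgebra ℝ M) * D.mu (L.face i)) *
          L.pathSum D a b ⟨p, false, .face i⟩ else 0 := by
  rw [h.pathSum_eq, if_neg (fun hf => Bool.false_ne_true hf.2.symm), zero_add]
  congr 1
  · rw [Finset.sum_comm, ← Finset.sum_add_distrib]
    refine Finset.sum_congr rfl fun v' _ => ?_
    by_cases hd : ∃ m, L.diag m = {v, v'}
    · obtain ⟨m, hm⟩ := hd
      rw [if_neg (c := D.T.Adj v v' ∧ ∀ m, L.diag m ≠ {v, v'}) (fun h => h.2 m hm), zero_add,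
        Finset.sum_eq_single m]
      · by_cases hp : p ≤ 2 * m.val + 1
        · rw [if_pos, if_pos ⟨hp, hm⟩]
          · have h1 : L.nextState ⟨p, true, .poly v⟩ (.poly v') =
                ⟨2 * (m.val + 1), false, .poly v'⟩ := by
              simp only [nextState, h.chain.advance_of_diag hm, Bool.not_true]
              congr 1
              omega
            rw [h1]
            simp [stepWeight, evenFactor, oddFactor]
          · refine ⟨h.labelling.adj_of_diag hm, fun h => absurd h.symm Bool.false_ne_true, trivial,
              fun h => absurd h id, fun h => absurd h id, fun q' hq => ?_⟩
            rw [(h.chain.mem_arcPos hm).mp hq]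
            exact hp
        · rw [if_neg, if_neg (fun h => hp h.1)]
          exact fun hs => hp (hs.pos_le _ ((h.chain.mem_arcPos hm).mpr rfl))
      · intro m' _ hm'
        exact if_neg fun h2 => hm' (h.chain.diag_injective (h2.2.trans hm.symm))
      · simp
    · have hd' : ∀ m, L.diag m ≠ {v, v'} := fun m hm => hd ⟨m, hm⟩
      rw [Finset.sum_eq_zero (fun m _ => if_neg fun h2 => hd ⟨m, h2.2⟩), add_zero]
      by_cases hadj : D.T.Adj v v'
      · rw [if_pos, if_pos ⟨hadj, hd'⟩]
        · have h1 : L.nextState ⟨p, true, .poly v⟩ (.poly v') = ⟨p, false, .poly v'⟩ := by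
            simp only [nextState, advance_of_not_diag hd', Bool.not_true]
          rw [h1]
          simp [stepWeight, evenFactor, oddFactor]
        · refine ⟨hadj, fun h => absurd h.symm Bool.false_ne_true, trivial,
              fun h => absurd h id, fun h => absurd h id, ?_⟩
          rintro q' ⟨m, hm, -⟩
          exact absurd hm (hd' m)
      · rw [if_neg (fun hs => hadj hs.adj), if_neg (fun h => hadj h.1)]
  · refine Finset.sum_congr rfl fun i _ => ?_
    have h1 : L.nextState ⟨p, true, .poly v⟩ (.face i) = ⟨p, false, .face i⟩ := rfl
    have h2 : L.StepOK a b D.T ⟨p, true, .poly v⟩ (.face i) ↔ v ∈ L.face i ∧ v ≠ L.center i :=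
      ⟨fun hs => hs.adj, fun hs => ⟨hs, fun h => absurd h.symm Bool.false_ne_true, trivial,
        fun _ => rfl, fun h => absurd h id, fun _ h => absurd h (Set.notMem_empty _)⟩⟩
    simp only [h1, h2]
    rfl

open Classical in
theorem IsSetup.pathSum_even_face (h : IsSetup L D a b r l q) (p : ℕ) (i : Fin (n + 1)) :
    L.pathSum D a b ⟨p, false, .face i⟩ = if p ≤ 2 * i.val then
      ∑ j, if i < j then L.pathSum D a b ⟨2 * j.val + 1, true, .face j⟩ else 0 else 0 := by
  rw [h.pathSum_eq, if_neg (by simp [IsFinal]), Finset.sum_eq_zero, zero_add, zero_add]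
  · by_cases hp : p ≤ 2 * i.val
    · rw [if_pos hp]
      refine Finset.sum_congr rfl fun j _ => ?_
      by_cases hij : i < j
      · have hij' : i.val < j.val := hij
        rw [if_pos hij, if_pos]
        · have h1 : L.nextState ⟨p, false, .face i⟩ (.face j) = ⟨2 * j.val + 1, true, .face j⟩ := by
            simp only [nextState, advance, Bool.not_false]
            congr 1
            omega
          rw [h1]
          simp [stepWeight, evenFactor, oddFactor]
        · refine ⟨hij.ne, fun _ => trivial, hij, fun h => absurd h id, fun _ => rfl, fun q' hq => ?_⟩
          simp only [arcPos, Set.uIcc, Set.mem_Icc] at hq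
          simp only
          omega
      · rw [if_neg hij, if_neg fun hs => hij hs.forward]
    · rw [if_neg hp]
      refine Finset.sum_eq_zero fun j _ => if_neg fun hs => hp (hs.pos_le _ Set.left_mem_uIcc)
  · exact fun v _ => if_neg fun hs => absurd (hs.crosses rfl) id

open Classical in
theorem IsSetup.pathSum_odd_face (h : IsSetup L D a b r l q) (p : ℕ) (j : Fin (n + 1)) :
    L.pathSum D a b ⟨p, true, .face j⟩ =
      ∑ v, if v ∈ L.face j ∧ v ≠ L.center j then
        L.sigmaFactor D v j * D.mu (L.face j) * L.pathSum D a b ⟨p, false, .poly v⟩ else 0 := by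
  rw [h.pathSum_eq, if_neg (by simp [IsFinal]), zero_add,
    Finset.sum_eq_zero (s := Finset.univ (α := Fin (n + 1))), add_zero]
  · refine Finset.sum_congr rfl fun v _ => ?_
    have h1 : L.nextState ⟨p, true, .face j⟩ (.poly v) = ⟨p, false, .poly v⟩ := rfl
    have h2 : L.StepOK a b D.T ⟨p, true, .face j⟩ (.poly v) ↔ v ∈ L.face j ∧ v ≠ L.center j :=
      ⟨fun hs => hs.adj, fun hs => ⟨hs, fun h => absurd h.symm Bool.false_ne_true, trivial,
        fun _ => rfl, fun h => absurd h id, fun _ h => absurd h (Set.notMem_empty _)⟩⟩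
    simp only [h1, h2]
    rfl
  · exact fun v _ => if_neg fun hs => absurd (hs.tau trivial) (by simp)

end Labelling

end SuperTeich

end

/-! ### The recursion along the arc. -/

noncomputable section

namespace SuperTeich

namespace Labelling

variable {M : Type*} [AddCommGroup M] [Module ℝ M] {n : ℕ} (L : Labelling n)
  (D : DecoratedTriangulation (n + 3) M) (a b : Fin (n + 3))

/-- The sum over the ends of paths from the vertex `v`, starting with an even step behind the
triangle `θ_{k-1}`. -/
def evenSum (k : ℕ) (v : Fin (n + 3)) : ExteriorAlgebra ℝ M := L.pathSum D a b ⟨2 * k, false, .poly v⟩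

/-- The sum over the ends of paths from the vertex `v`, starting with an odd step, all further
crossings being behind the triangle `θ_{k-1}`. -/
def oddSum (k : ℕ) (v : Fin (n + 3)) : ExteriorAlgebra ℝ M := L.pathSum D a b ⟨2 * k, true, .poly v⟩

open Classical in
/-- The sum over the ends of paths that start with a `τ`-edge from the triangle `θ_i`. -/
def faceSum (i : Fin (n + 1)) : ExteriorAlgebra ℝ M :=
  ∑ j, if i < j then L.pathSum D a b ⟨2 * j.val + 1, true, .face j⟩ else 0

variable {L D a b} {r l q : Fin n → Fin (n + 3)}

theorem IsLabelling.notMem_later {T : SimpleGraph (Fin (n + 3))} (hL : L.IsLabelling T a b)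
    (hT : IsTriangulation T) {v : Fin (n + 3)} {k : Fin n} (hv : v ∈ L.face k.castSucc)
    (hv' : v ∉ L.diag k) {j : Fin (n + 1)} (hj : k.succ ≤ j) : v ∉ L.face j := by
  intro h
  have hk : k.castSucc ≤ k.succ := Fin.le_def.mpr (by simp)
  exact hv' (Finset.mem_inter.mpr ⟨hv, hL.mem_face_of_le_of_le hT hv h _ hk hj⟩)

theorem IsLabelling.notMem_earlier {T : SimpleGraph (Fin (n + 3))} (hL : L.IsLabelling T a b)
    (hT : IsTriangulation T) {v : Fin (n + 3)} {k : Fin n} (hv : v ∈ L.face k.succ)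
    (hv' : v ∉ L.diag k) {j : Fin (n + 1)} (hj : j ≤ k.castSucc) : v ∉ L.face j := by
  intro h
  have hk : k.castSucc ≤ k.succ := Fin.le_def.mpr (by simp)
  exact hv' (Finset.mem_inter.mpr ⟨hL.mem_face_of_le_of_le hT h hv _ hj hk, hv⟩)

theorem mem_face_of_mem_diag {v : Fin (n + 3)} {k : Fin n} (h : v ∈ L.diag k) :
    v ∈ L.face k.castSucc ∧ v ∈ L.face k.succ := Finset.mem_inter.mp h

theorem pair_left_cancel {c w w' : Fin (n + 3)} (h : ({c, w} : Finset (Fin (n + 3))) = {c, w'}) :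
    w = w' := by
  rcases Sym2.eq_iff.mp (finset_pair_eq_iff.mp h) with ⟨-, h⟩ | ⟨h1, h2⟩
  · exact h
  · exact h2.trans h1

open Classical in
theorem sum_diag (k : Fin n) {v w : Fin (n + 3)} (hd : L.diag k = {v, w})
    (g : Fin (n + 3) → ExteriorAlgebra ℝ M) : (∑ v', if L.diag k = {v, v'} then g v' else 0) = g w := by
  rw [Finset.sum_eq_single w]
  · exact if_pos hd
  · intro v' _ hv'
    exact if_neg fun h' => hv' (pair_left_cancel (h'.symm.trans hd))
  · simp

theorem faceSum_last : L.faceSum D a b (Fin.last n) = 0 := by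
  rw [faceSum]
  exact Finset.sum_eq_zero fun j _ => if_neg (Fin.le_last j).not_gt

variable (h : IsSetup L D a b r l q)

include h

/-- An even step from a polygon vertex can only cross at an odd position, so the bounds `2 * k` and
`2 * k + 1` have the same effect. -/
theorem IsSetup.pathSum_even_poly_succ (k : ℕ) (v : Fin (n + 3)) :
    L.pathSum D a b ⟨2 * k + 1, false, .poly v⟩ = L.evenSum D a b k v := by
  classical
  rw [evenSum, h.pathSum_even_poly, h.pathSum_even_poly]
  congr 1
  refine Finset.sum_congr rfl fun m _ => Finset.sum_congr rfl fun v' _ => ?_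
  have : 2 * k + 1 ≤ 2 * m.val + 1 ↔ 2 * k ≤ 2 * m.val + 1 := by omega
  exact if_congr (and_congr_left' this) rfl rfl

theorem IsSetup.evenSum_last (v : Fin (n + 3)) [Decidable (v = b)] :
    L.evenSum D a b n v = if v = b then 1 else 0 := by
  classical
  rw [evenSum, h.pathSum_even_poly, Finset.sum_eq_zero, add_zero]
  · congr
  · intro m _
    refine Finset.sum_eq_zero fun v' _ => if_neg fun h' => ?_
    have := m.2
    omega

/-- Either the next even step does not use the diagonal `k`, or it crosses it to the other end. -/
theorem IsSetup.evenSum_of_mem {k : Fin n} {v w : Fin (n + 3)} (hd : L.diag k = {v, w}) :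
    L.evenSum D a b k v = L.evenSum D a b (k + 1) v +
      Ring.inverse (D.lam {v, w}) * L.oddSum D a b (k + 1) w := by
  classical
  rw [evenSum, evenSum, h.pathSum_even_poly, h.pathSum_even_poly, add_assoc]
  congr 1
  rw [← Finset.add_sum_erase _ _ (Finset.mem_univ k), add_comm,
    ← Finset.add_sum_erase _ _ (Finset.mem_univ k)]
  rw [Finset.sum_eq_zero (f := fun v' => ite (2 * (k.val + 1) ≤ 2 * k.val + 1 ∧ _) _ _), zero_add]
  · congr 1
    · refine Finset.sum_congr rfl fun m hm => Finset.sum_congr rfl fun v' _ => ?_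
      have hm' : m.val ≠ k.val := fun h => (Finset.mem_erase.mp hm).1 (Fin.ext h)
      have : 2 * k.val ≤ 2 * m.val + 1 ↔ 2 * (k.val + 1) ≤ 2 * m.val + 1 := by omega
      exact if_congr (and_congr_left' this) rfl rfl
    · have : 2 * k.val ≤ 2 * k.val + 1 := by omega
      simp only [this, true_and]
      exact sum_diag k hd fun v' =>
        Ring.inverse (D.lam {v, v'}) * L.pathSum D a b ⟨2 * (k.val + 1), true, .poly v'⟩
  · exact fun v' _ => if_neg fun h' => by omega

theorem IsSetup.evenSum_of_notMem {k : Fin n} {v : Fin (n + 3)} (hd : v ∉ L.diag k) :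
    L.evenSum D a b k v = L.evenSum D a b (k + 1) v := by
  classical
  rw [evenSum, evenSum, h.pathSum_even_poly, h.pathSum_even_poly]
  congr 1
  refine Finset.sum_congr rfl fun m hm => Finset.sum_congr rfl fun v' _ => ?_
  by_cases hd' : L.diag m = {v, v'}
  · have hm' : m.val ≠ k.val := fun h => hd (by rw [← Fin.ext h, hd']; simp)
    have : 2 * k.val ≤ 2 * m.val + 1 ↔ 2 * (k.val + 1) ≤ 2 * m.val + 1 := by omega
    exact if_congr (and_congr_left' this) rfl rfl
  · rw [if_neg fun h => hd' h.2, if_neg fun h => hd' h.2]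

theorem IsSetup.exists_face_of_evenSum_ne_zero {k : Fin n} {v : Fin (n + 3)}
    (hv : L.evenSum D a b k v ≠ 0) : ∃ j, k.succ ≤ j ∧ v ∈ L.face j := by
  classical
  by_contra! hc
  apply hv
  rw [evenSum, h.pathSum_even_poly, if_neg, zero_add]
  · refine Finset.sum_eq_zero fun m _ => Finset.sum_eq_zero fun v' _ => if_neg fun h' => ?_
    refine hc m.succ (Fin.le_def.mpr (by simp; omega)) (mem_face_of_mem_diag ?_).2
    rw [h'.2]; simp
  · rintro rfl
    exact hc _ (Fin.le_last _) h.labelling.last_mem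

/-- Such a vertex is a dead end: it belongs to no later triangle, so it is neither `b` nor an end of
a diagonal that can still be crossed. -/
theorem IsSetup.evenSum_succ_eq_zero {k : Fin n} {v : Fin (n + 3)} (hv : v ∈ L.face k.castSucc)
    (hv' : v ∉ L.diag k) : L.evenSum D a b k v = 0 := by
  by_contra hc
  obtain ⟨j, hj, hj'⟩ := h.exists_face_of_evenSum_ne_zero hc
  exact h.labelling.notMem_later h.valid.triangulation hv hv' hj hj'

/-- The triangle in front of the diagonal has no σ-edge at its fan center, so raising the bound past
this diagonal only loses the odd step along it. -/
theorem IsSetup.oddSum_center_add {k : Fin n} {w : Fin (n + 3)}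
    (hd : L.diag k = {L.center k.castSucc, w}) :
    L.oddSum D a b k (L.center k.castSucc) = L.oddSum D a b (k + 1) (L.center k.castSucc) +
      D.lam {L.center k.castSucc, w} * L.evenSum D a b (k + 1) w := by
  classical
  obtain ⟨c, hc⟩ : ∃ c, c = L.center k.castSucc := ⟨_, rfl⟩
  rw [← hc] at hd ⊢
  rw [oddSum, oddSum, h.pathSum_odd_poly, h.pathSum_odd_poly]
  rw [← Finset.add_sum_erase (Finset.univ : Finset (Fin n)) _ (Finset.mem_univ k)]
  rw [← Finset.add_sum_erase (Finset.univ : Finset (Fin n)) (fun m => ∑ v', ite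
    (2 * (k.val + 1) ≤ 2 * m.val + 1 ∧ _) _ _) (Finset.mem_univ k)]
  have e1 : ∀ v', D.T.Adj c v' ∧ (∀ m, L.diag m ≠ {c, v'}) →
      L.pathSum D a b ⟨2 * k.val, false, .poly v'⟩ =
        L.pathSum D a b ⟨2 * (k.val + 1), false, .poly v'⟩ := by
    rintro v' ⟨h1, h2⟩
    refine h.evenSum_of_notMem fun hv => ?_
    rw [hd, Finset.mem_insert, Finset.mem_singleton] at hv
    rcases hv with rfl | rfl
    · exact h1.ne rfl
    · exact h2 k hd
  have e2 : (∑ v', if 2 * (k.val + 1) ≤ 2 * k.val + 1 ∧ L.diag k = {c, v'} then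
      D.lam {c, v'} * L.pathSum D a b ⟨2 * (k.val + 1), false, .poly v'⟩ else 0) = 0 :=
    Finset.sum_eq_zero fun v' _ => if_neg fun h' => by omega
  have e3 : (∑ v', if 2 * k.val ≤ 2 * k.val + 1 ∧ L.diag k = {c, v'} then
      D.lam {c, v'} * L.pathSum D a b ⟨2 * (k.val + 1), false, .poly v'⟩ else 0) =
      D.lam {c, w} * L.evenSum D a b (k + 1) w := by
    have : 2 * k.val ≤ 2 * k.val + 1 := by omega
    simp only [this, true_and]
    exact sum_diag k hd fun v' =>
      D.lam {c, v'} * L.pathSum D a b ⟨2 * (k.val + 1), false, .poly v'⟩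
  have e4 : ∀ m ∈ Finset.univ.erase k, (2 * k.val ≤ 2 * m.val + 1 ↔ 2 * (k.val + 1) ≤ 2 * m.val + 1) := by
    intro m hm
    have hm' : m.val ≠ k.val := fun h => (Finset.mem_erase.mp hm).1 (Fin.ext h)
    omega
  have e5 : ∀ i, c ∈ L.face i ∧ c ≠ L.center i → L.pathSum D a b ⟨2 * k.val, false, .face i⟩ =
      L.pathSum D a b ⟨2 * (k.val + 1), false, .face i⟩ := by
    rintro i ⟨-, hi⟩
    have hik : i.val ≠ k.val := by
      intro h'
      rw [show i = k.castSucc from Fin.ext h'] at hi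
      exact hi hc
    rw [h.pathSum_even_face, h.pathSum_even_face]
    have : 2 * k.val ≤ 2 * i.val ↔ 2 * (k.val + 1) ≤ 2 * i.val := by omega
    simp only [this]
  rw [e2, e3, zero_add]
  rw [Finset.sum_congr rfl fun v' _ => ite_congr rfl (fun hv => by rw [e1 v' hv]) fun _ => rfl]
  rw [Finset.sum_congr rfl fun m hm => Finset.sum_congr rfl fun v' _ =>
    if_congr (and_congr_left' (e4 m hm)) rfl rfl]
  rw [Finset.sum_congr (g := fun i => ite (c ∈ L.face i ∧ c ≠ L.center i) _ _) rfl
    fun i _ => ite_congr rfl (fun hi => by rw [e5 i hi]) fun _ => rfl]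
  abel

theorem IsSetup.pathSum_face_eq_zero {k : Fin n} {i : Fin (n + 1)} (hi : i < k.castSucc) :
    L.pathSum D a b ⟨2 * k.val, false, .face i⟩ = 0 := by
  have hi' : i.val < k.val := hi
  rw [h.pathSum_even_face, if_neg (by omega)]

theorem IsSetup.pathSum_face_eq (i : Fin (n + 1)) :
    L.pathSum D a b ⟨2 * i.val, false, .face i⟩ = L.faceSum D a b i := by
  rw [h.pathSum_even_face, if_pos le_rfl, faceSum]

/-- The triangle between the two diagonals is the last one containing `w`. So a path can leave `w`
only along the side to `w'` or through the σ-edge of this triangle; all other neighbours are dead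
ends. -/
theorem IsSetup.oddSum_noncenter {k k' : Fin n} (hk : k.succ = k'.castSucc) {c w w' : Fin (n + 3)}
    (hd : L.diag k = {c, w}) (hd' : L.diag k' = {c, w'}) (hf : L.face k.succ = {c, w, w'})
    (hc : L.center k.succ = c) (hcw : c ≠ w) (hww : w ≠ w') (hcw' : c ≠ w') :
    L.oddSum D a b k' w = D.lam {w, w'} * L.evenSum D a b k' w' +
      L.sigmaFactor D w k.succ * (((L.faceUnit D.dir k.succ : ℤ) : ExteriorAlgebra ℝ M) *
        D.mu (L.face k.succ)) * L.faceSum D a b k.succ := by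
  classical
  have hT := h.valid.triangulation
  have hwd : w ∉ L.diag k' := by rw [hd']; simp [hcw.symm, hww]
  have hwd' : w' ∉ L.diag k := by rw [hd]; simp [hcw'.symm, hww.symm]
  have hwf : w ∈ L.face k.succ := by rw [hf]; simp
  have hwf' : w' ∈ L.face k.succ := by rw [hf]; simp
  have later : ∀ j, k'.succ ≤ j → w ∉ L.face j := fun j hj =>
    h.labelling.notMem_later hT (hk ▸ hwf) hwd hj
  have hkv : k'.val = k.val + 1 := by simpa using (congrArg Fin.val hk).symm
  have nd : ∀ m, L.diag m ≠ {w, w'} := by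
    intro m hm
    have h1 := mem_face_of_mem_diag (L := L) (k := m) (v := w) (by rw [hm]; simp)
    have h2 := mem_face_of_mem_diag (L := L) (k := m) (v := w') (by rw [hm]; simp)
    rcases Nat.lt_or_ge m.val k'.val with hlt | hge
    · exact h.labelling.notMem_earlier hT hwf' hwd' (j := m.castSucc)
        (Fin.le_def.mpr (by simp; omega)) h2.1
    · exact later _ (Fin.le_def.mpr (by simp; omega)) h1.2
  rw [oddSum, h.pathSum_odd_poly, Finset.sum_eq_single w', if_pos, Finset.sum_eq_zero, add_zero,
    Finset.sum_eq_single k.succ, if_pos]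
  · congr 2
    rw [← h.pathSum_face_eq, hkv]
    rfl
  · exact ⟨hwf, hc ▸ hcw.symm⟩
  · intro i _ hi
    rw [ite_eq_right_iff]
    rintro ⟨hi1, -⟩
    rcases lt_or_gt_of_ne hi with hi | hi
    · rw [h.pathSum_face_eq_zero (hk ▸ hi), mul_zero]
    · refine absurd hi1 (later i (Fin.le_def.mpr ?_))
      have : k.succ.val < i.val := hi
      simp at this ⊢
      omega
  · simp
  · intro m _
    refine Finset.sum_eq_zero fun v' _ => if_neg ?_
    rintro ⟨h1, h2⟩
    have h3 := mem_face_of_mem_diag (L := L) (k := m) (v := w) (by rw [h2]; simp)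
    exact later _ (Fin.le_def.mpr (by simp; omega)) h3.2
  · exact ⟨h.labelling.adj hwf hwf' hww, nd⟩
  -- A neighbour with nonzero sum lies in triangles on both sides of the diagonal `k'`, hence is one
  -- of its ends. The end `c` is ruled out, since `c w` is the diagonal `k`, which lies before the
  -- admitted positions.
  · intro v' _ hv'
    rw [ite_eq_right_iff]
    rintro ⟨h1, h2⟩
    by_contra hne
    have hE : L.evenSum D a b k' v' ≠ 0 := fun h0 => hne (by rw [evenSum] at h0; rw [h0, mul_zero])
    obtain ⟨M', hM, hvM⟩ := h.exists_face_of_evenSum_ne_zero hE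
    obtain ⟨j, hj1, hj2⟩ := h.labelling.exists_face hT h1
    have hjk : j ≤ k'.castSucc := by
      by_contra hj
      have hj' : k'.castSucc.val < j.val := not_le.mp hj
      exact later j (Fin.le_def.mpr (by simp at hj' ⊢; omega)) hj1
    have hkk : k'.castSucc ≤ k'.succ := Fin.le_def.mpr (by simp)
    have hv : v' ∈ L.diag k' := Finset.mem_inter.mpr
      ⟨h.labelling.mem_face_of_le_of_le hT hj2 hvM _ hjk (hkk.trans hM),
        h.labelling.mem_face_of_le_of_le hT hj2 hvM _ (hjk.trans hkk) hM⟩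
    rw [hd', Finset.mem_insert, Finset.mem_singleton] at hv
    rcases hv with rfl | rfl
    · exact h2 k (by rw [hd, Finset.pair_comm])
    · exact hv' rfl
  · simp

theorem IsSetup.notMem_diag_left (k : Fin n) : a ∉ L.diag k := by
  obtain ⟨n1, n2, -⟩ := h.chain.ne k
  rw [h.chain.diag_eq]; simp [n1, n2]

theorem IsSetup.notMem_diag_right (k : Fin n) : b ∉ L.diag k := by
  obtain ⟨-, -, n1, n2, -⟩ := h.chain.ne k
  rw [h.chain.diag_eq]; simp [n1, n2]

/-- No crossing is left, so the only possible end is the single step to `b`. -/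
theorem IsSetup.oddSum_last {k : Fin n} (hk : k.val + 1 = n) {v : Fin (n + 3)}
    (hv : v ∈ L.diag k) : L.oddSum D a b n v = D.lam {v, b} := by
  classical
  have hkl : k.succ = Fin.last n := Fin.ext hk
  have hvf := (mem_face_of_mem_diag hv).2
  have hbf := h.labelling.last_mem
  rw [← hkl] at hbf
  have hvb : v ≠ b := by rintro rfl; exact h.notMem_diag_right k hv
  rw [oddSum, h.pathSum_odd_poly, Finset.sum_eq_single b, if_pos, Finset.sum_eq_zero, add_zero,
    Finset.sum_eq_zero, add_zero]
  · have := h.evenSum_last b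
    rw [evenSum, if_pos rfl] at this
    rw [this, mul_one]
  · intro i _
    rw [h.pathSum_even_face]
    rw [ite_eq_right_iff]
    rintro -
    by_cases hi : 2 * n ≤ 2 * i.val
    · have hil : i = Fin.last n := Fin.ext (by have := i.2; simp; omega)
      have := faceSum_last (L := L) (D := D) (a := a) (b := b)
      rw [faceSum] at this
      rw [if_pos hi, hil, this, mul_zero]
    · rw [if_neg hi, mul_zero]
  · intro m _
    refine Finset.sum_eq_zero fun v' _ => if_neg ?_
    rintro ⟨h1, -⟩
    have := m.2
    omega
  · refine ⟨h.labelling.adj hvf hbf hvb, fun m hm => h.notMem_diag_right m (by rw [hm]; simp)⟩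
  · intro v' _ hv'
    rw [ite_eq_right_iff]
    rintro -
    have := h.evenSum_last v'
    rw [evenSum, if_neg hv'] at this
    rw [this, mul_zero]
  · simp

/-- The two sums differ by the τ-edge to the next triangle. From its internal vertex there is no
σ-edge to the center `c`, and `w` is a dead end, so only `w'` remains. -/
theorem IsSetup.faceSum_castSucc (k : Fin n) {c w w' : Fin (n + 3)} (hd : L.diag k = {c, w})
    (hf : L.face k.succ = {c, w, w'}) (hc : L.center k.succ = c) (hcw' : c ≠ w')
    (hww : w ≠ w') (hz : L.evenSum D a b (k + 1) w = 0) :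
    L.faceSum D a b k.castSucc = L.faceSum D a b k.succ +
      L.sigmaFactor D w' k.succ * D.mu (L.face k.succ) * L.evenSum D a b (k + 1) w' := by
  classical
  have hX : L.pathSum D a b ⟨2 * k.succ.val + 1, true, .face k.succ⟩ =
      L.sigmaFactor D w' k.succ * D.mu (L.face k.succ) * L.evenSum D a b (k + 1) w' := by
    rw [h.pathSum_odd_face, Finset.sum_eq_single w', if_pos, h.pathSum_even_poly_succ]
    · rfl
    · exact ⟨by rw [hf]; simp, hc ▸ hcw'.symm⟩
    · intro v _ hv
      rw [ite_eq_right_iff]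
      rintro ⟨h1, h2⟩
      rw [hf] at h1
      simp only [Finset.mem_insert, Finset.mem_singleton] at h1
      rcases h1 with rfl | rfl | rfl
      · exact absurd hc.symm h2
      · rw [h.pathSum_even_poly_succ, Fin.val_succ, hz, mul_zero]
      · exact absurd rfl hv
    · simp
  rw [faceSum, faceSum, ← Finset.add_sum_erase _ _ (Finset.mem_univ k.succ),
    ← Finset.add_sum_erase (a := k.succ) _ (fun j => ite (k.succ < j) _ _) (Finset.mem_univ _),
    if_pos (Fin.lt_def.mpr (by simp)), if_neg (lt_irrefl _), zero_add, hX, add_comm]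
  congr 1
  refine Finset.sum_congr rfl fun j hj => ?_
  have hj' : j.val ≠ k.val + 1 := fun h => (Finset.mem_erase.mp hj).1 (Fin.ext h)
  have : k.castSucc < j ↔ k.succ < j := by
    simp only [Fin.lt_def, Fin.val_castSucc, Fin.val_succ]; omega
  simp only [this]

/-- Only the first triangle contains `a`, so the first step follows one of its sides or its σ-edge
at `a`. -/
theorem IsSetup.oddSum_start {k : Fin n} (hk : k.val = 0) {c w : Fin (n + 3)}
    (hd : L.diag k = {c, w}) (hc : L.center k.castSucc = c) (hcw : c ≠ w) :
    L.oddSum D a b 0 a = D.lam {a, c} * L.evenSum D a b k c + D.lam {a, w} * L.evenSum D a b k w +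
      L.sigmaFactor D a k.castSucc * (((L.faceUnit D.dir k.castSucc : ℤ) : ExteriorAlgebra ℝ M) *
        D.mu (L.face k.castSucc)) * L.faceSum D a b k.castSucc := by
  classical
  have hT := h.valid.triangulation
  have had := h.notMem_diag_left k
  have hk0 : k.castSucc = 0 := Fin.ext hk
  have haf : a ∈ L.face k.castSucc := hk0 ▸ h.labelling.first_mem
  have hac : a ≠ c := by rintro rfl; exact had (by rw [hd]; simp)
  have haw : a ≠ w := by rintro rfl; exact had (by rw [hd]; simp)
  have later : ∀ j, a ∈ L.face j → j = k.castSucc := by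
    intro j hj
    by_contra hne
    refine h.labelling.notMem_later hT haf had (j := j) (Fin.le_def.mpr ?_) hj
    have : j.val ≠ k.val := fun h' => hne (Fin.ext h')
    simp; omega
  have hcf : c ∈ L.face k.castSucc := (mem_face_of_mem_diag (by rw [hd]; simp)).1
  have hwf : w ∈ L.face k.castSucc := (mem_face_of_mem_diag (by rw [hd]; simp)).1
  have nd : ∀ v m, L.diag m ≠ {a, v} := fun v m hm => h.notMem_diag_left m (by rw [hm]; simp)
  have hf : L.face k.castSucc = {c, w, a} := by
    symm
    apply Finset.eq_of_subset_of_card_le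
    · intro x hx
      simp only [Finset.mem_insert, Finset.mem_singleton] at hx
      rcases hx with rfl | rfl | rfl <;> assumption
    · rw [h.labelling.card_face, Finset.card_eq_three.mpr ⟨c, w, a, hcw, hac.symm, haw.symm, rfl⟩]
  rw [oddSum, h.pathSum_odd_poly, ← Finset.sum_subset (Finset.subset_univ {c, w}),
    Finset.sum_pair hcw, if_pos, if_pos, Finset.sum_eq_zero, add_zero,
    Finset.sum_eq_single k.castSucc, if_pos]
  · have := h.pathSum_face_eq k.castSucc
    rw [Fin.val_castSucc, hk] at this
    rw [this, evenSum, evenSum, hk]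
  · exact ⟨haf, hc ▸ hac⟩
  · exact fun i _ hi => if_neg fun h' => hi (later i h'.1)
  · simp
  · exact fun m _ => Finset.sum_eq_zero fun v' _ => if_neg fun h' => nd _ _ h'.2
  · exact ⟨h.labelling.adj haf hwf haw, nd _⟩
  · exact ⟨h.labelling.adj haf hcf hac, nd _⟩
  · intro v _ hv
    refine if_neg fun h' => ?_
    obtain ⟨j, hj1, hj2⟩ := h.labelling.exists_face hT h'.1
    rw [later j hj1, hf] at hj2
    simp only [Finset.mem_insert, Finset.mem_singleton] at hj2 hv
    have := h'.1.ne
    tauto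

end Labelling

end SuperTeich

end

/-! ### Solution of the recursion in terms of vectors. -/

noncomputable section

namespace SuperTeich

namespace Labelling

variable {M : Type*} [AddCommGroup M] [Module ℝ M] {n : ℕ} {L : Labelling n}
  {D : DecoratedTriangulation (n + 3) M} {a b : Fin (n + 3)} {r l q : Fin n → Fin (n + 3)}

theorem Pos.mul_left_cancel {x y z : Ev M} (hx : Pos x) (h : x * y = x * z) : y = z :=
  hx.isUnit.mul_left_cancel h

theorem Pos.smul_left_cancel {x : Ev M} {y z : Od M} (hx : Pos x) (h : x • y = x • z) : y = z := by
  have := congrArg (Ring.inverse x • ·) h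
  simpa only [smul_smul, Ring.inverse_mul_cancel _ hx.isUnit, one_smul] using this

theorem lam_perm {e : Fin (n + 3) → Fin (n + 3) → ℤˣ} (he : IsCut e) (u : Fin (n + 3) → SVec M)
    {x y z c w w' : Fin (n + 3)} (hxy : x ≠ y) (hyz : y ≠ z) (hxz : x ≠ z)
    (hf : ({c, w, w'} : Finset (Fin (n + 3))) = {x, y, z}) (hcw : c ≠ w) (hww : w ≠ w')
    (hcw' : c ≠ w') :
    Lam e u w c * Lam e u w w' * Lam e u c w' = Lam e u x y * Lam e u y z * Lam e u x z := by
  have h1 : c ∈ ({x, y, z} : Finset (Fin (n + 3))) := hf ▸ by simp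
  have h2 : w ∈ ({x, y, z} : Finset (Fin (n + 3))) := hf ▸ by simp
  have h3 : w' ∈ ({x, y, z} : Finset (Fin (n + 3))) := hf ▸ by simp
  simp only [Finset.mem_insert, Finset.mem_singleton] at h1 h2 h3
  have s1 := Lam_symm he u hxy
  have s2 := Lam_symm he u hyz
  have s3 := Lam_symm he u hxz
  clear hf
  rcases h1 with rfl | rfl | rfl <;> rcases h2 with rfl | rfl | rfl <;>
    rcases h3 with rfl | rfl | rfl <;>
    first
    | exact absurd rfl hcw
    | exact absurd rfl hww
    | exact absurd rfl hcw'
    | ((try simp only [s1, s2, s3]) <;> ring)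

/-- The square root of the product of all three λ-lengths, divided by the λ-length opposite to `w`,
is exactly the even factor of the σ-edge at `w`. So the weight of a σ-edge is a bracket divided by
the λ-length of the opposite side, up to sign. -/
theorem IsSetup.sigma_mul_mu (h : IsSetup L D a b r l q) {u : Fin (n + 3) → SVec M}
    {ε : Finset (Fin (n + 3)) → ℤˣ}
    (hR : Realizes (cutSign a) u ε D) {j : Fin (n + 1)} {c w w' x y z : Fin (n + 3)}
    (hf : L.face j = {c, w, w'}) (hf' : L.face j = {x, y, z}) (hs : sbtw x y z)
    (hc : L.center j = c) (hcw : c ≠ w) (hww : w ≠ w') (hcw' : c ≠ w') :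
    ∃ ψ θ : Od M, D.mu (L.face j) = θ ∧ (∃ s : Ev M, L.sigmaFactor D w j = s ∧ s • θ = ψ) ∧
      Lam (cutSign a) u c w' • ψ = sg M (ε (L.face j)) • bracket (u x) (u y) (u z) := by
  have he := isCut_cutSign a
  have hne : x ≠ y ∧ y ≠ z ∧ x ≠ z := by
    clear * - hs
    simp only [Fin.ext_iff, ne_eq, sbtw_iff] at *
    omega
  have adj := fun {i i'} => h.labelling.adj (k := j) (i := i) (j := i')
  have aw : D.T.Adj w c := adj (by simp [hf]) (by simp [hf]) hcw.symm
  have aw' : D.T.Adj w w' := adj (by simp [hf]) (by simp [hf]) hww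
  have ac : D.T.Adj c w' := adj (by simp [hf]) (by simp [hf]) hcw'
  obtain ⟨θ, h1, h2⟩ := hR.mu_eq x y z hs (adj (by simp [hf']) (by simp [hf']) hne.1)
    (adj (by simp [hf']) (by simp [hf']) hne.2.1) (adj (by simp [hf']) (by simp [hf']) hne.2.2)
  rw [← hf'] at h1 h2
  have p1 := hR.lam_pos _ _ aw
  have p2 := hR.lam_pos _ _ aw'
  have p3 := hR.lam_pos _ _ ac
  have e1 : (L.face j).erase (L.center j) = {w, w'} := by
    rw [hf, hc, Finset.erase_insert (by simp [hcw, hcw'])]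
  have e2 : (L.face j).erase w = {c, w'} := by
    rw [hf, Finset.insert_comm, Finset.erase_insert (by simp [hcw.symm, hww])]
  have hpos := (p1.mul p2).mul p3.inverse
  refine ⟨_, θ, h1, ⟨esqrt (Lam (cutSign a) u w c * Lam (cutSign a) u w w' *
    Ring.inverse (Lam (cutSign a) u c w')), ?_, rfl⟩, ?_⟩
  · rw [sigmaFactor, e1, e2, hc, hR.lam_eq _ _ aw, hR.lam_eq _ _ aw', hR.lam_eq _ _ ac,
      inverse_coe p3, ← gsqrt_coe hpos]
    rfl
  · rw [← h2, ← lam_perm he u hne.1 hne.2.1 hne.2.2 (hf.symm.trans hf') hcw hww hcw', smul_smul]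
    congr 1
    symm
    refine esqrt_eq (p3.mul (esqrt_pos hpos)) ?_
    have h3 := esqrt_mul_self hpos
    have h4 := Ring.mul_inverse_cancel _ p3.isUnit
    linear_combination (Lam (cutSign a) u c w' * Lam (cutSign a) u c w') * h3 +
      Lam (cutSign a) u w c * Lam (cutSign a) u w w' * Lam (cutSign a) u c w' * h4

/-- The earlier triangle lies to the right of the diagonal precisely when this is oriented from its
left to its right end, and the default orientation starts at the fan center. -/
theorem IsSetup.onRight_iff (h : IsSetup L D a b r l q) (k : Fin n) :
    L.OnRight D.dir k ↔ L.center k.castSucc = l k := by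
  obtain ⟨p, hp, hs, -⟩ := h.chain.exists_back k
  obtain ⟨-, -, -, -, hne, -⟩ := h.chain.ne k
  have hd := h.chain.diag_eq k
  constructor
  · rintro ⟨i, hi, j, hj, p', hp', hdir, hs'⟩
    rw [hd] at hi hj
    rw [hp] at hp'
    simp only [Finset.mem_insert, Finset.mem_singleton] at hi hj hp'
    have : i = l k ∧ j = r k := by
      clear * - hi hj hp' hs hs' hne
      rcases hi with rfl | rfl <;> rcases hj with rfl | rfl <;> rcases hp' with rfl | rfl | rfl <;>
        first
        | exact ⟨rfl, rfl⟩
        | (exfalso; simp only [sbtw_iff] at *; omega)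
    rw [this.1, this.2] at hdir
    have hc := h.labelling.center_mem_left k
    rw [hd] at hc
    simp only [Finset.mem_insert, Finset.mem_singleton] at hc
    refine hc.resolve_left fun hc => ?_
    have h1 := h.default k (l k) (by simp [hd]) (by rw [hc]; exact hne.symm)
    rw [hc] at h1
    exact (h.valid.dir_iff _ _ (h.labelling.adj_of_diag hd)).mp h1 hdir
  · intro hc
    refine ⟨l k, by simp [hd], r k, by simp [hd], p, by simp [hp], ?_, hs⟩
    have h1 := h.default k (r k) (by simp [hd]) (by rw [hc]; exact hne)
    rwa [hc] at h1

theorem IsSetup.faceUnit_castSucc (h : IsSetup L D a b r l q) (k : Fin n)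
    [Decidable (L.center k.castSucc = l k)] :
    L.faceUnit D.dir k.castSucc = if L.center k.castSucc = l k then 1 else -1 := by
  have hk : (∃ k' : Fin n, k'.castSucc = k.castSucc ∧ L.OnRight D.dir k') ↔
      L.center k.castSucc = l k := by
    rw [← h.onRight_iff]
    constructor
    · rintro ⟨k', hk', h'⟩
      rwa [← Fin.castSucc_injective _ hk']
    · exact fun h' => ⟨k, rfl, h'⟩
  rw [faceUnit]
  by_cases hc : L.center k.castSucc = l k
  · rw [if_pos hc, if_pos (hk.mpr hc)]
  · rw [if_neg hc, if_neg fun h' => hc (hk.mp h')]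

/-- Comparison of the recursions at the two ends of the diagonal: an odd step along it, or none,
from the center matches none, or an even step along it, from `w`, up to the factor λ of the
diagonal. -/
theorem IsSetup.oddSum_center (h : IsSetup L D a b r l q) {k : Fin n} {w : Fin (n + 3)}
    (hd : L.diag k = {L.center k.castSucc, w}) :
    L.oddSum D a b k (L.center k.castSucc) =
      D.lam {L.center k.castSucc, w} * L.evenSum D a b k w := by
  obtain ⟨c, hc, hp⟩ := exists_coe_of_isPositive
    (h.valid.lam_pos _ _ (h.labelling.adj_of_diag hd))
  rw [h.oddSum_center_add hd, h.evenSum_of_mem (hd.trans (Finset.pair_comm _ _)),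
    Finset.pair_comm w, hc, mul_add, ← mul_assoc, inverse_coe hp,
    show (c : ExteriorAlgebra ℝ M) * (Ring.inverse c : Ev M) = ((c * Ring.inverse c : Ev M) :
      ExteriorAlgebra ℝ M) from rfl, Ring.mul_inverse_cancel _ hp.isUnit,
    show ((1 : Ev M) : ExteriorAlgebra ℝ M) = 1 from rfl, one_mul, add_comm]

/-- The closed forms of the path sums behind a diagonal. -/
structure ClosedForm (L : Labelling n) (D : DecoratedTriangulation (n + 3) M) (a b : Fin (n + 3))
    (r l : Fin n → Fin (n + 3)) (u : Fin (n + 3) → SVec M) (k : Fin n) : Prop where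
  even : ∀ v w, L.diag k = {v, w} → ∃ E : Ev M, L.evenSum D a b k v = E ∧
    Lam (cutSign a) u v w * E = Lam (cutSign a) u w b
  face : ∃ ψ : Od M, L.faceSum D a b k.castSucc = ψ ∧
    Lam (cutSign a) u (r k) (l k) • ψ = bracket (u (r k)) (u b) (u (l k))

theorem faceSign_succ (h : IsSetup L D a b r l q) (k : Fin n) :
    L.faceSign r (L.face k.succ) = 1 := by
  rw [Labelling.faceSign, if_neg]
  rintro ⟨k', hk1, hk2, -⟩
  have := congrArg Fin.val (h.labelling.injective hk2)
  simp [hk1] at this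

/-- The last triangle contains `b`: its side to `b` gives the even sums and its σ-edge at `b` the
odd one. -/
theorem IsSetup.closedForm_last (h : IsSetup L D a b r l q) {u : Fin (n + 3) → SVec M}
    (hR : Realizes (cutSign a) u (L.faceSign r) D) {k : Fin n} (hk : k.val + 1 = n) :
    ClosedForm L D a b r l u k := by
  classical
  have he := isCut_cutSign a
  have hkl : k.succ = Fin.last n := Fin.ext hk
  have hlast := fun v => h.evenSum_last v
  obtain ⟨n1, n2, n3, n4, n5, n6, n7⟩ := h.chain.ne k
  have hqb := h.chain.q_last k hk
  have hf := h.chain.face_succ k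
  rw [hqb] at hf
  have hbd := h.notMem_diag_right k
  constructor
  · intro v w hd
    have hv : v ∈ L.diag k := by simp [hd]
    have hw : w ∈ L.diag k := by simp [hd]
    have hvb : v ≠ b := fun hh => hbd (hh ▸ hv)
    have hwb : w ≠ b := fun hh => hbd (hh ▸ hw)
    have avw := h.labelling.adj_of_diag hd
    have hbf : b ∈ L.face k.succ := hkl ▸ h.labelling.last_mem
    have awb := h.labelling.adj (mem_face_of_mem_diag hw).2 hbf hwb
    have hp := hR.lam_pos _ _ avw
    refine ⟨Ring.inverse (Lam (cutSign a) u v w) * Lam (cutSign a) u w b, ?_, ?_⟩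
    · rw [h.evenSum_of_mem hd, hk, h.oddSum_last hk hw, h.evenSum_last, if_neg hvb, zero_add,
        hR.lam_eq _ _ avw, hR.lam_eq _ _ awb, inverse_coe hp]
      rfl
    · rw [← mul_assoc, Ring.mul_inverse_cancel _ hp.isUnit, one_mul]
  · have hcm := h.labelling.center_mem_right k
    rw [h.chain.diag_eq] at hcm
    simp only [Finset.mem_insert, Finset.mem_singleton] at hcm
    have hsb := h.chain.between k
    rw [hqb] at hsb
    have hf' : L.face k.succ = {r k, b, l k} := by rw [hf, Finset.pair_comm]
    have key : ∀ c w, L.center k.succ = c → L.diag k = {c, w} → c ≠ w → c ≠ b → w ≠ b →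
        L.face k.succ = {c, w, b} → Lam (cutSign a) u c w = Lam (cutSign a) u (r k) (l k) →
        ∃ ψ : Od M, L.faceSum D a b k.castSucc = ψ ∧
          Lam (cutSign a) u (r k) (l k) • ψ = bracket (u (r k)) (u b) (u (l k)) := by
      intro c w hc hd hcw hcb hwb hcwf hL
      obtain ⟨ψ, θ, hθ, ⟨s, hs, hψ⟩, hLψ⟩ := h.sigma_mul_mu hR (j := k.succ) (c := c) (w := b)
        (w' := w) (by rw [hcwf, Finset.pair_comm]) hf' hsb hc hcb hwb.symm hcw
      refine ⟨ψ, ?_, ?_⟩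
      · rw [h.faceSum_castSucc k hd hcwf hc hcb hwb, hkl, faceSum_last, zero_add, hk,
          h.evenSum_last, if_pos rfl, mul_one, ← hkl, hs, hθ, ← hψ, coe_smul_Od]
        rw [hk, h.evenSum_last, if_neg hwb]
      · rw [← hL, hLψ, faceSign_succ h, sg_one, one_smul]
    rcases hcm with hc | hc
    · exact key (r k) (l k) hc (h.chain.diag_eq k) n5 n3.symm n4.symm hf rfl
    · exact key (l k) (r k) hc (by rw [h.chain.diag_eq, Finset.pair_comm]) n5.symm n4.symm n3.symm
        (by rw [hf, Finset.insert_comm]) (Lam_symm he u n5)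

/-- This and the next two are instances of `pair_mul_ptolemy`, with signs arranged as the recursion
needs them for a fan center on the left, a fan center on the right, and the first triangle. -/
theorem ptolemy_left (r q b l : SVec M) :
    pair q l * (pair r l * pair q b + pair r q * pair b l) +
      oddMul M (bracket r q l) (bracket q b l) = pair q l * (pair q l * pair r b) := by
  have h := pair_mul_ptolemy l r q b
  rw [← bracket_cyclic l r q, ← bracket_cyclic l q b, pair_swap q l, pair_swap r l,
    pair_swap b l] at h
  linear_combination -h

theorem ptolemy_right (r b q l : SVec M) :
    pair r q * (pair r l * pair b q + pair q l * pair r b) -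
      oddMul M (bracket r q l) (bracket r b q) = pair r q * (pair r q * pair b l) := by
  have h := pair_mul_ptolemy r b q l
  rw [oddMul_swap] at h
  linear_combination -h

theorem ptolemy_start (a r b l : SVec M) :
    pair r l * (pair a r * pair b l + pair a l * pair r b) +
      oddMul M (bracket a r l) (bracket r b l) = pair r l * (pair r l * pair a b) := by
  have h := pair_mul_ptolemy r a l b
  rw [bracket_swap a r l, bracket_cyclic b r l, bracket_swap r b l, map_neg, map_neg,
    LinearMap.neg_apply, neg_neg, pair_swap a r, pair_swap b l] at h
  linear_combination -h

theorem pair_smul_bracket_left (r q b l : SVec M) :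
    pair r l • bracket q b l + pair b l • bracket r q l = pair q l • bracket r b l := by
  have h := pair_mul_bracket l r q b
  rw [← bracket_cyclic l r q, ← bracket_cyclic l q b, ← bracket_cyclic l r b, pair_swap q l,
    pair_swap r l, pair_swap b l] at h
  linear_combination (norm := module) h

/-- Inserting the closed forms behind the next diagonal into the recursion leaves one even identity,
a super Ptolemy relation, and one odd identity, a three-term relation for brackets; the sum at the
vertex `w` left behind needs neither. -/
theorem IsSetup.closedForm_step (h : IsSetup L D a b r l q) {u : Fin (n + 3) → SVec M}
    (hR : Realizes (cutSign a) u (L.faceSign r) D) {k k' : Fin n} (hk : k.succ = k'.castSucc)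
    (hk' : ClosedForm L D a b r l u k') : ClosedForm L D a b r l u k := by
  classical
  have he := isCut_cutSign a
  have hkv : k.val + 1 = k'.val := by simpa using (congrArg Fin.val hk)
  have hT := h.valid.triangulation
  obtain ⟨n1, n2, n3, n4, n5, n6, n7⟩ := h.chain.ne k
  have hf := h.chain.face_succ k
  have hf' : L.face k.succ = {r k, q k, l k} := by rw [hf, Finset.pair_comm]
  have hdk := h.chain.diag_eq k
  have hdk' := h.chain.diag_eq k'
  have hfu := h.faceUnit_castSucc k'
  obtain ⟨ψ', hψ', hLψ'⟩ := hk'.face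
  have s1 := h.chain.sbtw_first k
  obtain ⟨s2, s3⟩ := h.chain.sbtw_new k
  have s4 : sbtw a (r k) b := h.chain.right k
  have s5 : sbtw a b (l k) := sbtw_cyclic_right (h.chain.left k)
  have s6 : sbtw a (r k') b := h.chain.right k'
  have s7 : sbtw a b (l k') := sbtw_cyclic_right (h.chain.left k')
  have plain : ∀ x y, sbtw a x y → Lam (cutSign a) u x y = pair (u x) (u y) := by
    intro x y hxy
    rw [Lam, cutSign_of_sbtw hxy, sg_one, one_mul]
  -- Both kinds of fans at once: `c` is the fan center, `w` the vertex left behind and `w'` the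
  -- fresh one. The two geometric relations are hypotheses here and are supplied separately for a
  -- center on the left and on the right.
  have main : ∀ c w w', L.diag k = {c, w} → L.diag k' = {c, w'} → L.face k.succ = {c, w, w'} →
      L.center k.succ = c → c ≠ w → w ≠ w' → c ≠ w' →
      (∀ ψ : Od M, Lam (cutSign a) u c w' • ψ = bracket (u (r k)) (u (q k)) (u (l k)) →
        Lam (cutSign a) u c w * Lam (cutSign a) u w' b +
          Lam (cutSign a) u w w' * Lam (cutSign a) u c b +
          sg M (L.faceUnit D.dir k.succ) * oddMul M ψ
            (bracket (u (r k')) (u b) (u (l k'))) =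
        Lam (cutSign a) u c w' * Lam (cutSign a) u w b) →
      (Lam (cutSign a) u c w = Lam (cutSign a) u (r k) (l k)) →
      (Lam (cutSign a) u c w' = Lam (cutSign a) u (r k') (l k')) →
      (Lam (cutSign a) u c w • bracket (u (r k')) (u b) (u (l k')) +
        Lam (cutSign a) u c b • bracket (u (r k)) (u (q k)) (u (l k)) =
          Lam (cutSign a) u c w' • bracket (u (r k)) (u b) (u (l k))) →
      ClosedForm L D a b r l u k := by
    intro c w w' hd hd' hfc hc hcw hww hcw' hpt hL1 hL2 hbr
    obtain ⟨Ec, hEc, hEc'⟩ := hk'.even _ _ hd'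
    obtain ⟨E, hE, hE'⟩ := hk'.even w' c (by rw [hd', Finset.pair_comm])
    rw [Lam_symm he u hcw'] at hE'
    have acw := h.labelling.adj_of_diag hd
    have acw' := h.labelling.adj_of_diag hd'
    have aww' : D.T.Adj w w' := h.labelling.adj (k := k.succ) (by simp [hfc]) (by simp [hfc]) hww
    have pcw := hR.lam_pos _ _ acw
    have pcw' := hR.lam_pos _ _ acw'
    have hw0 : L.evenSum D a b (k.val + 1) w = 0 := by
      rw [hkv]
      exact h.evenSum_succ_eq_zero (by rw [← hk, hfc]; simp) (by rw [hd']; simp [hcw.symm, hww])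
    have hc' : L.center k'.castSucc = c := hk ▸ hc
    have hSc := h.oddSum_center (k := k') (w := w') (by rw [hc', hd'])
    rw [hc', hE, hR.lam_eq _ _ acw'] at hSc
    obtain ⟨ψ₁, θ, hθ, ⟨t₁, ht₁, htψ₁⟩, hLψ₁⟩ := h.sigma_mul_mu hR hfc hf' (h.chain.between k) hc
      hcw hww hcw'
    obtain ⟨ψ₂, θ₂, hθ₂, ⟨t₂, ht₂, htψ₂⟩, hLψ₂⟩ := h.sigma_mul_mu hR (w := w') (w' := w)
      (hfc.trans (by rw [Finset.pair_comm w w'])) hf' (h.chain.between k) hc hcw' hww.symm hcw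
    rw [faceSign_succ h, sg_one, one_smul] at hLψ₁ hLψ₂
    have hSw := h.oddSum_noncenter hk hd hd' hfc hc hcw hww hcw'
    rw [hE, hR.lam_eq _ _ aww', ht₁, hθ, hk, hψ', ← hk] at hSw
    have hSw' : L.oddSum D a b k' w = (Lam (cutSign a) u w w' * E +
        sg M (L.faceUnit D.dir k.succ) * oddMul M ψ₁ ψ' : Ev M) := by
      rw [hSw, ← htψ₁, map_smul, LinearMap.smul_apply, smul_eq_mul]
      have hcm : (t₁ : ExteriorAlgebra ℝ M) * (((L.faceUnit D.dir k.succ : ℤ) : ExteriorAlgebra ℝ M)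
          * θ) = ((L.faceUnit D.dir k.succ : ℤ) : ExteriorAlgebra ℝ M) * (t₁ * θ) := by
        rw [← mul_assoc, ← mul_assoc, Int.cast_comm]
      rw [hcm, mul_assoc, mul_assoc, ← coe_oddMul]
      rfl
    have h1 := hpt ψ₁ hLψ₁
    constructor
    · intro v v' hvv
      have hcase : (v = c ∧ v' = w) ∨ (v = w ∧ v' = c) :=
        Sym2.eq_iff.mp (finset_pair_eq_iff.mp (hvv.symm.trans hd))
      rcases hcase with ⟨rfl, rfl⟩ | ⟨rfl, rfl⟩
      · refine ⟨Ec + Ring.inverse (Lam (cutSign a) u v v') * (Lam (cutSign a) u v' w' * E +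
          sg M (L.faceUnit D.dir k.succ) * oddMul M ψ₁ ψ'), ?_, ?_⟩
        · rw [h.evenSum_of_mem hd, hkv, hEc, hSw', hR.lam_eq _ _ acw, inverse_coe pcw]
          rfl
        -- Once the denominator λ(c,w') is cleared, the claim is the Ptolemy hypothesis combined
        -- with the closed forms at the next diagonal.
        · refine Pos.mul_left_cancel pcw' ?_
          have h2 := Ring.mul_inverse_cancel _ pcw.isUnit
          have h3 := congrArg (oddMul M ψ₁) hLψ'
          rw [map_smul, smul_eq_mul, ← hL2] at h3
          rw [← h3] at h1
          linear_combination h1 + Lam (cutSign a) u v v' * hEc' + Lam (cutSign a) u v' w' * hE' +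
            Lam (cutSign a) u v w' * (Lam (cutSign a) u v' w' * E +
              sg M (L.faceUnit D.dir k.succ) * oddMul M ψ₁ ψ') * h2
      · refine ⟨Ring.inverse (Lam (cutSign a) u v' v) * (Lam (cutSign a) u v' w' * E), ?_, ?_⟩
        · rw [h.evenSum_of_mem hvv, hw0, zero_add, hkv, hSc, Finset.pair_comm, hR.lam_eq _ _ acw,
            inverse_coe pcw]
          rfl
        · rw [Lam_symm he u hcw, ← mul_assoc, Ring.mul_inverse_cancel _ pcw.isUnit, one_mul, hE']
    · refine ⟨ψ' + E • ψ₂, ?_, ?_⟩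
      · rw [h.faceSum_castSucc k hd hfc hc hcw' hww hw0, hk, hψ', ← hk, ht₂, hθ₂, hkv, hE, ← htψ₂]
        have := (IsEven.commute E.2 ((t₂ : ExteriorAlgebra ℝ M) * θ₂)).eq
        rw [← this]
        rfl
      · refine Pos.smul_left_cancel pcw' ?_
        rw [← hL1, ← hbr, ← hLψ', ← hLψ₂, ← hE', ← hL2]
        module
  rw [hk] at main
  rw [hfu] at main
  rcases h.chain.step k k' hk with ⟨e1, e2, e3⟩ | ⟨e1, e2, e3⟩
  · rw [e2] at s6
    have hc' : L.center k'.castSucc = l k' := by rw [← hk, e3, e1]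
    have b3 := plain _ _ s3
    refine main (l k) (r k) (q k) (by rw [hdk, Finset.pair_comm])
      (by rw [hdk', e1, e2, Finset.pair_comm]) (by rw [← hk, hf, Finset.insert_comm])
      (by rw [← hk, e3]) n5.symm n6.symm n7.symm ?_ (Lam_symm he u n5) ?_ ?_
    · intro ψ hψ
      have pq : Pos (Lam (cutSign a) u (q k) (l k)) := by
        have := hR.lam_pos _ _ (h.labelling.adj_of_diag hdk')
        rwa [e1, e2] at this
      refine Pos.mul_left_cancel pq ?_
      have h3 := congrArg (fun t => oddMul M t (bracket (u (r k')) (u b) (u (l k')))) hψ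
      simp only [map_smul, LinearMap.smul_apply, smul_eq_mul] at h3
      -- With the center on the left, the triangle is on the right of the next diagonal, so its
      -- μ-invariant is the greater one and no sign arises; in the other case the sign is -1.
      rw [if_pos hc', sg_one]
      rw [e1, e2, Lam_symm he u n7, plain _ _ s3] at h3
      rw [e1, e2, Lam_symm he u n5, Lam_symm he u n7, Lam_symm he u n4, plain _ _ s1, plain _ _ s2,
        plain _ _ s3, plain _ _ s4, plain _ _ s5, plain _ _ s6]
      linear_combination h3 + ptolemy_left (u (r k)) (u (q k)) (u b) (u (l k))
    · rw [e1, e2]; exact Lam_symm he u n7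
    · rw [e1, e2, Lam_symm he u n5, Lam_symm he u n7, Lam_symm he u n4, plain _ _ s1,
        plain _ _ s3, plain _ _ s5]
      exact pair_smul_bracket_left (u (r k)) (u (q k)) (u b) (u (l k))
  · rw [e2] at s7
    have hc' : L.center k'.castSucc ≠ l k' := by
      rw [← hk, e3, e2]; exact n6.symm
    have nqb : q k ≠ b := by
      rw [← e2]; exact (h.chain.ne k').2.2.2.1.symm
    refine main (r k) (l k) (q k) hdk (by rw [hdk', e1, e2]) (by rw [← hk, hf])
      (by rw [← hk, e3]) n5 n7.symm n6.symm ?_ rfl ?_ ?_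
    · intro ψ hψ
      have pq : Pos (Lam (cutSign a) u (r k) (q k)) := by
        have := hR.lam_pos _ _ (h.labelling.adj_of_diag hdk')
        rwa [e1, e2] at this
      refine Pos.mul_left_cancel pq ?_
      have h3 := congrArg (fun t => oddMul M t (bracket (u (r k')) (u b) (u (l k')))) hψ
      simp only [map_smul, LinearMap.smul_apply, smul_eq_mul] at h3
      rw [if_neg hc', sg_neg, sg_one]
      rw [e1, e2, plain _ _ s2] at h3
      rw [e1, e2, Lam_symm he u n7, Lam_symm he u nqb.symm, Lam_symm he u n4, plain _ _ s1,
        plain _ _ s2, plain _ _ s3, plain _ _ s4, plain _ _ s5, plain _ _ s7]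
      linear_combination -h3 + ptolemy_right (u (r k)) (u b) (u (q k)) (u (l k))
    · rw [e1, e2]
    · rw [e1, e2, plain _ _ s1, plain _ _ s2, plain _ _ s4]
      exact (pair_mul_bracket (u (r k)) (u b) (u (q k)) (u (l k))).symm

theorem IsSetup.closedForm (h : IsSetup L D a b r l q) {u : Fin (n + 3) → SVec M}
    (hR : Realizes (cutSign a) u (L.faceSign r) D) (k : Fin n) : ClosedForm L D a b r l u k := by
  obtain ⟨m, hm⟩ : ∃ m, k.val + m + 1 = n := ⟨n - 1 - k.val, by omega⟩
  induction m generalizing k with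
  | zero => exact h.closedForm_last hR hm
  | succ m ih =>
    exact h.closedForm_step hR (k' := ⟨k.val + 1, by omega⟩) rfl (ih _ (by simp only; omega))

/-- The sum of the weights of all twisted paths. -/
theorem IsSetup.pathSum_start (h : IsSetup L D a b r l q) {u : Fin (n + 3) → SVec M}
    (hR : Realizes (cutSign a) u (L.faceSign r) D) :
    L.pathSum D a b ⟨0, true, .poly a⟩ = (Lam (cutSign a) u a b : Ev M) := by
  classical
  have he := isCut_cutSign a
  obtain ⟨k, hk⟩ : ∃ k : Fin n, k.val = 0 := ⟨⟨0, h.pos⟩, rfl⟩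
  obtain ⟨n1, n2, n3, n4, n5, n6, n7⟩ := h.chain.ne k
  have hf := h.chain.face_zero k hk
  have hf' : L.face k.castSucc = {a, r k, l k} := by
    rw [hf, ← triple_rotate a]
  have hdk := h.chain.diag_eq k
  have s1 := h.chain.sbtw_first k
  have s4 : sbtw a (r k) b := h.chain.right k
  have s5 : sbtw a b (l k) := sbtw_cyclic_right (h.chain.left k)
  have plain : ∀ x y, sbtw a x y → Lam (cutSign a) u x y = pair (u x) (u y) := by
    intro x y hxy
    rw [Lam, cutSign_of_sbtw hxy, sg_one, one_mul]
  have plain_a : ∀ x, Lam (cutSign a) u a x = pair (u a) (u x) := by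
    intro x
    rw [Lam, cutSign_self_left, sg_one, one_mul]
  have hC := h.closedForm hR k
  obtain ⟨ψ, hψ, hLψ⟩ := hC.face
  have prl := hR.lam_pos _ _ (h.labelling.adj_of_diag hdk)
  have nab : a ≠ b := by
    rintro rfl
    clear * - s4
    simp only [sbtw_iff] at s4
    omega
  have haf : a ∈ L.face k.castSucc := by rw [hf]; simp
  have key : ∀ c w, L.diag k = {c, w} → L.center k.castSucc = c → c ≠ w → a ≠ c → a ≠ w →
      L.face k.castSucc = {c, a, w} →
      L.faceUnit D.dir k.castSucc * L.faceSign r (L.face k.castSucc) = 1 →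
      Lam (cutSign a) u c w = Lam (cutSign a) u (r k) (l k) →
      Lam (cutSign a) u a c * Lam (cutSign a) u w b + Lam (cutSign a) u a w * Lam (cutSign a) u c b =
        Lam (cutSign a) u a (r k) * Lam (cutSign a) u (l k) b +
          Lam (cutSign a) u a (l k) * Lam (cutSign a) u (r k) b →
      L.pathSum D a b ⟨0, true, .poly a⟩ = (Lam (cutSign a) u a b : Ev M) := by
    intro c w hd hc hcw hac haw hfc hsign hL hsum
    obtain ⟨Ec, hEc, hEc'⟩ := hC.even _ _ hd
    obtain ⟨E, hE, hE'⟩ := hC.even w c (by rw [hd, Finset.pair_comm])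
    rw [Lam_symm he u hcw] at hE'
    obtain ⟨ψ₁, θ, hθ, ⟨t₁, ht₁, htψ₁⟩, hLψ₁⟩ := h.sigma_mul_mu hR hfc hf' s1 hc hac.symm haw hcw
    have aac : D.T.Adj a c := h.labelling.adj haf (by rw [hfc]; simp) hac
    have aaw : D.T.Adj a w := h.labelling.adj haf (by rw [hfc]; simp) haw
    have hS := h.oddSum_start hk hd hc hcw
    have hcm : (t₁ : ExteriorAlgebra ℝ M) * (((L.faceUnit D.dir k.castSucc : ℤ) :
        ExteriorAlgebra ℝ M) * θ) =
          ((L.faceUnit D.dir k.castSucc : ℤ) : ExteriorAlgebra ℝ M) * (t₁ * θ) := by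
      rw [← mul_assoc, ← mul_assoc, Int.cast_comm]
    rw [hEc, hE, hψ, ht₁, hθ, hR.lam_eq _ _ aac, hR.lam_eq _ _ aaw, hcm, mul_assoc, mul_assoc] at hS
    have hS' : L.pathSum D a b ⟨0, true, .poly a⟩ = (Lam (cutSign a) u a c * Ec +
        Lam (cutSign a) u a w * E + sg M (L.faceUnit D.dir k.castSucc) * oddMul M (t₁ • θ) ψ :
          Ev M) := by
      refine hS.trans ?_
      rw [← mul_assoc (t₁ : ExteriorAlgebra ℝ M), ← coe_smul_Od, ← coe_oddMul]
      rfl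
    rw [hS', htψ₁]
    congr 1
    rw [← hL] at prl hLψ
    -- One factor λ of the first diagonal clears the denominator of the σ-weight, the other that of
    -- the sum over τ-edges.
    refine Pos.mul_left_cancel prl (Pos.mul_left_cancel prl ?_)
    have h1 := congrArg (fun t => oddMul M t (Lam (cutSign a) u c w • ψ)) hLψ₁
    simp only [map_smul, LinearMap.smul_apply, smul_eq_mul] at h1
    have h2 := congrArg (oddMul M (bracket (u a) (u (r k)) (u (l k)))) hLψ
    rw [map_smul, smul_eq_mul] at h2
    -- The sign of the positive order cancels the exceptional sign that the first triangle has in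
    -- the realization.
    have h3 : sg M (L.faceUnit D.dir k.castSucc) * sg M (L.faceSign r (L.face k.castSucc)) = 1 := by
      rw [← sg_mul, hsign, sg_one]
    have h4 := ptolemy_start (u a) (u (r k)) (u b) (u (l k))
    rw [← plain_a, ← plain_a, ← plain_a, ← plain _ _ s1, ← plain _ _ s5, ← plain _ _ s4,
      ← hL, Lam_symm he u n4.symm] at h4
    linear_combination h4 + Lam (cutSign a) u c w * hsum +
      Lam (cutSign a) u c w * Lam (cutSign a) u a c * hEc' +
      Lam (cutSign a) u c w * Lam (cutSign a) u a w * hE' +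
      sg M (L.faceUnit D.dir k.castSucc) * h1 + h2 +
      (oddMul M (bracket (u a) (u (r k)) (u (l k))) ψ) * Lam (cutSign a) u c w * h3
  have hcm := h.labelling.center_mem_left k
  rw [hdk] at hcm
  simp only [Finset.mem_insert, Finset.mem_singleton] at hcm
  rcases hcm with hc | hc
  · refine key (r k) (l k) hdk hc n5 n1 n2 (by rw [hf', Finset.insert_comm]) ?_ rfl rfl
    rw [h.faceUnit_castSucc, if_neg (by rw [hc]; exact n5), faceSign, if_pos ⟨k, hk, rfl, hc⟩]
    rfl
  · refine key (l k) (r k) (by rw [hdk, Finset.pair_comm]) hc n5.symm n2 n1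
      (by rw [hf', ← triple_rotate (l k) a (r k)]) ?_ (Lam_symm he u n5) (add_comm _ _)
    rw [h.faceUnit_castSucc, if_pos hc, faceSign, if_neg, mul_one]
    rintro ⟨k', hk1, -, hk2⟩
    have : k' = k := Fin.ext (hk1.trans hk.symm)
    subst this
    exact n5 (hk2.symm.trans hc)

end Labelling

end SuperTeich

end

/-! ### Correspondence between twisted paths and accepted words. -/

noncomputable section

namespace SuperTeich

theorem getElem_edges_eq_getVert {V : Type*} {G : SimpleGraph V} {u v : V} (w : G.Walk u v) (i : ℕ)
    (hi : i < w.edges.length) : w.edges[i] = s(w.getVert i, w.getVert (i + 1)) := by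
  induction w generalizing i with
  | nil => simp at hi
  | cons h p ih =>
    cases i with
    | zero => simp
    | succ i => simpa using ih i (by simpa using hi)

namespace Labelling

section Sorting

variable {M : Type*} [AddCommGroup M] [Module ℝ M] {α : Type*}

theorem orderedInsert_of_forall (R : α → α → Prop) [DecidableRel R] {x : α} {t : List α}
    (h : ∀ y ∈ t, R x y) : t.orderedInsert R x = x :: t := by
  cases t with
  | nil => rfl
  | cons y t => rw [List.orderedInsert_cons, if_pos (h y (by simp))]

theorem orderedInsert_of_forall_not (R : α → α → Prop) [DecidableRel R] {x : α} {t : List α}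
    (h : ∀ y ∈ t, ¬ R x y) : t.orderedInsert R x = t ++ [x] := by
  induction t with
  | nil => rfl
  | cons y t ih =>
    rw [List.orderedInsert_cons, if_neg (h y (by simp)), ih fun z hz => h z (by simp [hz]),
      List.cons_append]

theorem prod_mul_odd {x : ExteriorAlgebra ℝ M} (hx : IsOdd x) {t : List (ExteriorAlgebra ℝ M)}
    (h : ∀ y ∈ t, IsOdd y) : t.prod * x = (-1) ^ t.length * (x * t.prod) := by
  induction t with
  | nil => simp
  | cons y t ih =>
    rw [List.prod_cons, mul_assoc, ih fun z hz => h z (by simp [hz]), List.length_cons, pow_succ]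
    have h1 := IsOdd.anticomm hx (h y (by simp))
    have h2 : Commute y ((-1 : ExteriorAlgebra ℝ M) ^ t.length) :=
      ((Commute.one_right y).neg_right).pow_right _
    rw [← mul_assoc y, h2.eq, mul_assoc, ← mul_assoc y x, ← mul_assoc x y, h1]
    noncomm_ring

end Sorting

variable {M : Type*} [AddCommGroup M] [Module ℝ M] {n : ℕ} {L : Labelling n}
  {D : DecoratedTriangulation (n + 3) M} {a b : Fin (n + 3)} {r l q : Fin n → Fin (n + 3)}

/-- Characterizes `advance` as the least bound that is at least `p` and exceeds all positions at
which the step meets the arc. -/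
theorem IsSetup.le_advance_iff (h : IsSetup L D a b r l q) (p p' : ℕ) (x y : AuxVertex n) :
    L.advance p x y ≤ p' ↔ p ≤ p' ∧ ∀ q' ∈ L.arcPos x y, q' < p' := by
  cases x with
  | poly u =>
    cases y with
    | poly v =>
      by_cases hd : ∃ k, L.diag k = {u, v}
      · obtain ⟨k, hk⟩ := hd
        rw [h.chain.advance_of_diag hk]
        simp only [h.chain.mem_arcPos hk, forall_eq]
        omega
      · rw [advance_of_not_diag (fun k hk => hd ⟨k, hk⟩)]
        refine ⟨fun h => ⟨h, ?_⟩, fun h => h.1⟩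
        rintro q' ⟨k, hk, -⟩
        exact absurd ⟨k, hk⟩ hd
    | face j => simp [advance, arcPos]
  | face i =>
    cases y with
    | poly v => simp [advance, arcPos]
    | face j =>
      simp only [advance, arcPos, Set.uIcc, Set.mem_Icc]
      constructor
      · intro h
        exact ⟨by omega, fun q' hq => by omega⟩
      · rintro ⟨h1, h2⟩
        have := h2 (2 * max i.val j.val) (by omega)
        omega

/-- The conditions on twisted paths, except for that on repeated edges, for walks whose first
step has number `m`, if the crossings of the arc have to be at positions `≥ p`. -/
structure IsPathEnd (L : Labelling n) {T : SimpleGraph (Fin (n + 3))} (a : Fin (n + 3))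
    {b : Fin (n + 3)} (m p : ℕ) {x y : AuxVertex n} (w : (L.auxGraph T).Walk x y) : Prop where
  even_length : Even (m + w.length)
  crosses : ∀ i < w.length, Even (i + m) → CrossesArc a b (w.getVert i) (w.getVert (i + 1))
  forward : ∀ i < w.length, TauForward (w.getVert i) (w.getVert (i + 1))
  sigma : ∀ i < w.length, IsSigma (w.getVert i) (w.getVert (i + 1)) → Odd (i + m)
  tau : ∀ i < w.length, IsTau (w.getVert i) (w.getVert (i + 1)) → Even (i + m)
  pos_le : ∀ i < w.length, ∀ q ∈ L.arcPos (w.getVert i) (w.getVert (i + 1)), p ≤ q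
  ordered : ∀ i j, i < j → j < w.length →
    ∀ p ∈ L.arcPos (w.getVert i) (w.getVert (i + 1)),
    ∀ q ∈ L.arcPos (w.getVert j) (w.getVert (j + 1)), p < q

theorem forall_lt_succ_iff {N : ℕ} {P : ℕ → Prop} :
    (∀ i < N + 1, P i) ↔ P 0 ∧ ∀ i < N, P (i + 1) := by
  constructor
  · exact fun h => ⟨h 0 (by omega), fun i hi => h (i + 1) (by omega)⟩
  · rintro ⟨h0, h1⟩ (_ | i) hi
    · exact h0
    · exact h1 i (by omega)

/-- The order condition concerns all pairs of steps; since the state records a bound above all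
crossings so far, it can be checked one step at a time. -/
theorem IsSetup.isPathEnd_cons (h : IsSetup L D a b r l q) {m p : ℕ} {x z y : AuxVertex n}
    (hxz : (L.auxGraph D.T).Adj x z) (w : (L.auxGraph D.T).Walk z y) :
    L.IsPathEnd a (b := b) m p (.cons hxz w) ↔
      L.StepOK a b D.T ⟨p, decide (Odd m), x⟩ z ∧
        L.IsPathEnd a (b := b) (m + 1) (L.advance p x z) w := by
  have adv := fun p' => h.le_advance_iff p p' x z
  constructor
  · rintro ⟨h1, h2, h3, h4, h5, h6, h7⟩
    rw [SimpleGraph.Walk.length_cons] at h1 h2 h3 h4 h5 h6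
    rw [forall_lt_succ_iff] at h2 h3 h4 h5 h6
    simp only [SimpleGraph.Walk.getVert_cons_succ, SimpleGraph.Walk.getVert_zero, zero_add]
      at h2 h3 h4 h5 h6
    have sh : ∀ i, i + 1 + m = i + (m + 1) := fun i => by ring
    refine ⟨⟨hxz, ?_, h3.1, ?_, ?_, h6.1⟩, ?_, ?_, h3.2, ?_, ?_, ?_, ?_⟩
    · intro hm
      refine h2.1 ?_
      simpa using hm
    · intro hs
      simpa using h4.1 hs
    · intro hs
      simpa using h5.1 hs
    · rwa [add_assoc, add_comm 1]
    · intro i hi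
      rw [← sh]; exact h2.2 i hi
    · intro i hi
      rw [← sh]; exact h4.2 i hi
    · intro i hi
      rw [← sh]; exact h5.2 i hi
    · intro i hi q' hq'
      refine (adv q').mpr ⟨h6.2 i hi q' hq', fun q'' hq'' => ?_⟩
      exact h7 0 (i + 1) (by omega) (by simpa using hi) q'' (by simpa using hq'') q' hq'
    · intro i j hij hj
      exact h7 (i + 1) (j + 1) (by omega) (by simpa using hj)
  · rintro ⟨⟨s1, s2, s3, s4, s5, s6⟩, h1, h2, h3, h4, h5, h6, h7⟩
    have sh : ∀ i, i + 1 + m = i + (m + 1) := fun i => by ring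
    refine ⟨?_, ?_, ?_, ?_, ?_, ?_, ?_⟩ <;> rw [SimpleGraph.Walk.length_cons] <;>
      (try rw [forall_lt_succ_iff]) <;>
      (try simp only [SimpleGraph.Walk.getVert_cons_succ, SimpleGraph.Walk.getVert_zero, zero_add])
    · rwa [add_assoc, add_comm 1] at h1
    · refine ⟨fun hm => s2 (by simpa using hm), fun i hi => ?_⟩
      rw [sh]; exact h2 i hi
    · exact ⟨s3, h3⟩
    · refine ⟨fun hs => by simpa using s4 hs, fun i hi => ?_⟩
      rw [sh]; exact h4 i hi
    · refine ⟨fun hs => by simpa using s5 hs, fun i hi => ?_⟩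
      rw [sh]; exact h5 i hi
    · exact ⟨s6, fun i hi q' hq' => ((adv q').mp (h6 i hi q' hq')).1⟩
    · rintro (_ | i) (_ | j) hij hj
      · omega
      · intro p' hp' q' hq'
        exact ((adv q').mp (h6 j (by omega) q' hq')).2 p' (by simpa using hp')
      · omega
      · exact h7 i j (by omega) (by omega)

theorem IsSetup.accepts_iff (h : IsSetup L D a b r l q) {x y : AuxVertex n}
    (w : (L.auxGraph D.T).Walk x y) (hy : y = .poly b) (m p : ℕ) :
    Accepts (IsFinal b) (L.StepOK a b D.T) L.nextState w.support.tail ⟨p, decide (Odd m), x⟩ ↔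
      L.IsPathEnd a (b := b) m p w := by
  induction w generalizing m p with
  | nil =>
    constructor
    · rintro ⟨-, h2⟩
      refine ⟨by simpa using h2, ?_, ?_, ?_, ?_, ?_, ?_⟩ <;> simp
    · intro h'
      exact ⟨hy, by simpa using h'.even_length⟩
  | @cons x z y hxz w ih =>
    rw [h.isPathEnd_cons, ← ih hy, SimpleGraph.Walk.support_cons, List.tail_cons,
      ← SimpleGraph.Walk.cons_tail_support]
    refine and_congr Iff.rfl ?_
    rw [nextState]
    simp only [SimpleGraph.Walk.cons_tail_support, Nat.odd_add_one, decide_not]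

theorem exists_walk {t : List (AuxVertex n)} {s : PathState n}
    (ht : Accepts (IsFinal b) (L.StepOK a b D.T) L.nextState t s) :
    ∃ w : (L.auxGraph D.T).Walk s.vert (.poly b), w.support.tail = t := by
  induction t generalizing s with
  | nil =>
    obtain ⟨h1, -⟩ := ht
    rw [h1]
    exact ⟨.nil, rfl⟩
  | cons y t ih =>
    obtain ⟨h1, h2⟩ := ht
    obtain ⟨w, hw⟩ : ∃ w : (L.auxGraph D.T).Walk y (.poly b), w.support.tail = t := ih h2
    have hadj : (L.auxGraph D.T).Adj s.vert y := h1.adj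
    refine ⟨.cons hadj w, ?_⟩
    rw [SimpleGraph.Walk.support_cons, List.tail_cons, ← hw]
    exact (SimpleGraph.Walk.cons_tail_support w).symm

/-- No edge is used twice, since the crossings of the arc are in order. -/
theorem IsSetup.edges_nodup (h : IsSetup L D a b r l q)
    {w : (L.auxGraph D.T).Walk (.poly a) (.poly b)} (hw : L.IsPathEnd a (b := b) 1 0 w) :
    w.edges.Nodup := by
  have hT := h.valid.triangulation
  obtain ⟨h1, h2, h3, h4, h5, -, h7⟩ := hw
  obtain ⟨g, hg⟩ : ∃ g, g = w.getVert := ⟨_, rfl⟩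
  obtain ⟨N, hN⟩ : ∃ N, N = w.length := ⟨_, rfl⟩
  have hadj : ∀ i < N, L.AuxAdj D.T (g i) (g (i + 1)) := fun i hi => by
    rw [hg]; exact w.adj_getVert_succ (hN ▸ hi)
  have g0 : g 0 = .poly a := by rw [hg]; exact w.getVert_zero
  have gN : g N = .poly b := by rw [hg, hN]; exact w.getVert_length
  -- Indices start at 0 here, so an odd index belongs to an even step, that is, to one that crosses
  -- the arc.
  suffices hs : ∀ s t, s < t → t < N → s(g s, g (s + 1)) ≠ s(g t, g (t + 1)) by
    have hedge : ∀ (i : ℕ) (hi : i < w.edges.length), w.edges[i] = s(g i, g (i + 1)) := by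
      intro i hi
      rw [hg, getElem_edges_eq_getVert]
    rw [List.nodup_iff_injective_getElem]
    rintro ⟨i, hi⟩ ⟨j, hj⟩ hij
    simp only [hedge] at hij
    have hi' : i < N := by simpa [hN] using hi
    have hj' : j < N := by simpa [hN] using hj
    rcases lt_trichotomy i j with hlt | heq | hlt
    · exact absurd hij (hs i j hlt hj')
    · exact Fin.ext heq
    · exact absurd hij.symm (hs j i hlt hi')
  rw [← hg, ← hN] at h2 h3 h4 h5 h7
  rw [← hN] at h1
  have hNodd : Odd N := by
    rw [add_comm, Nat.even_add_one, Nat.not_even_iff_odd] at h1; exact h1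
  -- the shape of the steps
  have cross_poly : ∀ i < N, Odd i → ∀ v, g i = .poly v →
      ∃ v' k, g (i + 1) = .poly v' ∧ L.diag k = {v, v'} := by
    intro i hi hodd v hv
    have hc := h2 i hi hodd.add_one
    have ha := hadj i hi
    rw [hv] at hc ha
    cases hv' : g (i + 1) with
    | poly v' =>
      rw [hv'] at hc ha
      obtain ⟨k, hk⟩ := h.labelling.exists_diag_of_crosses hT ha hc
      exact ⟨v', k, rfl, hk⟩
    | face j => rw [hv'] at hc; exact absurd hc id
  have cross_poly' : ∀ i < N, Odd i → ∀ v, g (i + 1) = .poly v →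
      ∃ v' k, g i = .poly v' ∧ L.diag k = {v, v'} := by
    intro i hi hodd v hv
    have hc := h2 i hi hodd.add_one
    have ha := hadj i hi
    rw [hv] at hc ha
    cases hv' : g i with
    | poly v' =>
      rw [hv'] at hc ha
      obtain ⟨k, hk⟩ := h.labelling.exists_diag_of_crosses hT ha hc
      exact ⟨v', k, rfl, by rw [hk, Finset.pair_comm]⟩
    | face j => rw [hv'] at hc; exact absurd hc id
  have cross_face : ∀ i < N, Odd i → ∀ j, (g i = .face j ∨ g (i + 1) = .face j) →
      2 * j.val ∈ L.arcPos (g i) (g (i + 1)) := by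
    intro i hi hodd j hj
    have hc := h2 i hi hodd.add_one
    cases hx : g i with
    | poly v =>
      rw [hx] at hc hj
      rcases hj with hj | hj
      · cases hj
      · rw [hj] at hc; exact absurd hc id
    | face j₁ =>
      cases hy : g (i + 1) with
      | poly v => rw [hx, hy] at hc; exact absurd hc id
      | face j₂ =>
        rw [hx, hy] at hj
        rcases hj with hj | hj
        · cases hj; exact Set.left_mem_uIcc
        · cases hj; exact Set.right_mem_uIcc
  have arc_symm : ∀ x y : AuxVertex n, L.arcPos x y = L.arcPos y x := by
    intro x y
    cases x <;> cases y <;> simp only [arcPos]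
    · simp only [Finset.pair_comm]
    · exact Set.uIcc_comm _ _
  have arc_eq : ∀ s t, s(g s, g (s + 1)) = s(g t, g (t + 1)) →
      L.arcPos (g s) (g (s + 1)) = L.arcPos (g t) (g (t + 1)) := by
    intro s t hst
    rcases Sym2.eq_iff.mp hst with ⟨e1, e2⟩ | ⟨e1, e2⟩
    · rw [e1, e2]
    · rw [e1, e2, arc_symm]
  have arc_disj : ∀ s t, s < t → t < N → ∀ p, p ∈ L.arcPos (g s) (g (s + 1)) →
      p ∉ L.arcPos (g t) (g (t + 1)) := fun s t hst ht p hp hp' =>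
    lt_irrefl _ (h7 s t hst ht p hp p hp')
  have face_unique : ∀ s t, s < t → t < N → Odd s → Odd t → ∀ j,
      (g s = .face j ∨ g (s + 1) = .face j) → ¬ (g t = .face j ∨ g (t + 1) = .face j) :=
    fun s t hst ht hs' ht' j h1 h2 => arc_disj s t hst ht _ (cross_face s (by omega) hs' j h1)
      (cross_face t ht ht' j h2)
  have step_diag : ∀ i < N, Odd i → ∀ v, (g i = .poly v ∨ g (i + 1) = .poly v) →
      ∃ k, v ∈ L.diag k ∧ 2 * k.val + 1 ∈ L.arcPos (g i) (g (i + 1)) := by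
    rintro i hi hodd v (hv | hv)
    · obtain ⟨v', k, hv', hk⟩ := cross_poly i hi hodd v hv
      exact ⟨k, by simp [hk], by rw [hv, hv']; exact ⟨k, hk, rfl⟩⟩
    · obtain ⟨v', k, hv', hk⟩ := cross_poly' i hi hodd v hv
      exact ⟨k, by simp [hk], by rw [hv, hv']; exact ⟨k, by rw [hk, Finset.pair_comm], rfl⟩⟩
  have poly_pos : ∀ i < N, Odd i → ∀ v, (g i = .poly v ∨ g (i + 1) = .poly v) →
      ∀ p p', p ∈ L.arcPos (g i) (g (i + 1)) → p' ∈ L.arcPos (g i) (g (i + 1)) → p = p' := by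
    rintro i hi hodd v hv p p' hp hp'
    obtain ⟨u, u', k, hu, hu', hk⟩ : ∃ u u' k, g i = .poly u ∧ g (i + 1) = .poly u' ∧
        L.diag k = {u, u'} := by
      rcases hv with hv | hv
      · obtain ⟨v', k, hv', hk⟩ := cross_poly i hi hodd v hv
        exact ⟨v, v', k, hv, hv', hk⟩
      · obtain ⟨v', k, hv', hk⟩ := cross_poly' i hi hodd v hv
        exact ⟨v', v, k, hv', hv, by rw [hk, Finset.pair_comm]⟩
    rw [hu, hu', h.chain.mem_arcPos hk] at hp hp'
    rw [hp, hp']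
  -- The diagonals at a vertex are consecutive.
  have mid : ∀ x (m₀ m m₂ : Fin n), x ∈ L.diag m₀ → x ∈ L.diag m₂ → m₀.val ≤ m.val →
      m.val ≤ m₂.val → x ∈ L.diag m := by
    intro x m₀ m m₂ hx hx₂ hle hle₂
    have f₀ := (mem_face_of_mem_diag hx).1
    have f₂ := (mem_face_of_mem_diag hx₂).2
    exact Finset.mem_inter.mpr
      ⟨h.labelling.mem_face_of_le_of_le hT f₀ f₂ _ (Fin.le_def.mpr (by simpa using hle))
        (Fin.le_def.mpr (by simp; omega)),
      h.labelling.mem_face_of_le_of_le hT f₀ f₂ _ (Fin.le_def.mpr (by simp; omega))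
        (Fin.le_def.mpr (by simpa using hle₂))⟩
  intro s t hst htN heq
  have hsN : s < N := by omega
  have last_face : ∀ i ≤ N, ∀ j, g i = .face j → i < N := by
    intro i hi j hj
    rcases hi.eq_or_lt with rfl | hi
    · rw [gN] at hj; cases hj
    · exact hi
  have ht_mem : ∀ z, (g s = z ∨ g (s + 1) = z) → (g t = z ∨ g (t + 1) = z) := by
    intro z hz
    rcases Sym2.eq_iff.mp heq with ⟨e1, e2⟩ | ⟨e1, e2⟩
    · rwa [e1, e2] at hz
    · rw [e1, e2] at hz; exact hz.symm
  -- Both uses of a repeated edge meet the arc at the same positions, against the strict order. So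
  -- the edge does not meet the arc at all, and both indices are even.
  have no_pos : ∀ p, p ∉ L.arcPos (g s) (g (s + 1)) := fun p hp =>
    arc_disj s t hst htN p hp (arc_eq s t heq ▸ hp)
  have hs_even : Even s := by
    by_contra hs
    rw [Nat.not_even_iff_odd] at hs
    cases hx : g s with
    | poly v =>
      obtain ⟨k, -, hk⟩ := step_diag s hsN hs v (Or.inl hx)
      exact no_pos _ hk
    | face j => exact no_pos _ (cross_face s hsN hs j (Or.inl hx))
  have ht_even : Even t := by
    by_contra ht
    rw [Nat.not_even_iff_odd] at ht
    cases hx : g t with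
    | poly v =>
      obtain ⟨k, -, hk⟩ := step_diag t htN ht v (Or.inl hx)
      exact no_pos _ ((arc_eq s t heq).symm ▸ hk)
    | face j => exact no_pos _ ((arc_eq s t heq).symm ▸ cross_face t htN ht j (Or.inl hx))
  have hst2 : s + 2 ≤ t := by
    rcases hs_even with ⟨s', rfl⟩
    rcases ht_even with ⟨t', rfl⟩
    omega
  have ht_odd : Odd (t - 1) := by
    rcases ht_even with ⟨t', rfl⟩
    exact ⟨t' - 1, by omega⟩
  have ht1 : t - 1 + 1 = t := by omega
  -- the steps next to a step that ends at an internal vertex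
  have t_face : ∀ j, (g t = .face j ∨ g (t + 1) = .face j) →
      ∃ t' < N, Odd t' ∧ (t' = t - 1 ∧ g t = .face j ∨ t' = t + 1) ∧
        (g t' = .face j ∨ g (t' + 1) = .face j) := by
    rintro j (hj | hj)
    · exact ⟨t - 1, by omega, ht_odd, Or.inl ⟨rfl, hj⟩, Or.inr (by rw [ht1, hj])⟩
    · exact ⟨t + 1, last_face _ (by omega) j hj, ht_even.add_one, Or.inr rfl, Or.inl hj⟩
  cases hx : g s with
  | face j =>
    obtain ⟨t', ht', hodd, hcase, hj⟩ := t_face j (ht_mem _ (Or.inl hx))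
    have hs0 : s ≠ 0 := by rintro rfl; rw [g0] at hx; cases hx
    have hs1 : s - 1 + 1 = s := by omega
    have hs_odd : Odd (s - 1) := by
      rcases hs_even with ⟨s', rfl⟩
      exact ⟨s' - 1, by omega⟩
    exact face_unique (s - 1) t' (by omega) ht' hs_odd hodd j (Or.inr (by rw [hs1, hx])) hj
  | poly x =>
    cases hy : g (s + 1) with
    | face j =>
      obtain ⟨t', ht', hodd, hcase, hj⟩ := t_face j (ht_mem _ (Or.inr hy))
      rcases Nat.lt_or_ge (s + 1) t' with hlt | hge
      · exact face_unique (s + 1) t' hlt ht' hs_even.add_one hodd j (Or.inl hy) hj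
      · have ht2 : t = s + 1 + 1 := by omega
        have hgt : g t = .face j := by
          rcases hcase with ⟨-, h'⟩ | h'
          · exact h'
          · omega
        have := hadj (s + 1) (by omega)
        rw [← ht2, hy, hgt] at this
        exact this rfl
    | poly y =>
      have nd : ∀ k, L.diag k ≠ {x, y} := by
        intro k hk
        refine no_pos (2 * k.val + 1) ?_
        rw [hx, hy]
        exact ⟨k, hk, rfl⟩
      have hxy : D.T.Adj x y := by
        have := hadj s hsN
        rwa [hx, hy] at this
      have nboth : ∀ k, x ∈ L.diag k → y ∉ L.diag k := by
        intro k hxk hyk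
        refine nd k (Finset.eq_of_subset_of_card_le ?_ ?_).symm
        · intro z hz
          simp only [Finset.mem_insert, Finset.mem_singleton] at hz
          rcases hz with rfl | rfl <;> assumption
        · rw [h.labelling.card_diag, Finset.card_pair hxy.ne]
      -- The remaining case is a repeated side `x y`. After its first use the path crosses a
      -- diagonal at `y`. Diagonals at `x` are crossed no later and no earlier, respectively, unless
      -- `x` is `a` or `b`; so `x` lies on that diagonal too, and `x y` would be a diagonal.
      obtain ⟨m, hym, hm⟩ := step_diag (s + 1) (by omega) hs_even.add_one y (Or.inl hy)
      have before : x = a ∨ ∃ m₀ : Fin n, x ∈ L.diag m₀ ∧ m₀.val ≤ m.val := by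
        rcases Nat.eq_zero_or_pos s with rfl | hs0
        · rw [g0] at hx; cases hx; exact Or.inl rfl
        · have hs1 : s - 1 + 1 = s := by omega
          have hs_odd : Odd (s - 1) := by
            rcases hs_even with ⟨s', rfl⟩
            exact ⟨s' - 1, by omega⟩
          obtain ⟨m₀, hxm, hm₀⟩ := step_diag (s - 1) (by omega) hs_odd x (Or.inr (by rw [hs1, hx]))
          have := h7 (s - 1) (s + 1) (by omega) (by omega) _ hm₀ _ hm
          exact Or.inr ⟨m₀, hxm, by omega⟩
      have after : x = b ∨ ∃ m₂ : Fin n, x ∈ L.diag m₂ ∧ m.val ≤ m₂.val := by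
        rcases ht_mem _ (Or.inl hx) with hz | hz
        · obtain ⟨m₂, hxm, hm₂⟩ := step_diag (t - 1) (by omega) ht_odd x (Or.inr (by rw [ht1, hz]))
          refine Or.inr ⟨m₂, hxm, ?_⟩
          rcases (show s + 1 ≤ t - 1 by omega).eq_or_lt with heq' | hlt
          · have := poly_pos (t - 1) (by omega) ht_odd x (Or.inr (by rw [ht1, hz])) _ _ hm₂
              (heq' ▸ hm)
            omega
          · have := h7 (s + 1) (t - 1) hlt (by omega) _ hm _ hm₂
            omega
        · rcases (show t + 1 ≤ N by omega).eq_or_lt with heq' | hlt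
          · rw [heq', gN] at hz; cases hz; exact Or.inl rfl
          · obtain ⟨m₂, hxm, hm₂⟩ := step_diag (t + 1) hlt ht_even.add_one x (Or.inl hz)
            have := h7 (s + 1) (t + 1) (by omega) hlt _ hm _ hm₂
            exact Or.inr ⟨m₂, hxm, by omega⟩
      rcases before with rfl | ⟨m₀, hx₀, hle₀⟩
      · rcases after with rfl | ⟨m₂, hx₂, -⟩
        · have := h.chain.right m
          simp only [sbtw_iff] at this
          omega
        · exact h.notMem_diag_left m₂ hx₂
      · rcases after with rfl | ⟨m₂, hx₂, hle₂⟩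
        · exact h.notMem_diag_right m₀ hx₀
        · exact nboth m (mid x m₀ m m₂ hx₀ hx₂ hle₀ hle₂) hym

/-- The restriction of the order condition to crossing steps is immaterial, since only such steps
have positions on the arc, and `edges_nodup` supplies the condition on repeated edges. -/
theorem IsSetup.isTwistedPath_iff (h : IsSetup L D a b r l q)
    (w : (L.auxGraph D.T).Walk (.poly a) (.poly b)) :
    L.IsTwistedPath w ↔ L.IsPathEnd a (b := b) 1 0 w := by
  have arc_crosses : ∀ x y p, p ∈ L.arcPos x y → CrossesArc a b x y := by
    rintro (u | i) (v | j) p hp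
    · obtain ⟨k, hk, -⟩ := hp
      exact h.chain.crosses hk
    · exact absurd hp (Set.notMem_empty _)
    · exact absurd hp (Set.notMem_empty _)
    · trivial
  constructor
  · rintro ⟨-, h2, h3, h4, h5, h6, h7⟩
    refine ⟨by rw [add_comm]; exact h2.add_one, h3, h4, h5, h6, fun _ _ _ _ => Nat.zero_le _, ?_⟩
    intro i j hij hj p hp p' hp'
    exact h7 i j hij hj (arc_crosses _ _ _ hp) (arc_crosses _ _ _ hp') p hp p' hp'
  · intro h'
    refine ⟨h.edges_nodup h', ?_, h'.crosses, h'.forward, h'.sigma, h'.tau,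
      fun i j hij hj _ _ => h'.ordered i j hij hj⟩
    have := h'.even_length
    rwa [add_comm, Nat.even_add_one, Nat.not_even_iff_odd] at this

/-- The twisted paths are given by the accepted words. -/
theorem IsSetup.image_twistedPaths (h : IsSetup L D a b r l q) :
    (fun w => w.support.tail) '' L.twistedPaths D.T a b =
      {t | Accepts (IsFinal b) (L.StepOK a b D.T) L.nextState t ⟨0, true, .poly a⟩} := by
  ext t
  constructor
  · rintro ⟨w, hw, rfl⟩
    exact (h.accepts_iff w rfl 1 0).mpr ((h.isTwistedPath_iff w).mp hw)
  · intro ht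
    obtain ⟨w, rfl⟩ := exists_walk ht
    exact ⟨w, (h.isTwistedPath_iff w).mpr ((h.accepts_iff w rfl 1 0).mp ht), rfl⟩

theorem support_tail_injective {V : Type*} {G : SimpleGraph V} {u v : V} :
    Function.Injective fun w : G.Walk u v => w.support.tail := by
  intro w w' hw
  refine SimpleGraph.Walk.ext_support ?_
  rw [← SimpleGraph.Walk.cons_tail_support w, ← SimpleGraph.Walk.cons_tail_support w']
  exact congrArg _ hw

theorem IsSetup.finite_twistedPaths (h : IsSetup L D a b r l q) :
    (L.twistedPaths D.T a b).Finite := by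
  refine Set.Finite.of_finite_image ?_ support_tail_injective.injOn
  rw [h.image_twistedPaths]
  exact h.finite_accepts _

end Labelling

end SuperTeich

end

/-! ### Weights: from the positive order to a product over the steps. -/

noncomputable section

namespace SuperTeich

namespace Labelling

variable {M : Type*} [AddCommGroup M] [Module ℝ M] {n : ℕ} (L : Labelling n)
  (D : DecoratedTriangulation (n + 3) M)

/-- The triangles whose `μ`-invariants occur in the weight of a walk. -/
def oddFaces {x y : AuxVertex n} (w : (L.auxGraph D.T).Walk x y) : List (Fin (n + 1)) :=
  (List.range w.length).filterMap fun i => sigmaFace (w.getVert i) (w.getVert (i + 1))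

/-- The even part of the weight of a walk whose first step has number `m`. -/
def evenProd (m : ℕ) {x y : AuxVertex n} (w : (L.auxGraph D.T).Walk x y) : ExteriorAlgebra ℝ M :=
  ((List.range w.length).map
    fun i => L.evenFactor D (i + m) (w.getVert i) (w.getVert (i + 1))).prod

open Classical in
/-- The product of `μ`-invariants in the positive order. -/
def sortedProd (t : List (Fin (n + 1))) : ExteriorAlgebra ℝ M :=
  ((t.insertionSort (L.PosGT D.dir)).map fun s => D.mu (L.face s)).prod

variable {L D} {a b : Fin (n + 3)} {r l q : Fin n → Fin (n + 3)}

theorem oddFaces_cons {x z y : AuxVertex n} (h : (L.auxGraph D.T).Adj x z)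
    (w : (L.auxGraph D.T).Walk z y) :
    L.oddFaces D (.cons h w) = (sigmaFace x z).toList ++ L.oddFaces D w := by
  simp only [oddFaces, SimpleGraph.Walk.length_cons, List.range_succ_eq_map, List.filterMap_cons,
    List.filterMap_map, SimpleGraph.Walk.getVert_zero, SimpleGraph.Walk.getVert_cons_succ]
  cases sigmaFace x z <;> rfl

theorem evenProd_cons (m : ℕ) {x z y : AuxVertex n} (h : (L.auxGraph D.T).Adj x z)
    (w : (L.auxGraph D.T).Walk z y) :
    L.evenProd D m (.cons h w) = L.evenFactor D m x z * L.evenProd D (m + 1) w := by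
  simp only [evenProd, SimpleGraph.Walk.length_cons, List.range_succ_eq_map, List.map_cons,
    List.map_map, List.prod_cons, SimpleGraph.Walk.getVert_zero, zero_add,
    SimpleGraph.Walk.getVert_cons_succ]
  congr 3
  funext i
  simp only [Function.comp_apply, SimpleGraph.Walk.getVert_cons_succ, Nat.succ_eq_add_one]
  rw [add_assoc, add_comm 1 m]

theorem twt_eq (w : (L.auxGraph D.T).Walk (.poly a) (.poly b)) :
    L.twt D w = L.evenProd D 1 w * L.sortedProd D (L.oddFaces D w) := rfl

open Classical in
-- Compared with all later triangles, `θ_i` is either the greatest and stays in front, or the least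
-- and is sorted to the end; in the second case moving its μ-invariant back to the front passes
-- `t.length` odd factors.
theorem sortedProd_cons (hmu : ∀ k, IsOdd (D.mu (L.face k))) {i : Fin (n + 1)}
    {t : List (Fin (n + 1))} (h : ∀ f ∈ t, i < f) :
    L.sortedProd D (i :: t) =
      (if ∃ k : Fin n, k.castSucc = i ∧ L.OnRight D.dir k then 1 else (-1) ^ t.length) *
        (D.mu (L.face i) * L.sortedProd D t) := by
  have hmem : ∀ f ∈ t.insertionSort (L.PosGT D.dir), i < f := fun f hf =>
    h f ((List.perm_insertionSort _ t).mem_iff.mp hf)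
  rw [sortedProd, List.insertionSort_cons]
  by_cases hk : ∃ k : Fin n, k.castSucc = i ∧ L.OnRight D.dir k
  · rw [orderedInsert_of_forall, if_pos hk, one_mul]
    · rfl
    · intro f hf
      obtain ⟨k, hk1, hk2⟩ := hk
      exact Or.inl ⟨k, hk1, hmem f hf, hk2⟩
  · rw [orderedInsert_of_forall_not, if_neg hk, List.map_append, List.prod_append]
    · rw [List.map_singleton, List.prod_singleton, prod_mul_odd (hmu i), List.length_map,
        List.length_insertionSort]
      · rfl
      · intro y hy
        obtain ⟨s, -, rfl⟩ := List.mem_map.mp hy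
        exact hmu s
    · rintro f hf (⟨k, hk1, -, hk2⟩ | ⟨k, -, hlt, -⟩)
      · exact hk ⟨k, hk1, hk2⟩
      · exact absurd hlt (hmem f hf).not_gt

/-- The positions and the parity of the triangles in the weight of the end of a path. -/
def OddFacesOK (m p : ℕ) (x : AuxVertex n) (t : List (Fin (n + 1))) : Prop :=
  match x with
  | .poly _ => (∀ f ∈ t, p ≤ 2 * f.val) ∧ Even t.length
  | .face i => (Even m → p ≤ 2 * i.val ∧ ∀ f ∈ t, i < f) ∧ (Odd m → ∀ f ∈ t, i ≤ f) ∧ Odd t.length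

/-- σ-edges come in pairs joined by a τ-edge, so the number of triangles still to come is even at a
polygon vertex and odd at an internal one; as τ-edges go forward, the later triangles have larger
indices. -/
theorem IsSetup.oddFacesOK (h : IsSetup L D a b r l q) {x y : AuxVertex n}
    (w : (L.auxGraph D.T).Walk x y) (hy : y = .poly b) {m p : ℕ}
    (hw : L.IsPathEnd a (b := b) m p w) (hp : ∀ j, x = .face j → Odd m → 2 * j.val + 1 ≤ p) :
    OddFacesOK m p x (L.oddFaces D w) := by
  induction w generalizing m p with
  | nil =>
    subst hy
    exact ⟨by simp [oddFaces], by simp [oddFaces]⟩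
  | @cons x z y hxz w ih =>
    obtain ⟨hs, hw'⟩ := (h.isPathEnd_cons hxz w).mp hw
    have ih := ih hy hw'
    have hadv := ((h.le_advance_iff p _ x z).mp le_rfl).1
    rw [oddFaces_cons]
    cases x with
    | poly u =>
      cases z with
      | poly v =>
        obtain ⟨h1, h2⟩ := ih (by simp)
        exact ⟨fun f hf => hadv.trans (h1 f hf), h2⟩
      | face i =>
        have hm : Odd m := by simpa using hs.sigma trivial
        obtain ⟨h1, -, h3⟩ := ih fun j _ hj => by
          rw [Nat.odd_add_one] at hj; exact absurd hm hj
        obtain ⟨h4, h5⟩ := h1 hm.add_one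
        have h4 : p ≤ 2 * i.val := h4
        refine ⟨?_, ?_⟩
        · intro f hf
          rcases List.mem_cons.mp hf with rfl | hf
          · exact h4
          · have : i.val < f.val := h5 f hf
            omega
        · exact h3.add_one
    | face i =>
      cases z with
      | poly v =>
        have hm : Odd m := by simpa using hs.sigma trivial
        have hp' := hp i rfl hm
        obtain ⟨h1, h2⟩ := ih (by simp)
        refine ⟨fun h => absurd hm (Nat.not_odd_iff_even.mpr h), fun _ => ?_, h2.add_one⟩
        intro f hf
        rcases List.mem_cons.mp hf with rfl | hf
        · exact le_rfl
        · have : p ≤ 2 * f.val := h1 f hf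
          exact Fin.le_def.mpr (by omega)
      | face j =>
        have hm : ¬ Odd m := by simpa using hs.tau trivial
        have hij : i < j := hs.forward
        obtain ⟨-, h2, h3⟩ := ih fun j' hj' _ => by
          cases hj'
          exact le_trans (by have : i.val < j.val := hij; omega) (le_max_right p _)
        refine ⟨fun _ => ⟨hs.pos_le _ Set.left_mem_uIcc, fun f hf => ?_⟩, fun h => absurd h hm, h3⟩
        exact hij.trans_le (h2 (Nat.odd_add_one.mpr hm) f hf)

theorem isEven_gsqrt (x : ExteriorAlgebra ℝ M) : IsEven (gsqrt x) := by
  rw [gsqrt]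
  split_ifs with h
  · exact h.choose_spec.1.1
  · exact Submodule.zero_mem _

theorem isEven_evenFactor (hD : D.IsValid) (m : ℕ) {x z : AuxVertex n} (h : L.AuxAdj D.T x z) :
    IsEven (L.evenFactor D m x z) := by
  cases x with
  | poly u =>
    cases z with
    | poly v =>
      obtain ⟨c, hc, hp⟩ := exists_coe_of_isPositive (hD.lam_pos u v h)
      simp only [evenFactor]
      split_ifs
      · rw [hc]; exact c.2
      · rw [hc, inverse_coe hp]; exact (Ring.inverse c).2
    | face i => exact isEven_gsqrt _
  | face i =>
    cases z with
    | poly v => exact isEven_gsqrt _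
    | face j => exact (1 : Ev M).2

theorem evenFactor_parity (m : ℕ) (x z : AuxVertex n) :
    L.evenFactor D (if decide (Odd m) = true then 1 else 2) x z = L.evenFactor D m x z := by
  cases x <;> cases z <;> simp only [evenFactor]
  by_cases hm : Odd m <;> simp [hm]

/-- At the first σ-edge of a pair an odd number of μ-invariants follows, so sorting contributes 1 or
-1, which is `faceUnit`; at the second an even number follows and no sign arises. The even factors
are central and can be interleaved with the odd ones. -/
theorem IsSetup.evenProd_mul_sortedProd (h : IsSetup L D a b r l q) {x y : AuxVertex n}
    (w : (L.auxGraph D.T).Walk x y) (hy : y = .poly b) {m p : ℕ}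
    (hw : L.IsPathEnd a (b := b) m p w) (hp : ∀ j, x = .face j → Odd m → 2 * j.val + 1 ≤ p) :
    IsEven (L.evenProd D m w) ∧
      L.evenProd D m w * L.sortedProd D (L.oddFaces D w) =
        wordWeight L.nextState (L.stepWeight D) w.support.tail ⟨p, decide (Odd m), x⟩ := by
  classical
  have hmu : ∀ k, IsOdd (D.mu (L.face k)) := fun k => h.valid.mu_odd _ (h.labelling.isNClique k)
  induction w generalizing m p with
  | nil =>
    refine ⟨(1 : Ev M).2, ?_⟩
    simp [evenProd, oddFaces, sortedProd, wordWeight]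
  | @cons x z y hxz w ih =>
    obtain ⟨hs, hw'⟩ := (h.isPathEnd_cons hxz w).mp hw
    have hp' : ∀ j, z = .face j → Odd (m + 1) → 2 * j.val + 1 ≤ L.advance p x z := by
      rintro j rfl hm
      cases x with
      | poly u =>
        have : Odd m := by simpa using hs.sigma trivial
        rw [Nat.odd_add_one] at hm
        exact absurd this hm
      | face i =>
        have hij : i.val < j.val := hs.forward
        exact le_trans (by omega) (le_max_right p _)
    obtain ⟨ih1, ih2⟩ := ih hy hw' hp'
    have hOK := h.oddFacesOK w hy hw' hp'
    have hOK' := h.oddFacesOK _ hy hw hp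
    have hef := isEven_evenFactor h.valid m (L := L) (show L.AuxAdj D.T x z from hxz)
    have hprod : IsEven (L.evenProd D m (.cons hxz w)) := by
      rw [evenProd_cons]
      exact ((⟨_, hef⟩ : Ev M) * ⟨_, ih1⟩).2
    refine ⟨hprod, ?_⟩
    have hword : wordWeight L.nextState (L.stepWeight D)
        (SimpleGraph.Walk.cons hxz w).support.tail ⟨p, decide (Odd m), x⟩ =
        L.evenFactor D m x z * L.oddFactor D x z *
          (L.evenProd D (m + 1) w * L.sortedProd D (L.oddFaces D w)) := by
      rw [ih2, SimpleGraph.Walk.support_cons, List.tail_cons,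
        ← SimpleGraph.Walk.cons_tail_support]
      rw [wordWeight, stepWeight, nextState]
      simp only [SimpleGraph.Walk.cons_tail_support, Nat.odd_add_one, decide_not]
      rw [evenFactor_parity]
    have hsort : L.sortedProd D (L.oddFaces D (.cons hxz w)) =
        L.oddFactor D x z * L.sortedProd D (L.oddFaces D w) := by
      rw [oddFaces_cons]
      cases x with
      | poly u =>
        cases z with
        | poly v => simp [sigmaFace, oddFactor]
        | face i =>
          have hm : Odd m := by simpa using hs.sigma trivial
          obtain ⟨h1, -, h3⟩ := hOK
          rw [sigmaFace, Option.toList_some, List.singleton_append,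
            sortedProd_cons hmu (h1 hm.add_one).2, oddFactor, faceUnit, h3.neg_one_pow, mul_assoc]
          split_ifs <;> simp
      | face i =>
        cases z with
        | poly v =>
          have hm : Odd m := by simpa using hs.sigma trivial
          have hp' := hp i rfl hm
          obtain ⟨h1, h2⟩ := hOK
          rw [sigmaFace, Option.toList_some, List.singleton_append, sortedProd_cons hmu, oddFactor,
            h2.neg_one_pow, ite_self, one_mul]
          intro f hf
          have : p ≤ 2 * f.val := h1 f hf
          exact Fin.lt_def.mpr (by omega)
        | face j => simp [sigmaFace, oddFactor]
    rw [hword, hsort, evenProd_cons, mul_assoc, mul_assoc]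
    congr 1
    rw [← mul_assoc, ← mul_assoc, (IsEven.commute ih1 _).eq]

theorem IsSetup.finsum_twt (h : IsSetup L D a b r l q) :
    ∑ᶠ w ∈ L.twistedPaths D.T a b, L.twt D w = L.pathSum D a b ⟨0, true, .poly a⟩ := by
  rw [pathSum, accSum, ← h.image_twistedPaths, finsum_mem_image support_tail_injective.injOn]
  refine finsum_mem_congr rfl fun w hw => ?_
  rw [twt_eq, (h.evenProd_mul_sortedProd w rfl ((h.isTwistedPath_iff w).mp hw) (by simp)).2]
  rfl

end Labelling

theorem pos_of_not_isSide {n : ℕ} {a b : Fin (n + 3)} (hne : a ≠ b) (hab : ¬ IsSide a b) :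
    0 < n := by
  rcases Nat.eq_zero_or_pos n with rfl | hn
  · exfalso
    revert hne hab
    unfold IsSide
    revert a b
    decide
  · exact hn

end SuperTeich

end

theorem theorem7p3 {M : Type*} [AddCommGroup M] [Module ℝ M] (n : ℕ)
    (D : DecoratedTriangulation (n + 3) M) (hD : D.IsValid)
    (a b : Fin (n + 3)) (hne : a ≠ b) (hab : ¬ IsSide a b)
    (hcross : ∀ i j, D.T.Adj i j → ¬ IsSide i j → Crosses a b i j)
    (L : Labelling n) (hL : L.IsLabelling D.T a b) (hdir : L.IsDefault D.dir) :
    (L.twistedPaths D.T a b).Finite ∧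
      ∀ x : ExteriorAlgebra ℝ M,
        D.IsLambdaLength a b x ↔ x = ∑ᶠ w ∈ L.twistedPaths D.T a b, L.twt D w := by
  have hn := pos_of_not_isSide hne hab
  obtain ⟨r, l, q, hC⟩ := hL.exists_isChain hD.triangulation hcross
  have hS : Labelling.IsSetup L D a b r l q := ⟨hn, hD, hL, hdir, hC⟩
  obtain ⟨u, hu⟩ := hC.exists_realizes hn hD hL hdir
  refine ⟨hS.finite_twistedPaths, fun x => ?_⟩
  rw [hC.isLambdaLength_iff hn hL hu, hS.finsum_twt, hS.pathSum_start hu]
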